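/- Let $Q$ be a quiver of type $A_3$ (any orientation of the graph $1 - 2 - 3$), let $\Pi=\Pi(Q)$ be its preprojective algebra over $\mathbb{C}$, and let $W$ be its Weyl group with simple reflections $s_1,s_2,s_3$. For a vertex $i$ and a $\Pi$-module $M$ let $\mathrm{soc}_i(M)$ be the $S_i$-isotypic part of the socle of $M$, where $S_i$ is the simple module at $i$. For $u\in W$ let $(\mathcal{C}_u,\mathcal{C}^u)$ be the torsion pair in the category of finite dimensional $\Pi$-modules attached to $u$: for a reduced expression $u=s_{i_1}\cdots s_{i_r}$ the torsion-free class $\mathcal{C}^u$ consists, up to isomorphism, of the modules obtained from finite dimensional modules by successively dividing out $\mathrm{soc}_{i_1},\mathrm{soc}_{i_2},\dots,\mathrm{soc}_{i_r}$, and the torsion class $\mathcal{C}_u$ consists of the finite dimensional modules $M$ with $\mathrm{Hom}_\Pi(M,N)=0$ for all $N\in\mathcal{C}^u$. Let $t_u(M)$ be the largest submodule of $M$ in $\mathcal{C}_u$ and $f_u(M)=M/t_u(M)$. Let $w=s_1s_3s_2s_1s_3$ and $v=s_2$, put $\Pi_w:=\mathrm{End}_\Pi(t_w(\Pi))$ and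 $\Pi_{v,w}:=\mathrm{End}_\Pi(f_vt_w(\Pi))$, and let $\varphi_2\colon \Pi_w\to\Pi_{v,w}$ be the homomorphism of $\mathbb{C}$-algebras induced by the functor $f_v$. Then: 1. $\varphi_2$ is injective, and its cokernel as a map of vector spaces is isomorphic to $\mathbb{C}$; in particular $\varphi_2$ is not surjective. 2. $\Pi_{v,w}$ is isomorphic to the Auslander algebra of the preprojective algebra $\Pi(A_2)$ over $\mathbb{C}$, that is, to the endomorphism algebra of the direct sum of a finite complete list of pairwise non-isomorphic finite dimensional indecomposable $\Pi(A_2)$-modules. 3. $\Pi_{v,w}$ has (left and right) global dimension $2$, and it is an Iwanaga-Gorenstein ring of virtual dimension $2$: it is two-sided noetherian, and its injective dimensions as a left and as a right module over itself are both equal to $2$. -/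

import Mathlib

/-! ### Finite quivers, preprojective algebras, Weyl groups -/

/-- A finite quiver with vertex set `V` and arrow set `E`: every arrow has a source and a target. -/
structure FinQuiver (V E : Type) where
  src : E → V
  tgt : E → V

namespace FinQuiver

/-- The quivers of type `A_(n+1)`: the vertices are `0, …, n`, there is exactly one arrow between
`i` and `i + 1` for every `i < n`, and the sign `o i` says in which direction it points. -/
def typeA (n : ℕ) (o : Fin n → Bool) : FinQuiver (Fin (n + 1)) (Fin n) where
  src e := if o e then e.castSucc else e.succ
  tgt e := if o e then e.succ else e.castSucc

variable {V E : Type} [Fintype V] [DecidableEq V] [Fintype E]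

/-- The arrows between `i` and `j`, in either direction. -/
def edgesBetween (Q : FinQuiver V E) (i j : V) : Finset E :=
  Finset.univ.filter fun e => (Q.src e = i ∧ Q.tgt e = j) ∨ (Q.src e = j ∧ Q.tgt e = i)

/-- The order of `s_i s_j` in the Weyl group of `Q`, for `i ≠ j`, in terms of the number of edges
between `i` and `j` (`0` stands for infinite order). -/
def coxeterEntry : ℕ → ℕ
  | 0 => 2
  | 1 => 3
  | _ => 0

/-- The Coxeter matrix of the underlying graph of `Q`. -/
def coxeterMatrix (Q : FinQuiver V E) : CoxeterMatrix V where
  M := Matrix.of fun i j => if i = j then 1 else coxeterEntry (Q.edgesBetween i j).card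
  isSymm := by
    ext i j
    have h : Q.edgesBetween j i = Q.edgesBetween i j := by
      ext e
      simp only [edgesBetween, Finset.mem_filter]
      tauto
    simp only [Matrix.transpose_apply, Matrix.of_apply, h, eq_comm]
  diagonal := by
    intro i
    simp
  off_diagonal := by
    intro i j hij
    simp only [Matrix.of_apply, if_neg hij]
    generalize (Q.edgesBetween i j).card = m
    rcases m with _ | _ | m <;> simp [coxeterEntry]

/-- The Weyl group of `Q`. -/
abbrev Weyl (Q : FinQuiver V E) : Type := Q.coxeterMatrix.Group

/-- The Weyl group with its simple reflections `s_i`. -/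
abbrev cox (Q : FinQuiver V E) : CoxeterSystem Q.coxeterMatrix Q.Weyl :=
  Q.coxeterMatrix.toCoxeterSystem

/-- Generators of the path algebra of the double of `Q`: the trivial paths, the arrows `a`, and
the opposite arrows `a*`. -/
inductive PreprojGen (V E : Type) : Type
  | vertex (i : V)
  | arrow (a : E)
  | dual (a : E)

section Relations

variable (k : Type) [Field k]

open FreeAlgebra in
/-- The relations of the path algebra of the double of `Q` (paths are composed like maps, so that
left modules are representations), together with the preprojective relation
`∑ a a* = ∑ a* a`. -/
inductive PreprojRel (Q : FinQuiver V E) :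
    FreeAlgebra k (PreprojGen V E) → FreeAlgebra k (PreprojGen V E) → Prop
  | vertex_idem (i : V) :
      PreprojRel Q (ι k (.vertex i) * ι k (.vertex i)) (ι k (.vertex i))
  | vertex_orth (i j : V) (h : i ≠ j) :
      PreprojRel Q (ι k (.vertex i) * ι k (.vertex j)) 0
  | vertex_sum :
      PreprojRel Q (∑ i : V, ι k (.vertex i)) 1
  | tgt_arrow (a : E) :
      PreprojRel Q (ι k (.vertex (Q.tgt a)) * ι k (.arrow a)) (ι k (.arrow a))
  | arrow_src (a : E) :
      PreprojRel Q (ι k (.arrow a) * ι k (.vertex (Q.src a))) (ι k (.arrow a))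
  | src_dual (a : E) :
      PreprojRel Q (ι k (.vertex (Q.src a)) * ι k (.dual a)) (ι k (.dual a))
  | dual_tgt (a : E) :
      PreprojRel Q (ι k (.dual a) * ι k (.vertex (Q.tgt a))) (ι k (.dual a))
  | preproj :
      PreprojRel Q (∑ a : E, ι k (.arrow a) * ι k (.dual a))
        (∑ a : E, ι k (.dual a) * ι k (.arrow a))

/-- The preprojective algebra `Π(Q)` over `k`. -/
def Preproj (Q : FinQuiver V E) : Type := RingQuot (PreprojRel k Q)

noncomputable instance (Q : FinQuiver V E) : Ring (Preproj k Q) :=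
  inferInstanceAs (Ring (RingQuot (PreprojRel k Q)))

noncomputable instance (Q : FinQuiver V E) : Algebra k (Preproj k Q) :=
  inferInstanceAs (Algebra k (RingQuot (PreprojRel k Q)))

/-- The image of a generator in `Π(Q)`. -/
noncomputable def Preproj.gen (Q : FinQuiver V E) (g : PreprojGen V E) : Preproj k Q :=
  RingQuot.mkAlgHom k (PreprojRel k Q) (FreeAlgebra.ι k g)

/-- The left ideal generated by `1 - e_i` and by all arrows of the double of `Q`. -/
noncomputable def simpleIdeal (Q : FinQuiver V E) (i : V) : Ideal (Preproj k Q) :=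
  Ideal.span ({1 - Preproj.gen k Q (.vertex i)} ∪
    (Set.range fun a => Preproj.gen k Q (.arrow a)) ∪
    (Set.range fun a => Preproj.gen k Q (.dual a)))

/-- The one-dimensional simple `Π(Q)`-module `S_i` at the vertex `i`. -/
abbrev SimpleAt (Q : FinQuiver V E) (i : V) : Type := Preproj k Q ⧸ simpleIdeal k Q i

end Relations

end FinQuiver

/-! ### Finite dimensional modules -/

/-- The module `M` over the `k`-algebra `A` is finite dimensional over `k`. -/
def FinDim (k A M : Type) [Field k] [Ring A] [Algebra k A] [AddCommGroup M] [Module A M] : Prop :=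
  Module.Finite k (RestrictScalars k A M)

theorem FinDim.of_surjective {k A M N : Type} [Field k] [Ring A] [Algebra k A]
    [AddCommGroup M] [Module A M] [AddCommGroup N] [Module A N] (h : FinDim k A M)
    (g : M →ₗ[A] N) (hg : Function.Surjective g) : FinDim k A N := by
  let g' : RestrictScalars k A M →ₗ[k] RestrictScalars k A N :=
    { toFun := g
      map_add' := g.map_add
      map_smul' := fun c x => g.map_smul (algebraMap k A c) x }
  have : Module.Finite k (RestrictScalars k A M) := h
  exact Module.Finite.of_surjective g' hg

/-! ### The torsion pairs `(C_w, C^w)` -/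

namespace FinQuiver

section Torsion

variable {V E : Type} [Fintype V] [DecidableEq V] [Fintype E]
variable (k : Type) [Field k] (Q : FinQuiver V E)

/-- The `S_i`-isotypic part `soc_i M` of the socle of `M`. -/
noncomputable def socAt (M : Type) [AddCommGroup M] [Module (Preproj k Q) M] (i : V) :
    Submodule (Preproj k Q) M :=
  isotypicComponent (Preproj k Q) M (SimpleAt k Q i)

/-- For a word `(i_1, …, i_r)`, the last term of the chain `0 = M_0 ≤ M_1 ≤ … ≤ M_r ≤ M` with
`M_p / M_(p-1) = soc_(i_p) (M / M_(p-1))`. In other words, `M / M_r` is obtained from `M` by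
dividing out `soc_(i_1)`, then `soc_(i_2)`, and so on. -/
noncomputable def socSeq : List V → (M : Type) → [AddCommGroup M] → [Module (Preproj k Q) M] →
    Submodule (Preproj k Q) M
  | [], _, _, _ => ⊥
  | i :: l, M, _, _ => (socSeq l (M ⧸ socAt k Q M i)).comap (socAt k Q M i).mkQ

/-- The torsion-free class `C^w`: up to isomorphism, it consists of the modules obtained from
finite dimensional modules by dividing out `soc_(i_1)`, then `soc_(i_2)`, …, then `soc_(i_r)`,
where `w = s_(i_1) s_(i_2) ⋯ s_(i_r)` is a reduced expression. -/
def TorsionFreeClass (w : Q.Weyl) (M : Type) [AddCommGroup M] [Module (Preproj k Q) M] : Prop :=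
  ∃ l : List V, Q.cox.IsReduced l ∧ Q.cox.wordProd l = w ∧
    ∃ (N : Type) (_ : AddCommGroup N) (_ : Module (Preproj k Q) N),
      FinDim k (Preproj k Q) N ∧
        Nonempty (M ≃ₗ[Preproj k Q] (N ⧸ socSeq k Q l N))

/-- The torsion class `C_w` of the torsion pair `(C_w, C^w)`: the finite dimensional modules
without nonzero maps to modules in `C^w`. -/
def TorsionClass (w : Q.Weyl) (M : Type) [AddCommGroup M] [Module (Preproj k Q) M] : Prop :=
  FinDim k (Preproj k Q) M ∧
    ∀ (N : Type) [AddCommGroup N] [Module (Preproj k Q) N], TorsionFreeClass k Q w N →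
      ∀ f : M →ₗ[Preproj k Q] N, f = 0

/-- The torsion radical `t_w M`: the largest submodule of `M` that lies in `C_w`. -/
noncomputable def torsionRadical (w : Q.Weyl) (M : Type) [AddCommGroup M]
    [Module (Preproj k Q) M] : Submodule (Preproj k Q) M :=
  sSup {N : Submodule (Preproj k Q) M | TorsionClass k Q w N}

/-- `f_w M = M / t_w M`. -/
abbrev TorsionFreePart (w : Q.Weyl) (M : Type) [AddCommGroup M] [Module (Preproj k Q) M] : Type :=
  M ⧸ torsionRadical k Q w M

theorem TorsionClass.of_surjective {w : Q.Weyl} {M N : Type} [AddCommGroup M]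
    [Module (Preproj k Q) M] [AddCommGroup N] [Module (Preproj k Q) N]
    (h : TorsionClass k Q w M) (g : M →ₗ[Preproj k Q] N) (hg : Function.Surjective g) :
    TorsionClass k Q w N := by
  refine ⟨h.1.of_surjective g hg, fun F _ _ hF f => ?_⟩
  have h0 : f ∘ₗ g = 0 := h.2 F hF (f ∘ₗ g)
  ext x
  obtain ⟨y, rfl⟩ := hg x
  exact LinearMap.congr_fun h0 y

/-- `t_w` is a subfunctor of the identity. -/
theorem torsionRadical_le_comap (w : Q.Weyl) {M N : Type} [AddCommGroup M]
    [Module (Preproj k Q) M] [AddCommGroup N] [Module (Preproj k Q) N]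
    (g : M →ₗ[Preproj k Q] N) :
    torsionRadical k Q w M ≤ (torsionRadical k Q w N).comap g := by
  refine sSup_le fun U hU => ?_
  rw [← Submodule.map_le_iff_le_comap]
  refine le_sSup ?_
  have hs : Function.Surjective (g.submoduleMap U) := g.submoduleMap_surjective U
  exact TorsionClass.of_surjective k Q hU (g.submoduleMap U) hs

/-- The algebra homomorphism `End M → End (f_v M)` induced by the functor `f_v`. -/
noncomputable def torsionFreePartEnd (v : Q.Weyl) (M : Type) [AddCommGroup M] [Module k M]
    [Module (Preproj k Q) M] [IsScalarTower k (Preproj k Q) M] :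
    Module.End (Preproj k Q) M →ₐ[k] Module.End (Preproj k Q) (TorsionFreePart k Q v M) where
  toFun g := (torsionRadical k Q v M).mapQ (torsionRadical k Q v M) g
    (torsionRadical_le_comap k Q v g)
  map_one' := by
    ext x
    rfl
  map_mul' _ _ := by
    ext x
    rfl
  map_zero' := by
    ext x
    rfl
  map_add' _ _ := by
    ext x
    rfl
  commutes' _ := by
    ext x
    rfl

/-- `t_w(Π)`, where `Π` is the regular `Π`-module. -/
abbrev TorsionPi (w : Q.Weyl) : Type := torsionRadical k Q w (Preproj k Q)

/-- `P_{v,w} = f_v t_w (Π)`. -/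
abbrev PiModule (v w : Q.Weyl) : Type := TorsionFreePart k Q v (TorsionPi k Q w)

/-- The algebra `Π_w = End (t_w Π)`. -/
abbrev PiSub (w : Q.Weyl) : Type := Module.End (Preproj k Q) (TorsionPi k Q w)

/-- The algebra `Π_{v,w} = End (P_{v,w})`. -/
abbrev PiPair (v w : Q.Weyl) : Type := Module.End (Preproj k Q) (PiModule k Q v w)

/-- The homomorphism `φ₂ : Π_w → Π_{v,w}` induced by the functor `f_v`. -/
noncomputable def phi₂ (v w : Q.Weyl) : PiSub k Q w →ₐ[k] PiPair k Q v w :=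
  torsionFreePartEnd k Q v (TorsionPi k Q w)

end Torsion

end FinQuiver

/-! ### Auslander algebras -/

/-- An indecomposable module: nonzero, and not a direct sum of two nonzero submodules. -/
def IsIndecomposableModule (A M : Type) [Ring A] [AddCommGroup M] [Module A M] : Prop :=
  Nontrivial M ∧ ∀ N N' : Submodule A M, IsCompl N N' → N = ⊥ ∨ N' = ⊥

/-- `B` is the Auslander algebra of the representation-finite `k`-algebra `A`: there is a finite
list `X_0, …, X_(n-1)` that contains every finite dimensional indecomposable `A`-module exactly
once up to isomorphism, and `B` is isomorphic to the endomorphism algebra of the direct sum of the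
`X_i`. -/
def IsAuslanderAlgebra (k A B : Type) [Field k] [Ring A] [Algebra k A] [Ring B] [Algebra k B] :
    Prop :=
  ∃ (n : ℕ) (X : Fin n → Type) (_ : ∀ i, AddCommGroup (X i)) (_ : ∀ i, Module k (X i))
    (_ : ∀ i, Module A (X i)) (_ : ∀ i, IsScalarTower k A (X i)),
    (∀ i, FinDim k A (X i) ∧ IsIndecomposableModule A (X i)) ∧
    (∀ i j, Nonempty (X i ≃ₗ[A] X j) → i = j) ∧
    (∀ (Y : Type) [AddCommGroup Y] [Module A Y], FinDim k A Y → IsIndecomposableModule A Y →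
      ∃ i, Nonempty (Y ≃ₗ[A] X i)) ∧
    Nonempty (B ≃ₐ[k] Module.End A (∀ i, X i))

/-! ### Homological dimensions -/

/-- The (left) global dimension of a ring: the supremum of the projective dimensions of all
modules. -/
noncomputable def globalDimension (R : Type) [Ring R] : WithBot ℕ∞ :=
  ⨆ M : ModuleCat.{0} R, CategoryTheory.projectiveDimension M

/-- The injective dimension of `R` as a left module over itself. -/
noncomputable def selfInjectiveDimension (R : Type) [Ring R] : WithBot ℕ∞ :=
  CategoryTheory.injectiveDimension (ModuleCat.of R R)

/-- Iwanaga-Gorenstein rings: two-sided noetherian rings of finite injective dimension as left and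
as right modules over themselves. -/
def IsIwanagaGorenstein (R : Type) [Ring R] : Prop :=
  IsNoetherianRing R ∧ IsNoetherianRing Rᵐᵒᵖ ∧
    selfInjectiveDimension R < ⊤ ∧ selfInjectiveDimension Rᵐᵒᵖ < ⊤

/-- `R` is an Iwanaga-Gorenstein ring of virtual dimension `d`: its injective dimensions as a left
and as a right module over itself are both equal to `d`. -/
def HasVirtualDimension (R : Type) [Ring R] (d : ℕ) : Prop :=
  IsIwanagaGorenstein R ∧ selfInjectiveDimension R = d ∧ selfInjectiveDimension Rᵐᵒᵖ = d

set_option linter.unusedSimpArgs false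

/-! Number the vertices 0, 1, 2 and write P_i for the left ideal of Π = Π(A₃) generated by the
trivial path at i. Every reduced word of w contains the subwords 2,1,0 and 0,1,2, and P₀, P₂ are
uniserial of length three, so modules in C^w live at the middle vertex only. Hence t_w Π = P₀ ⊕ P₂ ⊕
rad P₁ (`torsionRadical_self_eq`). In rad P₁ the simples S₀ and S₂ lie above a common socle S₁,
spanned by the path z; the functor f_v removes exactly this line (`mem_torsionRadical_radSubmodule`)
and leaves P₀ ⊕ S₀ ⊕ P₂ ⊕ S₂.

The generators sit at the vertices 0 and 2 and z sits at 1, so an endomorphism of t_w Π that dies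
under f_v is zero. An endomorphism of the quotient multiplies the generators of S₀ and S₂, up to
socle terms, by two independent scalars. It lifts to t_w Π exactly when these agree, because the
only relation of rad P₁ glues the two generators along z. This single linear condition describes the
image of φ₂ (`mem_range_torsionFreePartEnd`).

The endomorphisms of P₀ ⊕ S₀ ⊕ P₂ ⊕ S₂ do not see the middle composition factors of P₀ and P₂; they
compose like those of the four indecomposables over Π(A₂). Both endomorphism algebras have a basis
of paths of a 4-cycle with two zero relations (`IsCyclicSystem.exists_basis`), and such algebras are
isomorphic. Completeness of the list of indecomposables is `A₂.exists_equiv`.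

The homological statements use only the path basis. A module is projective once two short sequences
of its vertex spaces are left exact (`IsPathBasis.projective`); this property passes to kernels, so
second syzygies are projective. A map from a left ideal that does not extend to the algebra shows
that the self-injective dimension is at least two, which also bounds the global dimension from
below. The opposite algebra again has a path basis, which gives the right-hand statements. -/

/-! ### Algebras with a path basis of the cyclic quiver `1 → 2 → 3 → 4 → 1` -/

/-- The nonzero paths of the cyclic quiver with arrows `a : 1 → 2`, `b : 2 → 3`, `c : 3 → 4`,
`d : 4 → 1` and relations `c b = 0`, `a d = 0`. -/
inductive CycPath : Type
  | e₁ | e₂ | e₃ | e₄ | a | b | c | d | ba | dc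
  deriving DecidableEq

namespace CycPath

instance : Fintype CycPath :=
  ⟨{e₁, e₂, e₃, e₄, a, b, c, d, ba, dc}, fun x => by cases x <;> decide⟩

theorem sum_eq {M : Type} [AddCommMonoid M] (f : CycPath → M) :
    ∑ i, f i = f e₁ + f e₂ + f e₃ + f e₄ + f a + f b + f c + f d + f ba + f dc := by
  have : (Finset.univ : Finset CycPath) = {e₁, e₂, e₃, e₄, a, b, c, d, ba, dc} := rfl
  rw [this]
  simp [Finset.sum_insert, add_assoc]

/-- The product of paths (composed like maps), with `none` standing for zero. -/
def mul : CycPath → CycPath → Option CycPath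
  | e₁, e₁ => some e₁
  | e₁, d => some d
  | e₁, dc => some dc
  | e₂, e₂ => some e₂
  | e₂, a => some a
  | e₃, e₃ => some e₃
  | e₃, b => some b
  | e₃, ba => some ba
  | e₄, e₄ => some e₄
  | e₄, c => some c
  | a, e₁ => some a
  | b, e₂ => some b
  | b, a => some ba
  | c, e₃ => some c
  | d, e₄ => some d
  | d, c => some dc
  | ba, e₁ => some ba
  | dc, e₃ => some dc
  | _, _ => none

/-- The anti-automorphism of the path category that exchanges the vertices `2` and `4`. -/
def flip : CycPath → CycPath
  | e₁ => e₁
  | e₂ => e₄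
  | e₃ => e₃
  | e₄ => e₂
  | a => d
  | b => c
  | c => b
  | d => a
  | ba => dc
  | dc => ba

theorem flip_flip : ∀ i, flip (flip i) = i := by decide

theorem mul_flip : ∀ i j, mul (flip i) (flip j) = (mul j i).map flip := by decide

end CycPath

/-- A basis `β` of the `k`-algebra `R` that multiplies like the paths `CycPath`. -/
structure IsPathBasis {k R : Type} [Field k] [Ring R] [Algebra k R]
    (β : Module.Basis CycPath k R) : Prop where
  mul : ∀ i j, β i * β j = (CycPath.mul i j).elim 0 β
  one : 1 = β .e₁ + β .e₂ + β .e₃ + β .e₄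

namespace IsPathBasis

open CycPath

variable {k R S : Type} [Field k] [Ring R] [Algebra k R] [Ring S] [Algebra k S]
variable {β : Module.Basis CycPath k R} {γ : Module.Basis CycPath k S}

/-- The structure constants depend only on `CycPath`, so the linear map matching the two bases is
multiplicative. -/
theorem nonempty_algEquiv (hβ : IsPathBasis β) (hγ : IsPathBasis γ) : Nonempty (R ≃ₐ[k] S) := by
  let φ : R ≃ₗ[k] S := β.equiv γ (Equiv.refl _)
  have hφ : ∀ i, φ (β i) = γ i := fun i => by simp [φ]
  refine ⟨AlgEquiv.ofLinearEquiv φ ?_ fun x y => ?_⟩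
  · rw [hβ.one, hγ.one]
    simp [hφ]
  · have : (LinearMap.mul k R).compr₂ φ.toLinearMap =
        (LinearMap.mul k S).compl₁₂ φ.toLinearMap φ.toLinearMap := by
      refine β.ext fun i => β.ext fun j => ?_
      simp only [LinearMap.compr₂_apply, LinearMap.compl₁₂_apply, LinearMap.mul_apply',
        LinearEquiv.coe_coe, hφ, hβ.mul, hγ.mul]
      cases CycPath.mul i j <;> simp [hφ]
    exact LinearMap.congr_fun₂ this x y

/-- Reversing all arrows and exchanging the vertices 2 and 4 preserves the quiver and its relations.
Every statement about left modules thereby also holds on the right. -/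
theorem exists_op (hβ : IsPathBasis β) :
    ∃ γ : Module.Basis CycPath k Rᵐᵒᵖ, IsPathBasis γ := by
  refine ⟨(β.map (MulOpposite.opLinearEquiv k)).reindex ⟨flip, flip, flip_flip, flip_flip⟩,
    fun i j => ?_, ?_⟩
  · simp only [Module.Basis.coe_reindex, Module.Basis.coe_map, Function.comp_apply,
      MulOpposite.coe_opLinearEquiv, Equiv.coe_fn_symm_mk]
    rw [← MulOpposite.op_mul, hβ.mul, mul_flip]
    cases CycPath.mul i j <;> simp
  · simp only [Module.Basis.coe_reindex, Module.Basis.coe_map, Function.comp_apply,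
      MulOpposite.coe_opLinearEquiv, Equiv.coe_fn_symm_mk]
    rw [← MulOpposite.op_one, hβ.one]
    simp only [CycPath.flip, MulOpposite.op_add]
    abel

end IsPathBasis

/-! ### Left exact modules are projective -/

/-- A section over the range extends to all of `W`. Such maps encode choices of complements of
kernels and images. -/
theorem LinearMap.exists_generalizedInverse {k V W : Type} [Field k] [AddCommGroup V] [Module k V]
    [AddCommGroup W] [Module k W] (f : V →ₗ[k] W) : ∃ g : W →ₗ[k] V, ∀ x, f (g (f x)) = f x := by
  obtain ⟨h, hh⟩ := f.rangeRestrict.exists_rightInverse_of_surjective f.range_rangeRestrict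
  obtain ⟨g, hg⟩ := LinearMap.exists_extend h
  refine ⟨g, fun x => ?_⟩
  have h1 : g (f x) = h (f.rangeRestrict x) := LinearMap.congr_fun hg (f.rangeRestrict x)
  rw [h1]
  exact congrArg Subtype.val (LinearMap.congr_fun hh (f.rangeRestrict x))

/-- The exactness conditions that characterize the projective modules over an algebra with a path
basis. -/
structure IsLeftExactModule {k R : Type} [Field k] [Ring R] [Algebra k R]
    (β : Module.Basis CycPath k R) (V : Type) [AddCommGroup V] [Module R V] : Prop where
  -- With V_i = e_i V, the fields say that 0 → V₂ → V₃ → V₄ (maps b, c) and 0 → V₄ → V₁ → V₂ (maps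
  -- d, a) are exact. For the Auslander algebra of Π(A₂) these are the values of a covariant functor
  -- on the two almost split sequences.
  b_inj : ∀ x : V, β .b • x = 0 → β .e₂ • x = 0
  d_inj : ∀ x : V, β .d • x = 0 → β .e₄ • x = 0
  c_exact : ∀ x : V, β .c • x = 0 → ∃ y : V, β .e₃ • x = β .b • y
  a_exact : ∀ x : V, β .a • x = 0 → ∃ y : V, β .e₁ • x = β .d • y

namespace IsPathBasis

open CycPath TensorProduct

variable {k R : Type} [Field k] [Ring R] [Algebra k R] {β : Module.Basis CycPath k R}

theorem mul_eq_sum (hβ : IsPathBasis β) (g : CycPath) (x : R) :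
    β g * x = ∑ i, β.repr x i • (CycPath.mul g i).elim 0 β := by
  conv_lhs => rw [← β.sum_repr x, Finset.mul_sum]
  exact Finset.sum_congr rfl fun i _ => by rw [mul_smul_comm, hβ.mul]

theorem isLeftExactModule_self (hβ : IsPathBasis β) : IsLeftExactModule β R := by
  constructor
  · intro x h
    simp only [smul_eq_mul, hβ.mul_eq_sum, CycPath.sum_eq, CycPath.mul, Option.elim, smul_zero,
      zero_add, add_zero] at h ⊢
    have h1 := congrArg (fun y => β.repr y .b) h
    have h2 := congrArg (fun y => β.repr y .ba) h
    simp [Finsupp.single_apply] at h1 h2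
    simp [h1, h2]
  · intro x h
    simp only [smul_eq_mul, hβ.mul_eq_sum, CycPath.sum_eq, CycPath.mul, Option.elim, smul_zero,
      zero_add, add_zero] at h ⊢
    have h1 := congrArg (fun y => β.repr y .d) h
    have h2 := congrArg (fun y => β.repr y .dc) h
    simp [Finsupp.single_apply] at h1 h2
    simp [h1, h2]
  · intro x h
    -- The paths ending at 3 and killed by c are b = b e₂ and ba = b a.
    refine ⟨β.repr x .b • β .e₂ + β.repr x .ba • β .a, ?_⟩
    simp only [smul_eq_mul, hβ.mul_eq_sum _ x, mul_add, mul_smul_comm, hβ.mul, CycPath.sum_eq,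
      CycPath.mul, Option.elim, smul_zero, zero_add, add_zero] at h ⊢
    have h1 := congrArg (fun y => β.repr y .c) h
    simp [Finsupp.single_apply] at h1
    simp [h1]
  · intro x h
    refine ⟨β.repr x .d • β .e₄ + β.repr x .dc • β .c, ?_⟩
    simp only [smul_eq_mul, hβ.mul_eq_sum _ x, mul_add, mul_smul_comm, hβ.mul, CycPath.sum_eq,
      CycPath.mul, Option.elim, smul_zero, zero_add, add_zero] at h ⊢
    have h1 := congrArg (fun y => β.repr y .a) h
    simp [Finsupp.single_apply] at h1
    simp [h1]

/-- The multiplication map R ⊗ V → V splits R-linearly. Complements chosen with generalized inverses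
of the arrows single out the new generators at each vertex, and exactness guarantees that all other
vectors arise freely from generators elsewhere. -/
theorem projective (hβ : IsPathBasis β) {V : Type} [AddCommGroup V] [Module R V]
    (hV : IsLeftExactModule β V) : Module.Projective R V := by
  let _ : Module k V := Module.compHom V (algebraMap k R)
  have : IsScalarTower k R V := ⟨fun x y z => by
    rw [Algebra.smul_def, mul_smul]; rfl⟩
  have hL : ∀ r : R, ∃ g : V →ₗ[k] V, ∀ x, r • g (r • x) = r • x := fun r =>
    (Algebra.lsmul k k V r).exists_generalizedInverse
  obtain ⟨a', ha⟩ := hL (β .a)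
  obtain ⟨b', hb⟩ := hL (β .b)
  obtain ⟨c', hc⟩ := hL (β .c)
  obtain ⟨d', hd⟩ := hL (β .d)
  have hb2 : ∀ x, β .e₂ • b' (β .b • x) = β .e₂ • x := fun x => by
    rw [← sub_eq_zero, ← smul_sub]
    exact hV.b_inj _ (by rw [smul_sub, hb, sub_self])
  have hd4 : ∀ x, β .e₄ • d' (β .d • x) = β .e₄ • x := fun x => by
    rw [← sub_eq_zero, ← smul_sub]
    exact hV.d_inj _ (by rw [smul_sub, hd, sub_self])
  have hbc : ∀ x, β .b • b' (β .e₃ • (x - c' (β .c • x))) = β .e₃ • (x - c' (β .c • x)) :=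
    fun x => by
      obtain ⟨y, hy⟩ := hV.c_exact (x - c' (β .c • x)) (by rw [smul_sub, hc, sub_self])
      rw [hy, hb]
  have hda : ∀ x, β .d • d' (β .e₁ • (x - a' (β .a • x))) = β .e₁ • (x - a' (β .a • x)) :=
    fun x => by
      obtain ⟨y, hy⟩ := hV.a_exact (x - a' (β .a • x)) (by rw [smul_sub, ha, sub_self])
      rw [hy, hd]
  let T : R → V →ₗ[k] R ⊗[k] V := fun r => TensorProduct.mk k R V r
  let A : R → R ⊗[k] V →ₗ[k] R ⊗[k] V := fun r => Algebra.lsmul k k _ r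
  let L : R → V →ₗ[k] V := fun r => Algebra.lsmul k k V r
  -- On V₂ the part in the image of a is lifted through a preimage in V₁; the remainder consists of
  -- new generators at e₂. The vertex 4 is treated in the same way with c.
  let s₂ : V →ₗ[k] R ⊗[k] V :=
    (T (β .a) ∘ₗ a' + T (β .e₂) ∘ₗ (LinearMap.id - L (β .a) ∘ₗ a')) ∘ₗ L (β .e₂)
  let s₄ : V →ₗ[k] R ⊗[k] V :=
    (T (β .c) ∘ₗ c' + T (β .e₄) ∘ₗ (LinearMap.id - L (β .c) ∘ₗ c')) ∘ₗ L (β .e₄)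
  -- The vector x - a'(a x) is killed by a, so its component in V₁ comes from V₄ via d, where the
  -- section is already defined. The rest is generated at e₁.
  let s₁ : V →ₗ[k] R ⊗[k] V := T (β .e₁) ∘ₗ a' ∘ₗ L (β .a) +
    A (β .d) ∘ₗ s₄ ∘ₗ d' ∘ₗ L (β .e₁) ∘ₗ (LinearMap.id - a' ∘ₗ L (β .a))
  let s₃ : V →ₗ[k] R ⊗[k] V := T (β .e₃) ∘ₗ c' ∘ₗ L (β .c) +
    A (β .b) ∘ₗ s₂ ∘ₗ b' ∘ₗ L (β .e₃) ∘ₗ (LinearMap.id - c' ∘ₗ L (β .c))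
  have hs₂ : ∀ x, s₂ x = β .a ⊗ₜ a' (β .e₂ • x) +
      β .e₂ ⊗ₜ (β .e₂ • x - β .a • a' (β .e₂ • x)) := fun x => rfl
  have hs₄ : ∀ x, s₄ x = β .c ⊗ₜ c' (β .e₄ • x) +
      β .e₄ ⊗ₜ (β .e₄ • x - β .c • c' (β .e₄ • x)) := fun x => rfl
  have hs₁ : ∀ x, s₁ x = β .e₁ ⊗ₜ a' (β .a • x) +
      β .d • s₄ (d' (β .e₁ • (x - a' (β .a • x)))) := fun x => rfl
  have hs₃ : ∀ x, s₃ x = β .e₃ ⊗ₜ c' (β .c • x) +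
      β .b • s₂ (b' (β .e₃ • (x - c' (β .c • x)))) := fun x => rfl
  let s : V →ₗ[k] R ⊗[k] V := s₁ + s₂ + s₃ + s₄
  have hs : ∀ x, s x = s₁ x + s₂ x + s₃ x + s₄ x := fun x => rfl
  have hm : ∀ i j : CycPath, ∀ x : V, β i • β j • x = (CycPath.mul i j).elim 0 (β · • x) :=
    fun i j x => by
      rw [← mul_smul, hβ.mul]
      cases CycPath.mul i j <;> simp
  -- The two paths of length two are left aside: compatibility with them follows from that with the
  -- arrows.
  have hgen : ∀ i, i ≠ .ba → i ≠ .dc → ∀ x, s (β i • x) = β i • s x := by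
    intro i h1 h2 x
    cases i <;>
    simp [hs, hs₁, hs₂, hs₃, hs₄, hm, CycPath.mul, TensorProduct.smul_tmul', smul_smul, hβ.mul,
      smul_add, ha, hc, hb2, hd4, smul_sub] at h1 h2 ⊢
  have hgen' : ∀ i x, s (β i • x) = β i • s x := by
    intro i x
    by_cases h1 : i = .ba
    · have : β .ba = β .b * β .a := by simp [hβ.mul, CycPath.mul]
      rw [h1, this, mul_smul, mul_smul, hgen _ (by decide) (by decide),
        hgen _ (by decide) (by decide)]
    by_cases h2 : i = .dc
    · have : β .dc = β .d * β .c := by simp [hβ.mul, CycPath.mul]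
      rw [h2, this, mul_smul, mul_smul, hgen _ (by decide) (by decide),
        hgen _ (by decide) (by decide)]
    exact hgen i h1 h2 x
  let σ : V →ₗ[R] R ⊗[k] V :=
    { s with
      map_smul' := fun r x => by
        change s (r • x) = r • s x
        rw [← β.sum_repr r, Finset.sum_smul, Finset.sum_smul, map_sum]
        refine Finset.sum_congr rfl fun i _ => ?_
        rw [smul_assoc, smul_assoc, map_smul, hgen'] }
  have : Module.Projective R (R ⊗[k] V) := Module.Projective.of_free
  let ρ : R ⊗[k] V →ₗ[k] V := TensorProduct.lift (Algebra.lsmul k k V).toLinearMap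
  have hρt : ∀ r x, ρ (r ⊗ₜ x) = r • x := fun r x => rfl
  have hρ : ∀ (r : R) (t : R ⊗[k] V), ρ (r • t) = r • ρ t := fun r t => by
    induction t with
    | zero => simp
    | tmul x y => rw [TensorProduct.smul_tmul', hρt, hρt, smul_eq_mul, mul_smul]
    | add x y hx hy => rw [smul_add, map_add, map_add, smul_add, hx, hy]
  let π : R ⊗[k] V →ₗ[R] V := { ρ with map_smul' := hρ }
  refine Module.Projective.of_split σ π ?_
  ext x
  change ρ (s x) = x
  have h1 : β .e₁ • x + β .e₂ • x + β .e₃ • x + β .e₄ • x = x := by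
    rw [← add_smul, ← add_smul, ← add_smul, ← hβ.one, one_smul]
  conv_rhs => rw [← h1]
  have hbc' := hbc x
  have hda' := hda x
  simp only [smul_sub, map_sub] at hbc' hda'
  simp [hs, hs₁, hs₂, hs₃, hs₄, hm, CycPath.mul, hρ, hρt, smul_sub, smul_add,
    ha, hc]
  linear_combination (norm := abel) hbc' + hda'

theorem isLeftExactModule_finsupp (h : IsLeftExactModule β R) (ι : Type) :
    IsLeftExactModule β (ι →₀ R) := by
  classical
  constructor
  · intro x hx
    ext i
    exact h.b_inj _ (DFunLike.congr_fun hx i)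
  · intro x hx
    ext i
    exact h.d_inj _ (DFunLike.congr_fun hx i)
  · intro x hx
    have hx' : ∀ i, β .c • x i = 0 := fun i => DFunLike.congr_fun hx i
    have : ∀ r : R, ∃ y : R, β .c * r = 0 → β .e₃ * r = β .b * y := fun r => by
      by_cases hr : β .c * r = 0
      · obtain ⟨y, hy⟩ := h.c_exact r hr
        exact ⟨y, fun _ => hy⟩
      · exact ⟨0, fun h => absurd h hr⟩
    choose f hf using this
    -- The preimage of 0 is forced to be 0, so that the support stays finite.
    refine ⟨x.mapRange (fun r => if r = 0 then 0 else f r) (by simp), ?_⟩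
    ext i
    simp only [Finsupp.smul_apply, Finsupp.mapRange_apply, smul_eq_mul]
    split_ifs with h0
    · simp [h0]
    · exact hf _ (hx' i)
  · intro x hx
    have hx' : ∀ i, β .a • x i = 0 := fun i => DFunLike.congr_fun hx i
    have : ∀ r : R, ∃ y : R, β .a * r = 0 → β .e₁ * r = β .d * y := fun r => by
      by_cases hr : β .a * r = 0
      · obtain ⟨y, hy⟩ := h.a_exact r hr
        exact ⟨y, fun _ => hy⟩
      · exact ⟨0, fun h => absurd h hr⟩
    choose f hf using this
    refine ⟨x.mapRange (fun r => if r = 0 then 0 else f r) (by simp), ?_⟩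
    ext i
    simp only [Finsupp.smul_apply, Finsupp.mapRange_apply, smul_eq_mul]
    split_ifs with h0
    · simp [h0]
    · exact hf _ (hx' i)

/-- A preimage y under b of a vector of the kernel need not lie in the kernel, but b f(y) = 0, and
injectivity of b on `W` gives f(e₂ y) = 0. So e₂ y is a preimage in the kernel. -/
theorem isLeftExactModule_ker (hβ : IsPathBasis β) {V W : Type} [AddCommGroup V] [Module R V]
    [AddCommGroup W] [Module R W] (hV : IsLeftExactModule β V) (hW : IsLeftExactModule β W)
    (f : V →ₗ[R] W) : IsLeftExactModule β (LinearMap.ker f) := by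
  have hm : ∀ i j : CycPath, ∀ x : W, β i • β j • x = (CycPath.mul i j).elim 0 (β · • x) :=
    fun i j x => by
      rw [← mul_smul, hβ.mul]
      cases CycPath.mul i j <;> simp
  have hm' : ∀ i j : CycPath, ∀ x : V, β i • β j • x = (CycPath.mul i j).elim 0 (β · • x) :=
    fun i j x => by
      rw [← mul_smul, hβ.mul]
      cases CycPath.mul i j <;> simp
  constructor
  · intro x hx
    exact Subtype.ext (hV.b_inj _ (congrArg Subtype.val hx))
  · intro x hx
    exact Subtype.ext (hV.d_inj _ (congrArg Subtype.val hx))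
  · intro x hx
    obtain ⟨y, hy⟩ := hV.c_exact _ (congrArg Subtype.val hx)
    refine ⟨⟨β .e₂ • y, ?_⟩, Subtype.ext ?_⟩
    · rw [LinearMap.mem_ker, map_smul]
      apply hW.b_inj
      rw [← map_smul, ← hy, map_smul, x.2, smul_zero]
    · change β .e₃ • (x : V) = β .b • β .e₂ • y
      rw [hy, hm']
      rfl
  · intro x hx
    obtain ⟨y, hy⟩ := hV.a_exact _ (congrArg Subtype.val hx)
    refine ⟨⟨β .e₄ • y, ?_⟩, Subtype.ext ?_⟩
    · rw [LinearMap.mem_ker, map_smul]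
      apply hW.d_inj
      rw [← map_smul, ← hy, map_smul, x.2, smul_zero]
    · change β .e₁ • (x : V) = β .d • β .e₄ • y
      rw [hy, hm']
      rfl

end IsPathBasis

/-! ### Homological dimensions -/

section HomologicalDimension

open CategoryTheory

variable {R : Type} [Ring R]

theorem hasProjectiveDimensionLT_succ_of_ker {P N : Type} [AddCommGroup P] [Module R P]
    [AddCommGroup N] [Module R N] [Module.Projective R P] {g : P →ₗ[R] N}
    (hg : Function.Surjective g) (n : ℕ)
    (h : HasProjectiveDimensionLT (ModuleCat.of R (LinearMap.ker g)) (n + 1)) :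
    HasProjectiveDimensionLT (ModuleCat.of R N) (n + 2) :=
  (LinearMap.shortExact_shortComplexKer hg).hasProjectiveDimensionLT_X₃ (n + 1) h inferInstance

/-- In a free presentation, the second syzygy is the kernel of a map between free modules. -/
theorem hasProjectiveDimensionLT_three_of_ker
    (h : ∀ (ι κ : Type) (f : (ι →₀ R) →ₗ[R] (κ →₀ R)), Module.Projective R (LinearMap.ker f))
    (M : ModuleCat.{0} R) : HasProjectiveDimensionLT M 3 := by
  have free_cover : ∀ (N : Type) [AddCommGroup N] [Module R N],
      ∃ g : (N →₀ R) →ₗ[R] N, Function.Surjective g := fun N _ _ =>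
    ⟨Finsupp.linearCombination R id, Finsupp.linearCombination_id_surjective R N⟩
  obtain ⟨g, hg⟩ := free_cover M
  obtain ⟨g', hg'⟩ := free_cover (LinearMap.ker g)
  have hp : Module.Projective R (LinearMap.ker g') := by
    rw [← LinearMap.ker_comp_of_ker_eq_bot g' (Submodule.ker_subtype _)]
    exact h _ _ _
  have h1 : HasProjectiveDimensionLT (ModuleCat.of R (LinearMap.ker g')) 1 := inferInstance
  exact hasProjectiveDimensionLT_succ_of_ker hg 1
    (hasProjectiveDimensionLT_succ_of_ker hg' 0 h1)

/-- The range I of f is a left ideal, so Ext¹(I, R) embeds into Ext²(R/I, R) = 0. Hence there is no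
obstruction to extending maps from the kernel of R → I. -/
theorem exists_extend_of_injectiveDimension_lt_two
    (h : HasInjectiveDimensionLT (ModuleCat.of R R) 2) (f : R →ₗ[R] R)
    (θ : LinearMap.ker f →ₗ[R] R) : ∃ φ : R →ₗ[R] R, ∀ x : LinearMap.ker f, φ x = θ x := by
  let _ := HasExt.standard (ModuleCat.{0} R)
  have e := LinearMap.shortExact_shortComplexKer f.surjective_rangeRestrict
  let T := ModuleCat.shortComplexOfCompEqZero (LinearMap.range f).subtype
    (LinearMap.range f).mkQ (by ext x; simp)
  have hT : T.ShortExact := ModuleCat.shortComplex_shortExact T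
    (LinearMap.exact_subtype_mkQ _) (LinearMap.range f).injective_subtype
    (LinearMap.range f).mkQ_surjective
  have hext : ∀ x : Abelian.Ext (ModuleCat.of R (LinearMap.range f)) (ModuleCat.of R R) 1, x = 0 := by
    intro x
    obtain ⟨y, hy⟩ := Abelian.Ext.contravariant_sequence_exact₁ hT (ModuleCat.of R R) x
      (rfl : 1 + 1 = 2) (Abelian.Ext.eq_zero_of_hasInjectiveDimensionLT _ 2 le_rfl)
    have hy0 : y = 0 := Abelian.Ext.eq_zero_of_hasProjectiveDimensionLT (X := ModuleCat.of R R) y 1 le_rfl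
    rw [← hy, hy0, Abelian.Ext.comp_zero]
  have hk : LinearMap.ker f ≤ LinearMap.ker f.rangeRestrict := by rw [LinearMap.ker_rangeRestrict]
  have hk' : LinearMap.ker f.rangeRestrict ≤ LinearMap.ker f := by rw [LinearMap.ker_rangeRestrict]
  obtain ⟨y, hy⟩ := Abelian.Ext.contravariant_sequence_exact₁ e (ModuleCat.of R R)
    (Abelian.Ext.mk₀ (ModuleCat.ofHom (θ ∘ₗ Submodule.inclusion hk'))) (rfl : 1 + 0 = 1) (hext _)
  obtain ⟨φ, rfl⟩ := (Abelian.Ext.mk₀_bijective _ _).2 y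
  rw [Abelian.Ext.mk₀_comp_mk₀] at hy
  have h2 := (Abelian.Ext.mk₀_bijective _ _).1 hy
  exact ⟨φ.hom, fun x => LinearMap.congr_fun (congrArg ModuleCat.Hom.hom h2) ⟨x, hk x.2⟩⟩

end HomologicalDimension

/-! ### Global and self-injective dimension of algebras with a path basis -/

namespace IsPathBasis

open CycPath CategoryTheory

variable {k R : Type} [Field k] [Ring R] [Algebra k R] {β : Module.Basis CycPath k R}

theorem hasProjectiveDimensionLT_three (hβ : IsPathBasis β) (M : ModuleCat.{0} R) :
    HasProjectiveDimensionLT M 3 :=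
  hasProjectiveDimensionLT_three_of_ker (fun ι κ f => hβ.projective
    (hβ.isLeftExactModule_ker (isLeftExactModule_finsupp hβ.isLeftExactModule_self ι)
      (isLeftExactModule_finsupp hβ.isLeftExactModule_self κ) f)) M

/-- The substitution `c ↦ e₄`, `dc ↦ d` of paths. -/
def _root_.CycPath.cancelC : CycPath → Option CycPath
  | c => some e₄
  | dc => some d
  | _ => none

/-- The exception is genuine: c e₃ = c goes to e₄, whereas e₃ itself goes to zero. -/
theorem _root_.CycPath.cancelC_mul : ∀ i j, j ≠ e₃ →
    (CycPath.mul i j).bind cancelC = (cancelC j).bind (CycPath.mul i) := by decide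

/-- The kernel of x ↦ x b is spanned by all paths except e₃, and there the substitution c ↦ e₄, dc ↦
d is linear over R. An extension φ to R would give e₄ = c φ(1), but e₄ does not lie in c R. -/
theorem not_hasInjectiveDimensionLT_two (hβ : IsPathBasis β) :
    ¬ HasInjectiveDimensionLT (ModuleCat.of R R) 2 := by
  intro h
  let Θ : R →ₗ[k] R := β.constr k fun j => (cancelC j).elim 0 β
  have hΘ : ∀ j, Θ (β j) = (cancelC j).elim 0 β := fun j => β.constr_basis k _ j
  have hΘ' : ∀ i j, j ≠ e₃ → Θ (β i * β j) = β i * Θ (β j) := fun i j hj => by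
    have h1 : Θ (β i * β j) = ((CycPath.mul i j).bind cancelC).elim 0 β := by
      rw [hβ.mul]
      cases CycPath.mul i j <;> simp [hΘ]
    have h2 : β i * Θ (β j) = ((cancelC j).bind (CycPath.mul i)).elim 0 β := by
      rw [hΘ]
      cases cancelC j <;> simp [hβ.mul]
    rw [h1, h2, cancelC_mul i j hj]
  let f : R →ₗ[R] R := LinearMap.toSpanSingleton R R (β .b)
  have hf : ∀ x ∈ LinearMap.ker f, β.repr x e₃ = 0 := fun x hx => by
    have hx' : x * β .b = 0 := hx
    rw [← β.sum_repr x, Finset.sum_mul] at hx'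
    simp only [smul_mul_assoc, hβ.mul, CycPath.sum_eq, CycPath.mul, Option.elim, smul_zero,
      zero_add, add_zero] at hx'
    have h1 := congrArg (fun y => β.repr y .b) hx'
    simpa using h1
  have hlin : ∀ (r x : R), β.repr x e₃ = 0 → Θ (r * x) = r * Θ x := by
    intro r x hx
    rw [← β.sum_repr r, ← β.sum_repr x, Finset.sum_mul_sum, map_sum, map_sum, Finset.sum_mul_sum]
    refine Finset.sum_congr rfl fun i _ => ?_
    rw [map_sum]
    refine Finset.sum_congr rfl fun j _ => ?_
    by_cases hj : j = e₃
    · simp [hj, hx]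
    · rw [smul_mul_smul_comm, map_smul, map_smul, smul_mul_smul_comm, hΘ' i j hj]
  let θ : LinearMap.ker f →ₗ[R] R :=
    { toFun := fun x => Θ x
      map_add' := fun x y => by simp
      map_smul' := fun r x => hlin r x (hf x x.2) }
  obtain ⟨φ, hφ⟩ := exists_extend_of_injectiveDimension_lt_two h f θ
  have hc : β .c ∈ LinearMap.ker f := by
    change β .c * β .b = 0
    rw [hβ.mul]
    rfl
  have h1 : β .c * φ 1 = β .e₄ := by
    rw [← smul_eq_mul, ← map_smul, smul_eq_mul, mul_one]
    exact (hφ ⟨_, hc⟩).trans (hΘ .c)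
  rw [hβ.mul_eq_sum] at h1
  simp only [CycPath.sum_eq, CycPath.mul, Option.elim, smul_zero, zero_add, add_zero] at h1
  have h2 := congrArg (fun y => β.repr y .e₄) h1
  simp at h2

/-- If all projective dimensions were below two, all Ext² into R would vanish and the self-injective
dimension would be below two. -/
theorem globalDimension_eq (hβ : IsPathBasis β) : globalDimension R = 2 := by
  refine le_antisymm (iSup_le fun M => ?_) ?_
  · exact (projectiveDimension_le_iff M 2).2 (hβ.hasProjectiveDimensionLT_three M)
  · by_contra hlt
    rw [not_le] at hlt
    refine hβ.not_hasInjectiveDimensionLT_two ?_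
    let _ := HasExt.standard (ModuleCat.{0} R)
    rw [hasInjectiveDimensionLT_iff]
    intro i hi Y x
    have hY : HasProjectiveDimensionLT Y 2 := projectiveDimension_lt_iff.1
      (lt_of_le_of_lt (le_iSup (fun M : ModuleCat.{0} R => projectiveDimension M) Y) hlt)
    exact Abelian.Ext.eq_zero_of_hasProjectiveDimensionLT x 2 hi

theorem selfInjectiveDimension_eq (hβ : IsPathBasis β) : selfInjectiveDimension R = 2 := by
  refine le_antisymm ((injectiveDimension_le_iff _ 2).2 ?_)
    ((injectiveDimension_ge_iff _ 2).2 hβ.not_hasInjectiveDimensionLT_two)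
  let _ := HasExt.standard (ModuleCat.{0} R)
  change HasInjectiveDimensionLT _ 3
  rw [hasInjectiveDimensionLT_iff]
  intro i hi Y x
  have hY := hβ.hasProjectiveDimensionLT_three Y
  exact Abelian.Ext.eq_zero_of_hasProjectiveDimensionLT x 3 hi

theorem isNoetherianRing {β : Module.Basis CycPath k R} : IsNoetherianRing R := by
  have : Module.Finite k R := Module.Finite.of_basis β
  exact isNoetherian_of_tower k inferInstance

theorem hasVirtualDimension (hβ : IsPathBasis β) : HasVirtualDimension R 2 := by
  obtain ⟨γ, hγ⟩ := hβ.exists_op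
  have h1 := hβ.selfInjectiveDimension_eq
  have h2 := hγ.selfInjectiveDimension_eq
  refine ⟨⟨isNoetherianRing (β := β), isNoetherianRing (β := γ), ?_, ?_⟩, h1, h2⟩
  · rw [h1]
    exact WithBot.coe_lt_coe.2 (ENat.natCast_lt_top 2)
  · rw [h2]
    exact WithBot.coe_lt_coe.2 (ENat.natCast_lt_top 2)

end IsPathBasis

/-! ### Preprojective algebras of type `A` -/

namespace FinQuiver

section TypeA

variable (k : Type) [Field k] {n : ℕ} (o : Fin n → Bool)

/-- The preprojective algebra of type `A_(n+1)`. -/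
abbrev PreprojA : Type := Preproj k (typeA n o)

namespace PreprojA

/-- The trivial path at `i`. -/
noncomputable def v (i : Fin (n + 1)) : PreprojA k o := Preproj.gen k (typeA n o) (.vertex i)

/-- The arrow of the double quiver from `e` to `e + 1`. -/
noncomputable def u (e : Fin n) : PreprojA k o :=
  if o e then Preproj.gen k (typeA n o) (.arrow e) else Preproj.gen k (typeA n o) (.dual e)

/-- The arrow of the double quiver from `e + 1` to `e`, up to a sign. -/
noncomputable def d (e : Fin n) : PreprojA k o :=
  if o e then Preproj.gen k (typeA n o) (.dual e) else -Preproj.gen k (typeA n o) (.arrow e)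

variable {k o}

/-- The quotient map from the free algebra. -/
noncomputable def mk : FreeAlgebra k (PreprojGen (Fin (n + 1)) (Fin n)) →ₐ[k] PreprojA k o :=
  RingQuot.mkAlgHom k (PreprojRel k (typeA n o))

theorem mk_ι (g : PreprojGen (Fin (n + 1)) (Fin n)) :
    mk (FreeAlgebra.ι k g) = Preproj.gen k (typeA n o) g := rfl

theorem gen_vertex (i : Fin (n + 1)) : Preproj.gen k (typeA n o) (.vertex i) = v k o i := rfl

theorem mk_rel {x y : FreeAlgebra k (PreprojGen (Fin (n + 1)) (Fin n))}
    (h : PreprojRel k (typeA n o) x y) : (mk x : PreprojA k o) = mk y :=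
  RingQuot.mkAlgHom_rel k h

theorem tgt_typeA (e : Fin n) : (typeA n o).tgt e = if o e then e.succ else e.castSucc := rfl

theorem src_typeA (e : Fin n) : (typeA n o).src e = if o e then e.castSucc else e.succ := rfl

theorem v_mul_self (i : Fin (n + 1)) : v k o i * v k o i = v k o i := by
  simpa only [map_mul, mk_ι, gen_vertex] using mk_rel (PreprojRel.vertex_idem (k := k) (Q := typeA n o) i)

theorem v_mul_of_ne {i j : Fin (n + 1)} (h : i ≠ j) : v k o i * v k o j = 0 := by
  simpa only [map_mul, map_zero, mk_ι, gen_vertex] using mk_rel (PreprojRel.vertex_orth (k := k) (Q := typeA n o) i j h)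

theorem sum_v : ∑ i, v k o i = 1 := by
  simpa only [map_sum, map_one, mk_ι, gen_vertex] using mk_rel (PreprojRel.vertex_sum (k := k) (Q := typeA n o))

theorem v_mul_gen_arrow (e : Fin n) : v k o ((typeA n o).tgt e) * Preproj.gen k (typeA n o) (.arrow e)
    = Preproj.gen k (typeA n o) (.arrow e) := by
  simpa only [map_mul, mk_ι, gen_vertex] using mk_rel (PreprojRel.tgt_arrow (k := k) (Q := typeA n o) e)

theorem gen_arrow_mul_v (e : Fin n) : Preproj.gen k (typeA n o) (.arrow e) * v k o ((typeA n o).src e)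
    = Preproj.gen k (typeA n o) (.arrow e) := by
  simpa only [map_mul, mk_ι, gen_vertex] using mk_rel (PreprojRel.arrow_src (k := k) (Q := typeA n o) e)

theorem v_mul_gen_dual (e : Fin n) : v k o ((typeA n o).src e) * Preproj.gen k (typeA n o) (.dual e)
    = Preproj.gen k (typeA n o) (.dual e) := by
  simpa only [map_mul, mk_ι, gen_vertex] using mk_rel (PreprojRel.src_dual (k := k) (Q := typeA n o) e)

theorem gen_dual_mul_v (e : Fin n) : Preproj.gen k (typeA n o) (.dual e) * v k o ((typeA n o).tgt e)
    = Preproj.gen k (typeA n o) (.dual e) := by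
  simpa only [map_mul, mk_ι, gen_vertex] using mk_rel (PreprojRel.dual_tgt (k := k) (Q := typeA n o) e)

theorem v_mul_u (e : Fin n) : v k o e.succ * u k o e = u k o e := by
  have h1 := v_mul_gen_arrow (k := k) (o := o) e
  have h2 := v_mul_gen_dual (k := k) (o := o) e
  cases h : o e <;> simp_all [u, tgt_typeA, src_typeA]

theorem u_mul_v (e : Fin n) : u k o e * v k o e.castSucc = u k o e := by
  have h1 := gen_arrow_mul_v (k := k) (o := o) e
  have h2 := gen_dual_mul_v (k := k) (o := o) e
  cases h : o e <;> simp_all [u, tgt_typeA, src_typeA]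

theorem v_mul_d (e : Fin n) : v k o e.castSucc * d k o e = d k o e := by
  have h1 := v_mul_gen_arrow (k := k) (o := o) e
  have h2 := v_mul_gen_dual (k := k) (o := o) e
  cases h : o e <;> simp_all [d, tgt_typeA, src_typeA]

theorem d_mul_v (e : Fin n) : d k o e * v k o e.succ = d k o e := by
  have h1 := gen_arrow_mul_v (k := k) (o := o) e
  have h2 := gen_dual_mul_v (k := k) (o := o) e
  cases h : o e <;> simp_all [d, tgt_typeA, src_typeA]

/-- For a reversed edge, a = -d and a* = u, so a a* - a* a equals u d - d u in both cases. The sign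
in `d` makes the relation independent of the orientation. -/
theorem sum_u_mul_d : ∑ e, u k o e * d k o e = ∑ e, d k o e * u k o e := by
  have h := mk_rel (PreprojRel.preproj (k := k) (Q := typeA n o))
  simp only [map_sum, map_mul, mk_ι] at h
  rw [← sub_eq_zero, ← Finset.sum_sub_distrib] at h ⊢
  rw [← h]
  refine Finset.sum_congr rfl fun e _ => ?_
  cases h : o e
  · simp only [u, d, h, Bool.false_eq_true, if_false, mul_neg, neg_mul, sub_neg_eq_add]
    rw [neg_add_eq_sub]
  · simp only [u, d, h, if_true]

theorem v_mul_u_of_ne {i : Fin (n + 1)} {e : Fin n} (h : i ≠ e.succ) : v k o i * u k o e = 0 := by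
  rw [← v_mul_u, ← mul_assoc, v_mul_of_ne h, zero_mul]

theorem u_mul_v_of_ne {i : Fin (n + 1)} {e : Fin n} (h : e.castSucc ≠ i) :
    u k o e * v k o i = 0 := by
  rw [← u_mul_v, mul_assoc, v_mul_of_ne h, mul_zero]

theorem v_mul_d_of_ne {i : Fin (n + 1)} {e : Fin n} (h : i ≠ e.castSucc) :
    v k o i * d k o e = 0 := by
  rw [← v_mul_d, ← mul_assoc, v_mul_of_ne h, zero_mul]

theorem d_mul_v_of_ne {i : Fin (n + 1)} {e : Fin n} (h : e.succ ≠ i) : d k o e * v k o i = 0 := by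
  rw [← d_mul_v, mul_assoc, v_mul_of_ne h, mul_zero]

theorem vv (i j : Fin (n + 1)) : v k o i * v k o j = if i = j then v k o i else 0 := by
  split_ifs with h
  · rw [h, v_mul_self]
  · exact v_mul_of_ne h

theorem vu (i : Fin (n + 1)) (e : Fin n) : v k o i * u k o e = if i = e.succ then u k o e else 0 := by
  split_ifs with h
  · rw [h, v_mul_u]
  · exact v_mul_u_of_ne h

theorem uv (e : Fin n) (i : Fin (n + 1)) :
    u k o e * v k o i = if e.castSucc = i then u k o e else 0 := by
  split_ifs with h
  · rw [← h, u_mul_v]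
  · exact u_mul_v_of_ne h

theorem vd (i : Fin (n + 1)) (e : Fin n) :
    v k o i * d k o e = if i = e.castSucc then d k o e else 0 := by
  split_ifs with h
  · rw [h, v_mul_d]
  · exact v_mul_d_of_ne h

theorem dv (e : Fin n) (i : Fin (n + 1)) : d k o e * v k o i = if e.succ = i then d k o e else 0 := by
  split_ifs with h
  · rw [← h, d_mul_v]
  · exact d_mul_v_of_ne h

theorem uu_of_ne {e e' : Fin n} (h : e.castSucc ≠ e'.succ) : u k o e * u k o e' = 0 := by
  rw [← v_mul_u e', ← mul_assoc, u_mul_v_of_ne h, zero_mul]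

theorem dd_of_ne {e e' : Fin n} (h : e.succ ≠ e'.castSucc) : d k o e * d k o e' = 0 := by
  rw [← v_mul_d e', ← mul_assoc, d_mul_v_of_ne h, zero_mul]

theorem ud_of_ne {e e' : Fin n} (h : e ≠ e') : u k o e * d k o e' = 0 := by
  rw [← v_mul_d e', ← mul_assoc, u_mul_v_of_ne fun h' => h (Fin.castSucc_injective _ h'), zero_mul]

theorem du_of_ne {e e' : Fin n} (h : e ≠ e') : d k o e * u k o e' = 0 := by
  rw [← v_mul_u e', ← mul_assoc, d_mul_v_of_ne fun h' => h (Fin.succ_injective _ h'), zero_mul]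

theorem gen_arrow_eq (e : Fin n) :
    Preproj.gen k (typeA n o) (.arrow e) = if o e then u k o e else -d k o e := by
  cases h : o e <;> simp [u, d, h]

theorem gen_dual_eq (e : Fin n) :
    Preproj.gen k (typeA n o) (.dual e) = if o e then d k o e else u k o e := by
  cases h : o e <;> simp [u, d, h]

/-- This is the induction principle in the normalized generators; linearity and stability are
checked on these only. -/
theorem subalgebra_eq_top (S : Subalgebra k (PreprojA k o)) (hv : ∀ i, v k o i ∈ S)
    (hu : ∀ e, u k o e ∈ S) (hd : ∀ e, d k o e ∈ S) : S = ⊤ := by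
  rw [eq_top_iff]
  rintro x -
  obtain ⟨y, rfl⟩ : ∃ y, mk y = x := RingQuot.mkAlgHom_surjective k (PreprojRel k (typeA n o)) x
  induction y using FreeAlgebra.induction with
  | grade0 r =>
    rw [AlgHom.commutes]
    exact S.algebraMap_mem r
  | grade1 g =>
    rw [mk_ι]
    cases g with
    | vertex i => exact hv i
    | arrow e =>
      rw [gen_arrow_eq]
      split_ifs
      exacts [hu e, S.neg_mem (hd e)]
    | dual e =>
      rw [gen_dual_eq]
      split_ifs
      exacts [hd e, hu e]
  | mul a b ha hb =>
    rw [map_mul]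
    exact S.mul_mem ha hb
  | add a b ha hb =>
    rw [map_add]
    exact S.add_mem ha hb

section Modules

variable {M L : Type} [AddCommGroup M] [Module k M] [Module (PreprojA k o) M]
  [IsScalarTower k (PreprojA k o) M] [AddCommGroup L] [Module k L] [Module (PreprojA k o) L]
  [IsScalarTower k (PreprojA k o) L]

theorem smul_mem_of_gen (S : Submodule k M) (hv : ∀ i, ∀ m ∈ S, v k o i • m ∈ S)
    (hu : ∀ e, ∀ m ∈ S, u k o e • m ∈ S) (hd : ∀ e, ∀ m ∈ S, d k o e • m ∈ S)
    (x : PreprojA k o) : ∀ m ∈ S, x • m ∈ S := by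
  let T : Subalgebra k (PreprojA k o) :=
    { carrier := {x | ∀ m ∈ S, x • m ∈ S}
      mul_mem' := fun {x y} hx hy m hm => by
        rw [mul_smul]
        exact hx _ (hy m hm)
      add_mem' := fun {x y} hx hy m hm => by
        rw [add_smul]
        exact S.add_mem (hx m hm) (hy m hm)
      algebraMap_mem' := fun r m hm => by
        rw [algebraMap_smul]
        exact S.smul_mem r hm }
  have hT : T = ⊤ := subalgebra_eq_top T hv hu hd
  exact (hT ▸ Algebra.mem_top : x ∈ T)

theorem map_smul_of_gen (f : M →ₗ[k] L) (hv : ∀ i m, f (v k o i • m) = v k o i • f m)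
    (hu : ∀ e m, f (u k o e • m) = u k o e • f m) (hd : ∀ e m, f (d k o e • m) = d k o e • f m)
    (x : PreprojA k o) : ∀ m, f (x • m) = x • f m := by
  let T : Subalgebra k (PreprojA k o) :=
    { carrier := {x | ∀ m, f (x • m) = x • f m}
      mul_mem' := fun {x y} hx hy m => by rw [mul_smul, hx, hy, mul_smul]
      add_mem' := fun {x y} hx hy m => by rw [add_smul, map_add, hx, hy, add_smul]
      algebraMap_mem' := fun r m => by rw [algebraMap_smul, map_smul, algebraMap_smul] }
  have hT : T = ⊤ := subalgebra_eq_top T hv hu hd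
  exact (hT ▸ Algebra.mem_top : x ∈ T)

end Modules

/-- The universal property in the normalized generators. It supplies the representations that
separate paths. -/
theorem exists_lift {S : Type} [Ring S] [Algebra k S] (V : Fin (n + 1) → S) (U D : Fin n → S)
    (hVV : ∀ i, V i * V i = V i) (hVV' : ∀ i j, i ≠ j → V i * V j = 0) (hV : ∑ i, V i = 1)
    (hVU : ∀ e, V e.succ * U e = U e) (hUV : ∀ e, U e * V e.castSucc = U e)
    (hVD : ∀ e, V e.castSucc * D e = D e) (hDV : ∀ e, D e * V e.succ = D e)
    (hUD : ∑ e, U e * D e = ∑ e, D e * U e) :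
    ∃ f : PreprojA k o →ₐ[k] S, (∀ i, f (v k o i) = V i) ∧ (∀ e, f (u k o e) = U e) ∧
      ∀ e, f (d k o e) = D e := by
  let F : PreprojGen (Fin (n + 1)) (Fin n) → S
    | .vertex i => V i
    | .arrow e => if o e then U e else -D e
    | .dual e => if o e then D e else U e
  have hF : ∀ ⦃x y⦄, PreprojRel k (typeA n o) x y →
      FreeAlgebra.lift k F x = FreeAlgebra.lift k F y := by
    intro x y h
    cases h with
    | vertex_idem i => simp [F, hVV]
    | vertex_orth i j h => simp [F, hVV' i j h]
    | vertex_sum => simp [F, hV]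
    | tgt_arrow e => cases h : o e <;> simp [F, tgt_typeA, src_typeA, h, hVU, hVD]
    | arrow_src e => cases h : o e <;> simp [F, tgt_typeA, src_typeA, h, hUV, hDV]
    | src_dual e => cases h : o e <;> simp [F, tgt_typeA, src_typeA, h, hVU, hVD]
    | dual_tgt e => cases h : o e <;> simp [F, tgt_typeA, src_typeA, h, hUV, hDV]
    | preproj =>
      simp only [map_sum, map_mul, FreeAlgebra.lift_ι_apply, F]
      rw [← sub_eq_zero, ← Finset.sum_sub_distrib] at hUD ⊢
      rw [← hUD]
      refine Finset.sum_congr rfl fun e _ => ?_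
      cases h : o e <;> simp
      abel
  let f : PreprojA k o →ₐ[k] S := RingQuot.liftAlgHom k ⟨FreeAlgebra.lift k F, hF⟩
  have hf : ∀ g, f (Preproj.gen k (typeA n o) g) = F g := fun g =>
    (RingQuot.liftAlgHom_mkAlgHom_apply k _ hF _).trans (FreeAlgebra.lift_ι_apply F g)
  refine ⟨f, fun i => hf _, fun e => ?_, fun e => ?_⟩
  · cases h : o e <;> simp [u, h, hf, F]
  · cases h : o e <;> simp [d, h, hf, F]

end PreprojA

end TypeA

end FinQuiver

/-! ### Operators given by partial maps of a basis -/

/-- The linear operator that sends the basis vector `j` to the basis vector `f j`, or to `0`. -/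
noncomputable def partialMapOp (k : Type) [Field k] {J : Type} (f : J → Option J) :
    Module.End k (J →₀ k) :=
  Finsupp.linearCombination k fun j => (f j).elim 0 fun i => Finsupp.single i 1

section PartialMapOp

variable {k : Type} [Field k] {J : Type}

@[simp] theorem partialMapOp_single (f : J → Option J) (j : J) :
    partialMapOp k f (Finsupp.single j 1) = (f j).elim 0 fun i => Finsupp.single i 1 := by
  simp [partialMapOp]

theorem partialMapOp_mul (f g : J → Option J) :
    partialMapOp k f * partialMapOp k g = partialMapOp k fun j => (g j).bind f := by
  ext j : 2
  rw [LinearMap.comp_apply, LinearMap.comp_apply, Finsupp.lsingle_apply, Module.End.mul_apply,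
    partialMapOp_single, partialMapOp_single]
  cases g j <;> simp

theorem partialMapOp_none : partialMapOp k (fun _ : J => none) = 0 := by
  ext j : 2
  simp

end PartialMapOp

/-! ### The preprojective algebra of type `A₃` -/

/-- The nonzero paths of `Π(A₃)`: `p i j` is the path of minimal length from `j` to `i`, and `z` is
the path of length two from `1` to `1`. -/
inductive A3Path : Type
  | p₀₀ | p₁₀ | p₂₀ | p₂₂ | p₁₂ | p₀₂ | p₁₁ | p₀₁ | p₂₁ | z
  deriving DecidableEq

namespace A3Path

instance : Fintype A3Path :=
  ⟨{p₀₀, p₁₀, p₂₀, p₂₂, p₁₂, p₀₂, p₁₁, p₀₁, p₂₁, z}, fun x => by cases x <;> decide⟩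

theorem sum_eq {M : Type} [AddCommMonoid M] (f : A3Path → M) :
    ∑ i, f i = f p₀₀ + f p₁₀ + f p₂₀ + f p₂₂ + f p₁₂ + f p₀₂ + f p₁₁ + f p₀₁ + f p₂₁ + f z := by
  have : (Finset.univ : Finset A3Path) = {p₀₀, p₁₀, p₂₀, p₂₂, p₁₂, p₀₂, p₁₁, p₀₁, p₂₁, z} := rfl
  rw [this]
  simp [Finset.sum_insert, add_assoc]

/-- The end point of a path. -/
def tgt : A3Path → Fin 3
  | p₀₀ => 0
  | p₁₀ => 1
  | p₂₀ => 2
  | p₂₂ => 2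
  | p₁₂ => 1
  | p₀₂ => 0
  | p₁₁ => 1
  | p₀₁ => 0
  | p₂₁ => 2
  | z => 1

/-- Composition with a trivial path. -/
def vAct (i : Fin 3) (j : A3Path) : Option A3Path := if tgt j = i then some j else none

/-- Composition with the arrows `e → e + 1`. -/
def uAct : Fin 2 → A3Path → Option A3Path
  | 0, p₀₀ => some p₁₀
  | 0, p₀₁ => some z
  | 1, p₁₀ => some p₂₀
  | 1, p₁₁ => some p₂₁
  | _, _ => none

/-- Composition with the arrows `e + 1 → e`. -/
def dAct : Fin 2 → A3Path → Option A3Path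
  | 0, p₁₁ => some p₀₁
  | 0, p₁₂ => some p₀₂
  | 1, p₂₂ => some p₁₂
  | 1, p₂₁ => some z
  | _, _ => none

end A3Path

namespace FinQuiver.PreprojA

open A3Path

variable {k : Type} [Field k] {o : Fin 2 → Bool}

/-- The preprojective relation is cut into its components at the vertices; i = 0, 1, 2 yield the
three relations that follow. -/
theorem v_mul_sum (i : Fin 3) : v k o i * (u k o 0 * d k o 0 + u k o 1 * d k o 1) =
    v k o i * (d k o 0 * u k o 0 + d k o 1 * u k o 1) := by
  have h := sum_u_mul_d (k := k) (o := o)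
  rw [Fin.sum_univ_two, Fin.sum_univ_two] at h
  rw [h]

theorem d₀u₀ : d k o 0 * u k o 0 = 0 := by
  have h := v_mul_sum (k := k) (o := o) 0
  simpa +decide [mul_add, ← mul_assoc, vu, vd] using h.symm

theorem u₀d₀ : u k o 0 * d k o 0 = d k o 1 * u k o 1 := by
  have h := v_mul_sum (k := k) (o := o) 1
  simpa +decide [mul_add, ← mul_assoc, vu, vd] using h

theorem u₁d₁ : u k o 1 * d k o 1 = 0 := by
  have h := v_mul_sum (k := k) (o := o) 2
  simpa +decide [mul_add, ← mul_assoc, vu, vd] using h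

theorem d₁u₁u₀ : d k o 1 * u k o 1 * u k o 0 = 0 := by
  rw [← u₀d₀, mul_assoc, d₀u₀, mul_zero]

theorem d₁u₁d₁ : d k o 1 * u k o 1 * d k o 1 = 0 := by
  rw [mul_assoc, u₁d₁, mul_zero]

theorem d₀d₁u₁ : d k o 0 * d k o 1 * u k o 1 = 0 := by
  rw [mul_assoc, ← u₀d₀, ← mul_assoc, d₀u₀, zero_mul]

variable (k o) in
/-- The elements of `Π(A₃)` given by paths. -/
noncomputable def path : A3Path → PreprojA k o
  | p₀₀ => v k o 0
  | p₁₀ => u k o 0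
  | p₂₀ => u k o 1 * u k o 0
  | p₂₂ => v k o 2
  | p₁₂ => d k o 1
  | p₀₂ => d k o 0 * d k o 1
  | p₁₁ => v k o 1
  | p₀₁ => d k o 0
  | p₂₁ => u k o 1
  | z => d k o 1 * u k o 1

theorem v_mul_path (i : Fin 3) (j : A3Path) :
    v k o i * path k o j = (vAct i j).elim 0 (path k o) := by
  fin_cases i <;> cases j <;>
    simp +decide [path, vAct, tgt, ← mul_assoc, vv, vu, vd]

theorem u_mul_path (e : Fin 2) (j : A3Path) :
    u k o e * path k o j = (uAct e j).elim 0 (path k o) := by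
  fin_cases e <;> cases j <;>
    simp +decide [path, uAct, ← mul_assoc, uv, uu_of_ne, ud_of_ne, u₁d₁, u₀d₀, d₁u₁d₁]

theorem d_mul_path (e : Fin 2) (j : A3Path) :
    d k o e * path k o j = (dAct e j).elim 0 (path k o) := by
  fin_cases e <;> cases j <;>
    simp +decide [path, dAct, ← mul_assoc, dv, dd_of_ne, du_of_ne, d₀u₀, d₁u₁u₀, d₀d₁u₁]

/-- Formal paths carry a representation of Π by composition, and a path is recovered from its action
on the formal identity. This gives linear independence. -/
theorem exists_coord : ∃ φ : PreprojA k o →ₗ[k] (A3Path →₀ k), ∀ j, φ (path k o j) =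
    Finsupp.single j 1 := by
  obtain ⟨f, hv, hu, hd⟩ := exists_lift (k := k) (o := o)
    (fun i => partialMapOp k (vAct i)) (fun e => partialMapOp k (uAct e))
    (fun e => partialMapOp k (dAct e))
    (fun i => by
      rw [partialMapOp_mul]
      congr 1
      funext j
      revert i j
      decide)
    (fun i j h => by
      rw [partialMapOp_mul, ← partialMapOp_none]
      congr 1
      funext l
      revert i j l
      decide)
    (by
      ext j : 2
      cases j <;> simp +decide [Fin.sum_univ_three, vAct])
    (fun i => by
      rw [partialMapOp_mul]
      congr 1
      funext j
      revert i j
      decide)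
    (fun i => by
      rw [partialMapOp_mul]
      congr 1
      funext j
      revert i j
      decide)
    (fun i => by
      rw [partialMapOp_mul]
      congr 1
      funext j
      revert i j
      decide)
    (fun i => by
      rw [partialMapOp_mul]
      congr 1
      funext j
      revert i j
      decide)
    (by
      ext j : 2
      cases j <;> simp +decide [Fin.sum_univ_two, partialMapOp_mul, uAct, dAct])
  -- The evaluation point is the sum of the three trivial paths, the formal counterpart of 1.
  refine ⟨LinearMap.applyₗ (Finsupp.single p₀₀ 1 + Finsupp.single p₁₁ 1 + Finsupp.single p₂₂ 1) ∘ₗ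
    f.toLinearMap, fun j => ?_⟩
  cases j <;> simp +decide [path, hv, hu, hd, vAct, uAct, dAct]

/-- The span contains 1 and is stable under left multiplication by the generators. -/
theorem span_path : Submodule.span k (Set.range (path k o)) = ⊤ := by
  rw [eq_top_iff]
  rintro x -
  have hS : ∀ (g : PreprojA k o) (act : A3Path → Option A3Path),
      (∀ j, g * path k o j = (act j).elim 0 (path k o)) →
      ∀ m ∈ Submodule.span k (Set.range (path k o)),
        g • m ∈ Submodule.span k (Set.range (path k o)) := by
    intro g act h m hm
    induction hm using Submodule.span_induction with
    | mem m hm =>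
      obtain ⟨j, rfl⟩ := hm
      rw [smul_eq_mul, h]
      cases act j with
      | none => exact Submodule.zero_mem _
      | some j => exact Submodule.subset_span ⟨j, rfl⟩
    | zero => rw [smul_zero]; exact Submodule.zero_mem _
    | add m m' _ _ hm hm' => rw [smul_add]; exact Submodule.add_mem _ hm hm'
    | smul c m _ hm => rw [smul_comm]; exact Submodule.smul_mem _ c hm
  have h1 : (1 : PreprojA k o) ∈ Submodule.span k (Set.range (path k o)) := by
    rw [← sum_v, Fin.sum_univ_three]
    exact Submodule.add_mem _ (Submodule.add_mem _ (Submodule.subset_span ⟨p₀₀, rfl⟩)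
      (Submodule.subset_span ⟨p₁₁, rfl⟩)) (Submodule.subset_span ⟨p₂₂, rfl⟩)
  have := smul_mem_of_gen _ (fun i => hS _ _ (v_mul_path i)) (fun e => hS _ _ (u_mul_path e))
    (fun e => hS _ _ (d_mul_path e)) x 1 h1
  rwa [smul_eq_mul, mul_one] at this

variable (k o) in
/-- The path basis of `Π(A₃)`. -/
noncomputable def pathBasis : Module.Basis A3Path k (PreprojA k o) :=
  Module.Basis.mk (by
    obtain ⟨φ, hφ⟩ := exists_coord (k := k) (o := o)
    refine LinearIndependent.of_comp φ ?_
    have : φ ∘ path k o = (Finsupp.basisSingleOne (ι := A3Path) (R := k)) := by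
      funext j
      simp [hφ]
    rw [this]
    exact Module.Basis.linearIndependent _) span_path.ge

theorem pathBasis_apply (j : A3Path) : pathBasis k o j = path k o j := Module.Basis.mk_apply _ _ _

end FinQuiver.PreprojA

/-! ### Socle series of modules over preprojective algebras of type `A` -/

namespace FinQuiver.PreprojA

section SocleSeries

variable {k : Type} [Field k] {n : ℕ} {o : Fin n → Bool}

variable (k o) in
/-- The trivial paths at vertices different from `i`, and all arrows. -/
def socGen (i : Fin (n + 1)) : Set (PreprojA k o) :=
  {x | (∃ j, j ≠ i ∧ x = v k o j) ∨ (∃ e, x = u k o e) ∨ ∃ e, x = d k o e}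

theorem socGen_subset_simpleIdeal (i : Fin (n + 1)) :
    socGen k o i ⊆ simpleIdeal k (typeA n o) i := by
  have ha : ∀ e, Preproj.gen k (typeA n o) (.arrow e) ∈ simpleIdeal k (typeA n o) i := fun e =>
    Ideal.subset_span (Or.inl (Or.inr ⟨e, rfl⟩))
  have hd : ∀ e, Preproj.gen k (typeA n o) (.dual e) ∈ simpleIdeal k (typeA n o) i := fun e =>
    Ideal.subset_span (Or.inr ⟨e, rfl⟩)
  rintro x (⟨j, hj, rfl⟩ | ⟨e, rfl⟩ | ⟨e, rfl⟩)
  · have : v k o j = v k o j * (1 - v k o i) := by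
      rw [mul_sub, mul_one, v_mul_of_ne hj, sub_zero]
    rw [this]
    exact Ideal.mul_mem_left _ _ (Ideal.subset_span (Or.inl (Or.inl rfl)))
  · rw [u]
    split_ifs
    exacts [ha e, hd e]
  · rw [d]
    split_ifs
    exacts [hd e, neg_mem (ha e)]

variable {M : Type} [AddCommGroup M] [Module (PreprojA k o) M]

theorem simpleIdeal_smul_eq_zero {i : Fin (n + 1)} {m : M}
    (h : ∀ q ∈ socGen k o i, q • m = 0) : ∀ x ∈ simpleIdeal k (typeA n o) i, x • m = 0 := by
  have hu : ∀ e, u k o e • m = 0 := fun e => h _ (Or.inr (Or.inl ⟨e, rfl⟩))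
  have hd : ∀ e, d k o e • m = 0 := fun e => h _ (Or.inr (Or.inr ⟨e, rfl⟩))
  have hle : simpleIdeal k (typeA n o) i ≤
      LinearMap.ker (LinearMap.toSpanSingleton (PreprojA k o) M m) := by
    refine Ideal.span_le.2 ?_
    rintro x ((rfl | ⟨e, rfl⟩) | ⟨e, rfl⟩)
    · change (1 - v k o i) • m = 0
      rw [← sum_v, ← Finset.sum_erase_eq_sub (Finset.mem_univ i), Finset.sum_smul]
      exact Finset.sum_eq_zero fun j hj => h _ (Or.inl ⟨j, Finset.ne_of_mem_erase hj, rfl⟩)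
    · change Preproj.gen k (typeA n o) (.arrow e) • m = 0
      rw [gen_arrow_eq]
      split_ifs <;> simp [hu, hd]
    · change Preproj.gen k (typeA n o) (.dual e) • m = 0
      rw [gen_dual_eq]
      split_ifs <;> simp [hu, hd]
  exact fun x hx => hle hx

/-- Each generator is congruent to 0 or 1 modulo the ideal, so the quotient is spanned by 1. -/
theorem exists_sub_algebraMap_mem (i : Fin (n + 1)) (x : PreprojA k o) :
    ∃ c : k, x - algebraMap k _ c ∈ simpleIdeal k (typeA n o) i := by
  let S : Subalgebra k (PreprojA k o) :=
    { carrier := {x | ∃ c : k, x - algebraMap k _ c ∈ simpleIdeal k (typeA n o) i}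
      mul_mem' := by
        rintro x y ⟨c, hc⟩ ⟨c', hc'⟩
        refine ⟨c * c', ?_⟩
        have : x * y - algebraMap k _ (c * c') = x * (y - algebraMap k _ c') +
            algebraMap k _ c' * (x - algebraMap k _ c) := by
          rw [mul_sub, mul_sub, map_mul, Algebra.commutes c' x, Algebra.commutes c']
          abel
        rw [this]
        exact add_mem (Ideal.mul_mem_left _ _ hc') (Ideal.mul_mem_left _ _ hc)
      add_mem' := by
        rintro x y ⟨c, hc⟩ ⟨c', hc'⟩
        refine ⟨c + c', ?_⟩
        rw [map_add, add_sub_add_comm]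
        exact add_mem hc hc'
      algebraMap_mem' := fun r => ⟨r, by rw [sub_self]; exact zero_mem _⟩ }
  have h0 : ∀ x ∈ socGen k o i, x ∈ S := fun x hx => ⟨0, by
    rw [map_zero, sub_zero]; exact socGen_subset_simpleIdeal i hx⟩
  have hS : S = ⊤ := by
    refine subalgebra_eq_top S (fun j => ?_) (fun e => h0 _ (Or.inr (Or.inl ⟨e, rfl⟩)))
      (fun e => h0 _ (Or.inr (Or.inr ⟨e, rfl⟩)))
    by_cases hj : j = i
    · refine ⟨1, ?_⟩
      rw [hj, map_one, ← neg_sub]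
      exact neg_mem (Ideal.subset_span (Or.inl (Or.inl rfl)))
    · exact h0 _ (Or.inl ⟨j, hj, rfl⟩)
  exact (hS ▸ Algebra.mem_top : x ∈ S)

/-- The vectors killed by the ideal form a submodule that contains every copy of S_i, and a nonzero
such vector spans a copy of S_i. Generators of the ideal suffice for the test. -/
theorem mem_socAt_iff {i : Fin (n + 1)} {m : M} :
    m ∈ socAt k (typeA n o) M i ↔ ∀ q ∈ socGen k o i, q • m = 0 := by
  constructor
  · intro hm q hq
    let K : Submodule (PreprojA k o) M :=
      { carrier := {m | ∀ x ∈ simpleIdeal k (typeA n o) i, x • m = 0}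
        add_mem' := fun {a b} ha hb x hx => by rw [smul_add, ha x hx, hb x hx, add_zero]
        zero_mem' := fun x _ => smul_zero x
        smul_mem' := fun r m hm x hx => by
          obtain ⟨c, hc⟩ := exists_sub_algebraMap_mem i r
          have h1 : r • m = algebraMap k (PreprojA k o) c • m := by
            rw [← sub_eq_zero, ← sub_smul, hm _ hc]
          rw [h1, ← mul_smul, ← Algebra.commutes, mul_smul, hm x hx, smul_zero] }
    have hle : socAt k (typeA n o) M i ≤ K := by
      refine sSup_le ?_
      rintro N ⟨e⟩ y hy x hx
      have h1 : ∀ s : SimpleAt k (typeA n o) i, x • s = 0 := by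
        intro s
        obtain ⟨r, rfl⟩ := Submodule.Quotient.mk_surjective _ s
        obtain ⟨c, hc⟩ := exists_sub_algebraMap_mem i r
        rw [← Submodule.Quotient.mk_smul, Submodule.Quotient.mk_eq_zero, smul_eq_mul]
        have : x * r = x * (r - algebraMap k _ c) + algebraMap k _ c * x := by
          rw [mul_sub, Algebra.commutes c x]
          abel
        rw [this]
        exact add_mem (Ideal.mul_mem_left _ _ hc) (Ideal.mul_mem_left _ _ hx)
      have h2 : x • (⟨y, hy⟩ : N) = 0 := e.injective (by rw [map_smul, h1, map_zero])
      exact congrArg Subtype.val h2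
    exact hle hm q (socGen_subset_simpleIdeal i hq)
  · intro h
    have h' := simpleIdeal_smul_eq_zero h
    by_cases hm : m = 0
    · rw [hm]
      exact zero_mem _
    have hle : simpleIdeal k (typeA n o) i ≤
      LinearMap.ker (LinearMap.toSpanSingleton (PreprojA k o) M m) := h'
    let f : SimpleAt k (typeA n o) i →ₗ[PreprojA k o] M := Submodule.liftQ _ _ hle
    have hf : Function.Injective f := by
      rw [← LinearMap.ker_eq_bot, Submodule.ker_liftQ_eq_bot]
      intro r hr
      have hr' : r • m = 0 := hr
      obtain ⟨c, hc⟩ := exists_sub_algebraMap_mem i r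
      have h1 : algebraMap k (PreprojA k o) c • m = 0 := by
        rw [← hr', ← sub_eq_zero, ← sub_smul, ← neg_sub, neg_smul, h' _ hc, neg_zero]
      have hc0 : c = 0 := by
        by_contra hc0
        apply hm
        rw [← one_smul (PreprojA k o) m, ← map_one (algebraMap k (PreprojA k o)),
          ← inv_mul_cancel₀ hc0, map_mul, mul_smul, h1, smul_zero]
      rwa [hc0, map_zero, sub_zero] at hc
    have hr : LinearMap.range f ≤ socAt k (typeA n o) M i :=
      le_sSup ⟨(LinearEquiv.ofInjective f hf).symm⟩
    refine hr ⟨Submodule.Quotient.mk 1, ?_⟩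
    exact one_smul _ m

variable (k o) in
/-- The products of generators that kill the socle series of a word. -/
def socKill : List (Fin (n + 1)) → Set (PreprojA k o)
  | [] => {1}
  | i :: l => {x | ∃ q ∈ socGen k o i, ∃ p ∈ socKill l, x = q * p}

/-- The letter divided out first contributes the leftmost factor: the remaining factors must carry m
into soc_i, which that factor kills. -/
theorem mem_socSeq_iff (l : List (Fin (n + 1))) :
    ∀ {M : Type} [AddCommGroup M] [Module (PreprojA k o) M] {m : M},
      m ∈ socSeq k (typeA n o) l M ↔ ∀ p ∈ socKill k o l, p • m = 0 := by
  induction l with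
  | nil =>
    intro M _ _ m
    simp [socSeq, socKill]
  | cons i l ih =>
    intro M _ _ m
    rw [socSeq, Submodule.mem_comap, ih]
    constructor
    · rintro h x ⟨q, hq, p, hp, rfl⟩
      have h1 := h p hp
      rw [← map_smul, Submodule.mkQ_apply, Submodule.Quotient.mk_eq_zero, mem_socAt_iff] at h1
      rw [mul_smul, h1 q hq]
    · intro h p hp
      rw [← map_smul, Submodule.mkQ_apply, Submodule.Quotient.mk_eq_zero, mem_socAt_iff]
      intro q hq
      rw [← mul_smul]
      exact h _ ⟨q, hq, p, hp, rfl⟩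

/-- Extra letters only enlarge the series, so a word may be tested on a subword. -/
theorem socSeq_mono {l l' : List (Fin (n + 1))} (h : l.Sublist l') :
    ∀ (M : Type) [AddCommGroup M] [Module (PreprojA k o) M],
      socSeq k (typeA n o) l M ≤ socSeq k (typeA n o) l' M := by
  induction h with
  | slnil => exact fun M _ _ => le_rfl
  | cons i _ ih =>
    intro M _ _ m hm
    rw [mem_socSeq_iff]
    rintro x ⟨q, hq, p, hp, rfl⟩
    rw [mul_smul, mem_socSeq_iff _ |>.1 (ih M hm) p hp, smul_zero]
  | cons_cons i _ ih =>
    intro M _ _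
    exact Submodule.comap_mono (ih _)

end SocleSeries

end FinQuiver.PreprojA

/-! ### Reduced words in the Weyl group of type `A₃` -/

namespace FinQuiver

section Words

variable (o : Fin 2 → Bool)

/-- The adjacent transpositions of `Fin 4`. -/
def adjSwap (i : Fin 3) : Equiv.Perm (Fin 4) := Equiv.swap i.castSucc i.succ

theorem isLiftable_adjSwap : (typeA 2 o).coxeterMatrix.IsLiftable adjSwap := by
  have h : ∀ o : Fin 2 → Bool, ∀ i j : Fin 3,
      (adjSwap i * adjSwap j) ^ (if i = j then 1 else coxeterEntry ((typeA 2 o).edgesBetween i j).card)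
        = 1 := by
    decide
  exact h o

/-- Equations in the Weyl group are moved to S₄, where they are decidable. The homomorphism is
enough; its injectivity plays no role. -/
theorem prod_adjSwap_eq {l l' : List (Fin 3)}
    (h : (typeA 2 o).cox.wordProd l = (typeA 2 o).cox.wordProd l') :
    (l.map adjSwap).prod = (l'.map adjSwap).prod := by
  have key : ∀ l : List (Fin 3), (typeA 2 o).cox.lift ⟨adjSwap, isLiftable_adjSwap o⟩
      ((typeA 2 o).cox.wordProd l) = (l.map adjSwap).prod := fun l => by
    rw [CoxeterSystem.wordProd, map_list_prod, List.map_map]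
    congr 2
  rw [← key, ← key, h]

theorem length_le_of_prod_adjSwap (l : List (Fin 3))
    (h : (l.map adjSwap).prod = ([0, 2, 1, 0, 2].map adjSwap).prod) : 5 ≤ l.length := by
  have h0 : (1 : Equiv.Perm (Fin 4)) ≠ ([0, 2, 1, 0, 2].map adjSwap).prod := by decide
  have h1 : ∀ a, ([a].map adjSwap).prod ≠ ([0, 2, 1, 0, 2].map adjSwap).prod := by decide
  have h2 : ∀ a b, ([a, b].map adjSwap).prod ≠ ([0, 2, 1, 0, 2].map adjSwap).prod := by decide
  have h3 : ∀ a b c, ([a, b, c].map adjSwap).prod ≠ ([0, 2, 1, 0, 2].map adjSwap).prod := by decide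
  have h4 : ∀ a b c d, ([a, b, c, d].map adjSwap).prod ≠ ([0, 2, 1, 0, 2].map adjSwap).prod := by
    decide
  match l with
  | [] => exact absurd h h0
  | [a] => exact absurd h (h1 a)
  | [a, b] => exact absurd h (h2 a b)
  | [a, b, c] => exact absurd h (h3 a b c)
  | [a, b, c, d] => exact absurd h (h4 a b c d)
  | a :: b :: c :: d :: e :: l => simp

/-- A reduced word for the same element has the same image in S₄, hence at least five letters. -/
theorem isReduced_longWord : (typeA 2 o).cox.IsReduced [0, 2, 1, 0, 2] := by
  obtain ⟨l, hl, hl'⟩ := (typeA 2 o).cox.exists_isReduced ((typeA 2 o).cox.wordProd [0, 2, 1, 0, 2])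
  have h1 := length_le_of_prod_adjSwap l (prod_adjSwap_eq o hl'.symm)
  have h2 := (typeA 2 o).cox.length_wordProd_le [0, 2, 1, 0, 2]
  have h3 := hl.eq
  rw [← hl'] at h3
  exact le_antisymm h2 (by rw [h3]; exact h1)

/-- The torsion-free class admits every reduced word of w, so the subwords needed later must occur
in all of them. The reduced words have five letters, which leaves a finite check in S₄. -/
theorem sublist_of_isReduced {l : List (Fin 3)} (hl : (typeA 2 o).cox.IsReduced l)
    (h : (typeA 2 o).cox.wordProd l = (typeA 2 o).cox.wordProd [0, 2, 1, 0, 2]) :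
    [0, 1, 2].Sublist l ∧ [2, 1, 0].Sublist l := by
  have h1 : l.length = 5 := by
    rw [← hl.eq, h, (isReduced_longWord o).eq]
    rfl
  have h2 := prod_adjSwap_eq o h
  have key : ∀ a b c d e, ([a, b, c, d, e].map adjSwap).prod = ([0, 2, 1, 0, 2].map adjSwap).prod →
      [0, 1, 2].Sublist [a, b, c, d, e] ∧ [2, 1, 0].Sublist [a, b, c, d, e] := by
    decide
  match l, h1 with
  | [a, b, c, d, e], _ => exact key a b c d e h2

theorem eq_singleton_of_isReduced {l : List (Fin 3)} {i : Fin 3} (hl : (typeA 2 o).cox.IsReduced l)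
    (h : (typeA 2 o).cox.wordProd l = (typeA 2 o).cox.simple i) : l = [i] := by
  have h1 : l.length = 1 := by rw [← hl.eq, h, (typeA 2 o).cox.length_simple]
  rw [← (typeA 2 o).cox.wordProd_singleton] at h
  have h2 := prod_adjSwap_eq o h
  have key : ∀ a b, ([a].map adjSwap).prod = ([b].map adjSwap).prod → a = b := by decide
  match l, h1 with
  | [a], _ => rw [key a i h2]

end Words

end FinQuiver

/-! ### Finite dimensional modules -/

section FinDimSub

variable {k A M N : Type} [Field k] [Ring A] [Algebra k A] [AddCommGroup M] [Module A M]
  [AddCommGroup N] [Module A N]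

theorem FinDim.of_injective (h : FinDim k A M) (g : N →ₗ[A] M) (hg : Function.Injective g) :
    FinDim k A N := by
  let _ : Module k M := Module.compHom M (algebraMap k A)
  let _ : Module k N := Module.compHom N (algebraMap k A)
  let g' : N →ₗ[k] M :=
    { toFun := g
      map_add' := g.map_add
      map_smul' := fun c x => g.map_smul (algebraMap k A c) x }
  have : Module.Finite k M := h
  have h' : Module.Finite k N := Module.Finite.of_injective g' hg
  exact h'

theorem FinDim.self (h : Module.Finite k A) : FinDim k A A :=
  Module.Finite.equiv (M := A)
    { toFun := fun x => (x : RestrictScalars k A A)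
      invFun := fun x => x
      map_add' := fun _ _ => rfl
      map_smul' := fun c x => Algebra.smul_def c x
      left_inv := fun _ => rfl
      right_inv := fun _ => rfl }

end FinDimSub

/-! ### Torsion radicals of `Π(A₃)` -/

namespace FinQuiver.PreprojA

open A3Path

section TorsionRadicals

variable {k : Type} [Field k] {o : Fin 2 → Bool}

theorem exists_of_mem_socGen {i : Fin 3} {q : PreprojA k o} (hq : q ∈ socGen k o i) (j : A3Path) :
    q * path k o j = 0 ∨ (A3Path.tgt j ≠ i ∧ q * path k o j = path k o j) ∨
      (∃ e, q * path k o j = (uAct e j).elim 0 (path k o)) ∨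
      ∃ e, q * path k o j = (dAct e j).elim 0 (path k o) := by
  obtain ⟨l, hl, rfl⟩ | ⟨e, rfl⟩ | ⟨e, rfl⟩ := hq
  · rw [v_mul_path, vAct]
    split_ifs with h
    · exact Or.inr (Or.inl ⟨h ▸ hl, rfl⟩)
    · exact Or.inl rfl
  · exact Or.inr (Or.inr (Or.inl ⟨e, u_mul_path e j⟩))
  · exact Or.inr (Or.inr (Or.inr ⟨e, d_mul_path e j⟩))

/-- P₀ is uniserial with factors S₀, S₁, S₂ from top to socle, so the letters 2, 1, 0 strip it
completely from below. -/
theorem socKill_mul_v₀ : ∀ p ∈ socKill k o [2, 1, 0], p * path k o p₀₀ = 0 := by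
  have h0 : ∀ q ∈ socGen k o 0, q * path k o p₀₀ = 0 ∨ q * path k o p₀₀ = path k o p₁₀ := by
    intro q hq
    obtain h | ⟨h, -⟩ | ⟨e, h⟩ | ⟨e, h⟩ := exists_of_mem_socGen hq p₀₀
    · exact Or.inl h
    · exact absurd rfl h
    · fin_cases e <;> simp_all [uAct]
    · fin_cases e <;> simp_all [dAct]
  have h1 : ∀ q ∈ socGen k o 1, q * path k o p₁₀ = 0 ∨ q * path k o p₁₀ = path k o p₂₀ := by
    intro q hq
    obtain h | ⟨h, -⟩ | ⟨e, h⟩ | ⟨e, h⟩ := exists_of_mem_socGen hq p₁₀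
    · exact Or.inl h
    · exact absurd rfl h
    · fin_cases e <;> simp_all [uAct]
    · fin_cases e <;> simp_all [dAct]
  have h2 : ∀ q ∈ socGen k o 2, q * path k o p₂₀ = 0 := by
    intro q hq
    obtain h | ⟨h, -⟩ | ⟨e, h⟩ | ⟨e, h⟩ := exists_of_mem_socGen hq p₂₀
    · exact h
    · exact absurd rfl h
    · fin_cases e <;> simp_all [uAct]
    · fin_cases e <;> simp_all [dAct]
  rintro p ⟨q, hq, p, ⟨q', hq', p', ⟨q'', hq'', p'', rfl, rfl⟩, rfl⟩, rfl⟩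
  rw [mul_one, mul_assoc, mul_assoc]
  obtain h | h := h0 q'' hq''
  · rw [h, mul_zero, mul_zero]
  obtain h' | h' := h1 q' hq'
  · rw [h, h', mul_zero]
  · rw [h, h', h2 q hq]

/-- The mirror image: P₂ has factors S₂, S₁, S₀ from top to socle. -/
theorem socKill_mul_v₂ : ∀ p ∈ socKill k o [0, 1, 2], p * path k o p₂₂ = 0 := by
  have h0 : ∀ q ∈ socGen k o 2, q * path k o p₂₂ = 0 ∨ q * path k o p₂₂ = path k o p₁₂ := by
    intro q hq
    obtain h | ⟨h, -⟩ | ⟨e, h⟩ | ⟨e, h⟩ := exists_of_mem_socGen hq p₂₂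
    · exact Or.inl h
    · exact absurd rfl h
    · fin_cases e <;> simp_all [uAct]
    · fin_cases e <;> simp_all [dAct]
  have h1 : ∀ q ∈ socGen k o 1, q * path k o p₁₂ = 0 ∨ q * path k o p₁₂ = path k o p₀₂ := by
    intro q hq
    obtain h | ⟨h, -⟩ | ⟨e, h⟩ | ⟨e, h⟩ := exists_of_mem_socGen hq p₁₂
    · exact Or.inl h
    · exact absurd rfl h
    · fin_cases e <;> simp_all [uAct]
    · fin_cases e <;> simp_all [dAct]
  have h2 : ∀ q ∈ socGen k o 0, q * path k o p₀₂ = 0 := by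
    intro q hq
    obtain h | ⟨h, -⟩ | ⟨e, h⟩ | ⟨e, h⟩ := exists_of_mem_socGen hq p₀₂
    · exact h
    · exact absurd rfl h
    · fin_cases e <;> simp_all [uAct]
    · fin_cases e <;> simp_all [dAct]
  rintro p ⟨q, hq, p, ⟨q', hq', p', ⟨q'', hq'', p'', rfl, rfl⟩, rfl⟩, rfl⟩
  rw [mul_one, mul_assoc, mul_assoc]
  obtain h | h := h0 q'' hq''
  · rw [h, mul_zero, mul_zero]
  obtain h' | h' := h1 q' hq'
  · rw [h, h', mul_zero]
  · rw [h, h', h2 q hq]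

variable (k o) in
/-- The kernel of the coordinate at the trivial path `1`: the submodule of `Π` spanned by all other
paths. -/
noncomputable def radSubmodule : Submodule (PreprojA k o) (PreprojA k o) where
  carrier := {x | (pathBasis k o).coord p₁₁ x = 0}
  add_mem' := fun {x y} hx hy => by
    rw [Set.mem_ofPred_eq] at *
    rw [map_add, hx, hy, add_zero]
  zero_mem' := map_zero _
  smul_mem' := by
    have key : ∀ (g : PreprojA k o) (act : A3Path → Option A3Path),
        (∀ j, g * path k o j = (act j).elim 0 (path k o)) → (∀ j, act j = some p₁₁ → j = p₁₁) →
        ∀ m ∈ LinearMap.ker ((pathBasis k o).coord p₁₁),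
          g • m ∈ LinearMap.ker ((pathBasis k o).coord p₁₁) := by
      intro g act h hact m hm
      rw [LinearMap.mem_ker, Module.Basis.coord_apply] at hm
      rw [LinearMap.mem_ker, ← (pathBasis k o).sum_repr m, Finset.smul_sum, map_sum]
      refine Finset.sum_eq_zero fun j _ => ?_
      by_cases hj : j = p₁₁
      · rw [hj, hm, zero_smul, smul_zero, map_zero]
      · rw [smul_comm, pathBasis_apply, smul_eq_mul, h, map_smul]
        cases hj' : act j with
        | none => simp
        | some i =>
          have hi : i ≠ p₁₁ := fun hi => hj (hact j (by rw [hj', hi]))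
          simp [← pathBasis_apply, hi]
    exact smul_mem_of_gen (LinearMap.ker ((pathBasis k o).coord p₁₁))
      (fun i => key _ _ (v_mul_path i) (by revert i; decide))
      (fun e => key _ _ (u_mul_path e) (by revert e; decide))
      (fun e => key _ _ (d_mul_path e) (by revert e; decide))

theorem mem_radSubmodule {x : PreprojA k o} :
    x ∈ radSubmodule k o ↔ (pathBasis k o).repr x p₁₁ = 0 := Iff.rfl

theorem exists_eq_of_mem_radSubmodule {x : PreprojA k o} (hx : x ∈ radSubmodule k o) :
    ∃ a b c e, x = a * v k o 0 + b * v k o 2 + c * d k o 0 + e * u k o 1 := by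
  rw [mem_radSubmodule] at hx
  let r := (pathBasis k o).repr x
  -- The path z is a multiple of both d₀ and u₁; here it is attributed to u₁, as z = d₁ u₁.
  refine ⟨r p₀₀ • 1 + r p₁₀ • u k o 0 + r p₂₀ • (u k o 1 * u k o 0),
    r p₂₂ • 1 + r p₁₂ • d k o 1 + r p₀₂ • (d k o 0 * d k o 1), r p₀₁ • 1,
    r p₂₁ • 1 + r z • d k o 1, ?_⟩
  conv_lhs => rw [← (pathBasis k o).sum_repr x, A3Path.sum_eq, hx]
  simp +decide [pathBasis_apply, path, add_mul, mul_assoc, uv, dv, r]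
  abel

theorem path_mem_radSubmodule {j : A3Path} (hj : j ≠ p₁₁) : path k o j ∈ radSubmodule k o := by
  rw [mem_radSubmodule, ← pathBasis_apply, Module.Basis.repr_self, Finsupp.single_eq_of_ne hj.symm]

/-- The elements of the radical-like submodule given by paths. -/
noncomputable def radPath (j : A3Path) (hj : j ≠ p₁₁) : radSubmodule k o :=
  ⟨path k o j, path_mem_radSubmodule hj⟩

/-- The generator of the direct summand `P₀`. -/
noncomputable abbrev radGen₀ : radSubmodule k o := radPath p₀₀ (by decide)

/-- The generator of the direct summand `P₂`. -/
noncomputable abbrev radGen₂ : radSubmodule k o := radPath p₂₂ (by decide)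

/-- The generator at the vertex `0` of the direct summand `rad P₁`. -/
noncomputable abbrev radGen₀₁ : radSubmodule k o := radPath p₀₁ (by decide)

/-- The generator at the vertex `2` of the direct summand `rad P₁`. -/
noncomputable abbrev radGen₂₁ : radSubmodule k o := radPath p₂₁ (by decide)

theorem exists_eq_smul_of_radSubmodule (x : radSubmodule k o) : ∃ a b c e : PreprojA k o,
    x = a • radGen₀ + b • radGen₂ + c • radGen₀₁ + e • radGen₂₁ := by
  obtain ⟨a, b, c, e, h⟩ := exists_eq_of_mem_radSubmodule x.2
  exact ⟨a, b, c, e, Subtype.ext h⟩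

/-- The path z cannot be prolonged by an arrow before it, so left multiplication by z reads off the
coefficient of `p₁₁`. -/
theorem z_mul_path (j : A3Path) :
    path k o z * path k o j = if j = p₁₁ then path k o z else 0 := by
  rw [show path k o z = d k o 1 * u k o 1 from rfl, mul_assoc, u_mul_path]
  cases j <;> simp +decide [uAct, d_mul_path, dAct, path, ← mul_assoc, d₁u₁u₀]

theorem finDim_self : FinDim k (PreprojA k o) (PreprojA k o) :=
  FinDim.self (Module.Finite.of_basis (pathBasis k o))

end TorsionRadicals

end FinQuiver.PreprojA


namespace FinQuiver.PreprojA

open A3Path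

section TorsionRadicals

variable {k : Type} [Field k] {o : Fin 2 → Bool}

/-- A vector at vertex 0 is the image of the generator of P₀, which the subword 2,1,0 of any reduced
word divides out; the vertex 2 uses the other subword. So modules in C^w live at the middle vertex.
-/
theorem v_smul_eq_zero_of_torsionFreeClass {w : (typeA 2 o).Weyl}
    (hw : w = (typeA 2 o).cox.wordProd [0, 2, 1, 0, 2]) {M : Type} [AddCommGroup M]
    [Module (PreprojA k o) M] (h : TorsionFreeClass k (typeA 2 o) w M) (m : M) :
    v k o 0 • m = 0 ∧ v k o 2 • m = 0 := by
  obtain ⟨l, hl, hlw, N, _, _, -, ⟨e⟩⟩ := h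
  obtain ⟨h1, h2⟩ := sublist_of_isReduced o hl (hlw.trans hw)
  obtain ⟨y, hy⟩ := Submodule.Quotient.mk_surjective _ (e m)
  constructor
  · apply e.injective
    rw [map_smul, map_zero, ← hy, ← Submodule.Quotient.mk_smul, Submodule.Quotient.mk_eq_zero]
    refine socSeq_mono h2 N ((mem_socSeq_iff _).2 fun p hp => ?_)
    rw [← mul_smul]
    exact (congrArg (· • y) (socKill_mul_v₀ p hp)).trans (zero_smul _ y)
  · apply e.injective
    rw [map_smul, map_zero, ← hy, ← Submodule.Quotient.mk_smul, Submodule.Quotient.mk_eq_zero]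
    refine socSeq_mono h1 N ((mem_socSeq_iff _).2 fun p hp => ?_)
    rw [← mul_smul]
    exact (congrArg (· • y) (socKill_mul_v₂ p hp)).trans (zero_smul _ y)

/-- A submodule in C_w dies in the quotient of Π by its socle series, so z kills it and its elements
have no component at `p₁₁`. Conversely, `radSubmodule` is generated at the vertices 0 and 2, where
modules in C^w vanish. -/
theorem torsionRadical_self_eq {w : (typeA 2 o).Weyl}
    (hw : w = (typeA 2 o).cox.wordProd [0, 2, 1, 0, 2]) :
    torsionRadical k (typeA 2 o) w (PreprojA k o) = radSubmodule k o := by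
  apply le_antisymm
  · refine sSup_le fun N hN x hx => ?_
    let S := socSeq k (typeA 2 o) [0, 2, 1, 0, 2] (PreprojA k o)
    have h1 : TorsionFreeClass k (typeA 2 o) w (PreprojA k o ⧸ S) :=
      ⟨_, isReduced_longWord o, hw.symm, PreprojA k o, _, _, finDim_self,
        ⟨LinearEquiv.refl _ _⟩⟩
    have h2 := LinearMap.congr_fun (hN.2 _ h1 (S.mkQ ∘ₗ N.subtype)) ⟨x, hx⟩
    have hxS : x ∈ S := (Submodule.Quotient.mk_eq_zero S).1 h2
    -- One factor for each letter 0, 2, 1, 0, 2: z = v₁ u₀ d₀ v₁ v₁. Arrows are admissible at every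
    -- letter, v₁ at the letters 0 and 2.
    have hz : path k o z ∈ socKill k o [0, 2, 1, 0, 2] := by
      have hv : ∀ {i j : Fin 3}, j ≠ i → v k o j ∈ socGen k o i := fun {i j} h =>
        Or.inl ⟨j, h, rfl⟩
      refine ⟨v k o 1, hv (by decide), _, ⟨u k o 0, Or.inr (Or.inl ⟨0, rfl⟩), _,
        ⟨d k o 0, Or.inr (Or.inr ⟨0, rfl⟩), _, ⟨v k o 1, hv (by decide), _,
        ⟨v k o 1, hv (by decide), _, rfl, rfl⟩, rfl⟩, rfl⟩, rfl⟩, ?_⟩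
      simp +decide only [mul_one, vv, dv, if_true, u₀d₀]
      rw [← mul_assoc, vd, if_pos (by decide)]
      rfl
    have h3 : path k o z * x = 0 := (mem_socSeq_iff _).1 hxS _ hz
    rw [mem_radSubmodule]
    rw [← (pathBasis k o).sum_repr x, Finset.mul_sum, Finset.sum_eq_single p₁₁
      (fun j _ hj => by rw [mul_smul_comm, pathBasis_apply, z_mul_path, if_neg hj, smul_zero])
      (fun h => absurd (Finset.mem_univ _) h), mul_smul_comm, pathBasis_apply, z_mul_path,
      if_pos rfl, ← pathBasis_apply] at h3
    simpa using congrArg (fun y => (pathBasis k o).repr y z) h3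
  · refine le_sSup ⟨finDim_self.of_injective (radSubmodule k o).subtype
      (radSubmodule k o).injective_subtype, fun L _ _ hL f => ?_⟩
    have hvL := v_smul_eq_zero_of_torsionFreeClass hw hL
    ext x
    obtain ⟨a, b, c, e, rfl⟩ := exists_eq_smul_of_radSubmodule x
    have h : ∀ i, (∀ m : L, v k o i • m = 0) → ∀ y : radSubmodule k o, v k o i • y = y → f y = 0 :=
      fun i hi y hy => by rw [← hy, map_smul, hi]
    rw [map_add, map_add, map_add, map_smul, map_smul, map_smul, map_smul,
      h 0 (fun m => (hvL m).1) radGen₀ (Subtype.ext (v_mul_self _)),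
      h 2 (fun m => (hvL m).2) radGen₂ (Subtype.ext (v_mul_self _)),
      h 0 (fun m => (hvL m).1) radGen₀₁ (Subtype.ext (v_mul_d 0)),
      h 2 (fun m => (hvL m).2) radGen₂₁ (Subtype.ext (v_mul_u 1))]
    simp

end TorsionRadicals

end FinQuiver.PreprojA

/-! ### The torsion radical of a simple reflection -/

namespace FinQuiver.PreprojA

open A3Path

section SimpleReflection

variable {k : Type} [Field k] {n : ℕ} {o : Fin n → Bool}

theorem mem_socSeq_singleton {i : Fin (n + 1)} {M : Type} [AddCommGroup M]
    [Module (PreprojA k o) M] {m : M} :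
    m ∈ socSeq k (typeA n o) [i] M ↔ ∀ q ∈ socGen k o i, q • m = 0 := by
  rw [mem_socSeq_iff]
  constructor
  · intro h q hq
    have := h (q * 1) ⟨q, hq, 1, rfl, rfl⟩
    rwa [mul_one] at this
  · rintro h p ⟨q, hq, p, rfl, rfl⟩
    rw [mul_one, h q hq]

/-- Dividing out `soc_i` twice is the same as dividing it out once. -/
theorem eq_zero_of_socGen_smul {i : Fin (n + 1)} {M : Type} [AddCommGroup M]
    [Module (PreprojA k o) M] (m : M ⧸ socSeq k (typeA n o) [i] M)
    (h : ∀ q ∈ socGen k o i, q • m = 0) : m = 0 := by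
  obtain ⟨y, rfl⟩ := Submodule.Quotient.mk_surjective _ m
  have hq : ∀ q ∈ socGen k o i, ∀ q' ∈ socGen k o i, q' • q • y = 0 := by
    intro q hq
    have := h q hq
    rwa [← Submodule.Quotient.mk_smul, Submodule.Quotient.mk_eq_zero,
      mem_socSeq_singleton] at this
  have hv : ∀ j, j ≠ i → v k o j • y = 0 := fun j hj => by
    have h1 : v k o j ∈ socGen k o i := Or.inl ⟨j, hj, rfl⟩
    rw [← v_mul_self, mul_smul, hq _ h1 _ h1]
  -- Without loops, each arrow has an endpoint other than i, and the idempotent there kills y or the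
  -- image of y under the arrow. So S_i has no self-extension.
  have hne : ∀ e : Fin n, e.succ ≠ i ∨ e.castSucc ≠ i := fun e => by
    by_contra! h
    exact (Fin.castSucc_lt_succ (i := e)).ne (h.2.trans h.1.symm)
  rw [Submodule.Quotient.mk_eq_zero, mem_socSeq_singleton]
  rintro q (⟨j, hj, rfl⟩ | ⟨e, rfl⟩ | ⟨e, rfl⟩)
  · exact hv j hj
  · obtain h1 | h1 := hne e
    · rw [← v_mul_u, mul_smul]
      exact hq _ (Or.inr (Or.inl ⟨e, rfl⟩)) _ (Or.inl ⟨_, h1, rfl⟩)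
    · rw [← u_mul_v, mul_smul, hv _ h1, smul_zero]
  · obtain h1 | h1 := hne e
    · rw [← d_mul_v, mul_smul, hv _ h1, smul_zero]
    · rw [← v_mul_d, mul_smul]
      exact hq _ (Or.inr (Or.inr ⟨e, rfl⟩)) _ (Or.inl ⟨_, h1, rfl⟩)

end SimpleReflection

section RadSubmodule

variable {k : Type} [Field k] {o : Fin 2 → Bool}

theorem smul_radPath_z {q : PreprojA k o} (hq : q ∈ socGen k o 1) :
    q • (radPath z (by decide) : radSubmodule k o) = 0 := by
  apply Subtype.ext
  change q * path k o z = 0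
  obtain h | ⟨h, -⟩ | ⟨e, h⟩ | ⟨e, h⟩ := exists_of_mem_socGen hq z
  · exact h
  · exact absurd rfl h
  · fin_cases e <;> simp_all [uAct]
  · fin_cases e <;> simp_all [dAct]

/-- P₀ and P₂ have socles S₂ and S₀, while rad P₁ has the socle spanned by z. -/
theorem exists_eq_smul_radPath_z {x : radSubmodule k o} (h : ∀ q ∈ socGen k o 1, q • x = 0) :
    ∃ c : k, x = c • radPath z (by decide) := by
  have hx := x.2
  rw [mem_radSubmodule] at hx
  have hq : ∀ q ∈ socGen k o 1, ∑ j, (pathBasis k o).repr x j • (q * path k o j) = 0 := by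
    intro q hq
    have h1 : q * (x : PreprojA k o) = 0 := congrArg Subtype.val (h q hq)
    rw [← (pathBasis k o).sum_repr x, Finset.mul_sum] at h1
    simpa only [mul_smul_comm, pathBasis_apply] using h1
  -- Four annihilators suffice: v₀ and v₂ remove the paths ending at 0 and 2, u₁ removes `p₁₀`, and
  -- d₀ removes `p₁₂`.
  have h0 := hq _ (Or.inl ⟨0, by decide, rfl⟩)
  have h2 := hq _ (Or.inl ⟨2, by decide, rfl⟩)
  have h3 := hq _ (Or.inr (Or.inl ⟨1, rfl⟩))
  have h4 := hq _ (Or.inr (Or.inr ⟨0, rfl⟩))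
  simp +decide only [v_mul_path, A3Path.sum_eq, u_mul_path, d_mul_path, vAct, uAct, dAct,
    A3Path.tgt, if_true, if_false, Option.elim, smul_zero, add_zero, zero_add] at h0 h2 h3 h4
  simp only [← pathBasis_apply] at h0 h2 h3 h4
  refine ⟨(pathBasis k o).repr x z, Subtype.ext ?_⟩
  have e00 := congrArg (fun y => (pathBasis k o).repr y p₀₀) h0
  have e02 := congrArg (fun y => (pathBasis k o).repr y p₀₂) h0
  have e01 := congrArg (fun y => (pathBasis k o).repr y p₀₁) h0
  have e20 := congrArg (fun y => (pathBasis k o).repr y p₂₀) h2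
  have e22 := congrArg (fun y => (pathBasis k o).repr y p₂₂) h2
  have e21 := congrArg (fun y => (pathBasis k o).repr y p₂₁) h2
  have e10 := congrArg (fun y => (pathBasis k o).repr y p₂₀) h3
  have e12 := congrArg (fun y => (pathBasis k o).repr y p₀₂) h4
  simp at e00 e02 e01 e20 e22 e21 e10 e12
  conv_lhs => rw [← (pathBasis k o).sum_repr x, A3Path.sum_eq]
  simp [e00, e02, e01, e20, e22, e21, e10, e12, hx, radPath, pathBasis_apply]

/-- Torsion submodules vanish after dividing out soc₁, hence lie in soc₁, which is the line of z.
Conversely, z spans a copy of S₁, and a module obtained by dividing out soc₁ receives no nonzero map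
from it. -/
theorem mem_torsionRadical_radSubmodule {x : radSubmodule k o} :
    x ∈ torsionRadical k (typeA 2 o) ((typeA 2 o).cox.simple 1) (radSubmodule k o) ↔
      ∃ c : k, x = c • radPath z (by decide) := by
  have hfin : FinDim k (PreprojA k o) (radSubmodule k o) :=
    finDim_self.of_injective (radSubmodule k o).subtype (radSubmodule k o).injective_subtype
  constructor
  · intro hx
    refine exists_eq_smul_radPath_z ?_
    rw [← mem_socSeq_singleton]
    refine sSup_le (fun N hN y hy => ?_ : ∀ N ∈ _, N ≤ socSeq k (typeA 2 o) [1] _) hx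
    let S := socSeq k (typeA 2 o) [1] (radSubmodule k o)
    have h1 : TorsionFreeClass k (typeA 2 o) ((typeA 2 o).cox.simple 1)
        (radSubmodule k o ⧸ S) := by
      refine ⟨[1], ?_, (typeA 2 o).cox.wordProd_singleton 1, radSubmodule k o, _, _, hfin,
        ⟨LinearEquiv.refl _ _⟩⟩
      rw [CoxeterSystem.IsReduced, CoxeterSystem.wordProd_singleton, CoxeterSystem.length_simple]
      rfl
    exact (Submodule.Quotient.mk_eq_zero S).1
      (LinearMap.congr_fun (hN.2 _ h1 (S.mkQ ∘ₗ N.subtype)) ⟨y, hy⟩)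
  · rintro ⟨c, rfl⟩
    let N : Submodule (PreprojA k o) (radSubmodule k o) :=
      Submodule.span _ {radPath z (by decide)}
    have hN : N ≤ torsionRadical k (typeA 2 o) ((typeA 2 o).cox.simple 1) (radSubmodule k o) := by
      refine le_sSup ⟨hfin.of_injective N.subtype N.injective_subtype, fun L _ _ hL f => ?_⟩
      obtain ⟨l, hl, hlw, L', _, _, -, ⟨e⟩⟩ := hL
      obtain rfl := eq_singleton_of_isReduced o hl hlw
      ext ⟨y, hy⟩
      obtain ⟨r, rfl⟩ := Submodule.mem_span_singleton.1 hy
      have h1 : f ⟨radPath z (by decide), Submodule.mem_span_singleton_self _⟩ = 0 := by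
        apply e.injective
        rw [map_zero]
        refine eq_zero_of_socGen_smul _ fun q hq => ?_
        rw [← map_smul, ← map_smul]
        have h2 : q • (⟨radPath z (by decide), Submodule.mem_span_singleton_self _⟩ : N) = 0 :=
          Subtype.ext (smul_radPath_z hq)
        rw [h2, map_zero, map_zero]
      have h3 := f.map_smul r ⟨radPath z (by decide), Submodule.mem_span_singleton_self _⟩
      rw [h1, smul_zero] at h3
      exact h3
    exact hN (by
      rw [← algebraMap_smul (PreprojA k o)]
      exact N.smul_mem _ (Submodule.mem_span_singleton_self _))

end RadSubmodule

end FinQuiver.PreprojA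

/-! ### Endomorphism algebras with a path basis -/

section CyclicGenerators

open CycPath

/-- The images of four generators under the endomorphism given by a path. -/
def CycPath.image {A M : Type} [Ring A] [AddCommGroup M] [Module A M] (X : Fin 4 → M) (r s : A) :
    CycPath → Fin 4 → M
  | e₁ => ![X 0, 0, 0, 0]
  | e₂ => ![0, X 1, 0, 0]
  | e₃ => ![0, 0, X 2, 0]
  | e₄ => ![0, 0, 0, X 3]
  | a => ![X 1, 0, 0, 0]
  | b => ![0, r • X 2, 0, 0]
  | c => ![0, 0, X 3, 0]
  | d => ![0, 0, 0, s • X 0]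
  | ba => ![r • X 2, 0, 0, 0]
  | dc => ![0, 0, s • X 0, 0]

/-- Generators `X₀, …, X₃` of a module `M` which is a direct sum of a module with top `X₀` and
socle `s X₀`, a simple module `X₁`, a module with top `X₂` and socle `r X₂`, and a simple module
`X₃`; only the vertices of `X₀` and `X₂`, with idempotents `p` and `q`, matter. -/
structure IsCyclicSystem (k : Type) {A M : Type} [Field k] [Ring A] [Algebra k A] [AddCommGroup M]
    [Module k M] [Module A M] (X : Fin 4 → M) (p q r s : A) : Prop where
  p_X₀ : p • X 0 = X 0
  p_X₁ : p • X 1 = X 1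
  q_X₂ : q • X 2 = X 2
  q_X₃ : q • X 3 = X 3
  s_X₁ : s • X 1 = 0
  r_X₃ : r • X 3 = 0
  s_r : s • r • X 2 = 0
  r_s : r • s • X 0 = 0
  indep_p : ∀ α β γ : k, α • X 0 + β • X 1 + γ • r • X 2 = 0 → α = 0 ∧ β = 0 ∧ γ = 0
  indep_q : ∀ α β γ : k, α • X 2 + β • X 3 + γ • s • X 0 = 0 → α = 0 ∧ β = 0 ∧ γ = 0
  span_p : ∀ m : M, p • m = m → ∃ α β γ : k, m = α • X 0 + β • X 1 + γ • r • X 2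
  span_q : ∀ m : M, q • m = m → ∃ α β γ : k, m = α • X 2 + β • X 3 + γ • s • X 0
  ext : ∀ f g : Module.End A M, (∀ j, f (X j) = g (X j)) → f = g
  exists_end : ∀ i, ∃ f : Module.End A M, ∀ j, f (X j) = CycPath.image X r s i j

namespace IsCyclicSystem

variable {k A M : Type} [Field k] [Ring A] [Algebra k A] [AddCommGroup M] [Module k M] [Module A M]
  [IsScalarTower k A M] {X : Fin 4 → M} {p q r s : A}

/-- An endomorphism is determined by its values on the X_j, which lie in p M or q M. The ten
coefficients left free match the ten paths. -/
theorem exists_basis (h : IsCyclicSystem k X p q r s) :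
    ∃ β : Module.Basis CycPath k (Module.End A M), IsPathBasis β ∧
      ∀ i j, β i (X j) = CycPath.image X r s i j := by
  choose E hE using h.exists_end
  have hmul : ∀ i j, E i * E j = (CycPath.mul i j).elim 0 E := by
    intro i j
    refine h.ext _ _ fun l => ?_
    cases i <;> cases j <;> fin_cases l <;>
      simp [CycPath.mul, hE, CycPath.image, h.s_X₁, h.r_X₃, h.s_r, h.r_s]
  have hsum : ∀ (c : CycPath → k) (j : Fin 4), (∑ i, c i • E i) (X j) =
      ∑ i, c i • CycPath.image X r s i j := fun c j => by
    simp [hE]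
  have hli : LinearIndependent k E := by
    rw [Fintype.linearIndependent_iff]
    intro c hc
    have h0 := hsum c 0
    have h1 := hsum c 1
    have h2 := hsum c 2
    have h3 := hsum c 3
    rw [hc] at h0 h1 h2 h3
    simp [CycPath.sum_eq, CycPath.image] at h0 h1 h2 h3
    obtain ⟨q1, q2, q3⟩ := h.indep_p (c e₁) (c .a) (c ba) h0.symm
    obtain ⟨-, q4, q5⟩ := h.indep_p 0 (c e₂) (c .b) (by simpa using h1.symm)
    obtain ⟨q6, q7, q8⟩ := h.indep_q (c e₃) (c .c) (c dc) h2.symm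
    obtain ⟨-, q9, q10⟩ := h.indep_q 0 (c e₄) (c .d) (by simpa using h3.symm)
    intro i
    cases i <;> assumption
  have hspan : ⊤ ≤ Submodule.span k (Set.range E) := by
    rintro g -
    obtain ⟨α₀, β₀, γ₀, h0⟩ := h.span_p (g (X 0)) (by rw [← map_smul, h.p_X₀])
    obtain ⟨α₁, β₁, γ₁, h1⟩ := h.span_p (g (X 1)) (by rw [← map_smul, h.p_X₁])
    obtain ⟨α₂, β₂, γ₂, h2⟩ := h.span_q (g (X 2)) (by rw [← map_smul, h.q_X₂])
    obtain ⟨α₃, β₃, γ₃, h3⟩ := h.span_q (g (X 3)) (by rw [← map_smul, h.q_X₃])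
    -- X₁ is killed by s but X₀ is not, so X₀ cannot occur in the image of X₁. The same argument
    -- with r excludes X₂ from the image of X₃.
    have hα₁ : α₁ = 0 := by
      have h4 : s • g (X 1) = 0 := by rw [← map_smul, h.s_X₁, map_zero]
      rw [h1, smul_add, smul_add, smul_comm s, smul_comm s, smul_comm s, h.s_X₁, h.s_r] at h4
      exact (h.indep_q 0 0 α₁ (by simpa using h4)).2.2
    have hα₃ : α₃ = 0 := by
      have h4 : r • g (X 3) = 0 := by rw [← map_smul, h.r_X₃, map_zero]
      rw [h3, smul_add, smul_add, smul_comm r, smul_comm r, smul_comm r, h.r_X₃, h.r_s] at h4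
      exact (h.indep_p 0 0 α₃ (by simpa using h4)).2.2
    let c : CycPath → k
      | e₁ => α₀
      | e₂ => β₁
      | e₃ => α₂
      | e₄ => β₃
      | .a => β₀
      | .b => γ₁
      | .c => β₂
      | .d => γ₃
      | ba => γ₀
      | dc => γ₂
    have hg : g = ∑ i, c i • E i := by
      refine h.ext _ _ fun j => ?_
      rw [hsum, CycPath.sum_eq]
      fin_cases j
      · simp [h0, c, CycPath.image]
      · simp [h1, hα₁, c, CycPath.image]
      · simp [h2, c, CycPath.image]
      · simp [h3, hα₃, c, CycPath.image]
    rw [hg]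
    exact Submodule.sum_mem _ fun i _ =>
      Submodule.smul_mem _ _ (Submodule.subset_span ⟨i, rfl⟩)
  refine ⟨Module.Basis.mk hli hspan, ⟨fun i j => ?_, ?_⟩, fun i j => ?_⟩
  · rw [Module.Basis.coe_mk]
    exact hmul i j
  · rw [Module.Basis.coe_mk]
    refine h.ext _ _ fun j => ?_
    fin_cases j <;> simp [hE, CycPath.image]
  · rw [Module.Basis.coe_mk]
    exact hE i j

end IsCyclicSystem

end CyclicGenerators

/-! ### Homomorphisms out of the torsion submodule of `Π(A₃)` -/

namespace FinQuiver.PreprojA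

open A3Path

variable {k : Type} [Field k] {o : Fin 2 → Bool}

section Hom

variable {L : Type} [AddCommGroup L] [Module k L] [Module (PreprojA k o) L]
  [IsScalarTower k (PreprojA k o) L]

theorem radSubmodule_hom_ext {L : Type} [AddCommGroup L] [Module (PreprojA k o) L]
    {f g : radSubmodule k o →ₗ[PreprojA k o] L} (h₀ : f radGen₀ = g radGen₀)
    (h₁ : f radGen₀₁ = g radGen₀₁) (h₂ : f radGen₂ = g radGen₂)
    (h₃ : f radGen₂₁ = g radGen₂₁) : f = g := by
  ext x
  obtain ⟨a, b, c, e, rfl⟩ := exists_eq_smul_of_radSubmodule x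
  simp only [map_add, map_smul, h₀, h₁, h₂, h₃]

/-- A presentation of P₀ ⊕ P₂ ⊕ rad P₁: two generators at each outer vertex and one relation, u₀ d₀
= d₁ u₁, in rad P₁. -/
theorem exists_radSubmodule_hom {x₀ y₀ x₂ y₂ : L} (hx₀ : v k o 0 • x₀ = x₀)
    (hy₀ : v k o 0 • y₀ = y₀) (hx₂ : v k o 2 • x₂ = x₂) (hy₂ : v k o 2 • y₂ = y₂)
    (h : u k o 0 • y₀ = d k o 1 • y₂) :
    ∃ f : radSubmodule k o →ₗ[PreprojA k o] L, f radGen₀ = x₀ ∧ f radGen₀₁ = y₀ ∧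
      f radGen₂ = x₂ ∧ f radGen₂₁ = y₂ := by
  let Φ : A3Path → L
    | p₀₀ => path k o p₀₀ • x₀
    | p₁₀ => path k o p₁₀ • x₀
    | p₂₀ => path k o p₂₀ • x₀
    | p₂₂ => path k o p₂₂ • x₂
    | p₁₂ => path k o p₁₂ • x₂
    | p₀₂ => path k o p₀₂ • x₂
    -- This path lies outside the submodule, so its value is irrelevant.
    | p₁₁ => 0
    | p₀₁ => v k o 0 • y₀
    | p₂₁ => v k o 2 • y₂
    | z => d k o 1 • y₂
  let F : PreprojA k o →ₗ[k] L := (pathBasis k o).constr k Φ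
  have hF : ∀ j, F (path k o j) = Φ j := fun j => by
    rw [← pathBasis_apply]
    exact (pathBasis k o).constr_basis k Φ j
  have hF' : ∀ a : Option A3Path, F (a.elim 0 (path k o)) = a.elim 0 Φ := fun a => by
    cases a <;> simp [hF]
  -- The vanishing of longer paths on y₂ is a consequence of the one relation, not a second
  -- condition.
  have hd : d k o 0 • d k o 1 • y₂ = 0 := by rw [← h, ← mul_smul, d₀u₀, zero_smul]
  have key : ∀ (g : PreprojA k o), (∀ j, j ≠ p₁₁ → F (g * path k o j) = g • Φ j) →
      ∀ m : radSubmodule k o, F (g * m) = g • F m := by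
    intro g hg m
    have hm := m.2
    rw [mem_radSubmodule] at hm
    rw [← (pathBasis k o).sum_repr (m : PreprojA k o), Finset.mul_sum, map_sum, map_sum,
      Finset.smul_sum]
    refine Finset.sum_congr rfl fun j _ => ?_
    by_cases hj : j = p₁₁
    · simp [hj, hm]
    · rw [mul_smul_comm, map_smul, map_smul, pathBasis_apply, hg j hj, hF, smul_comm]
  let f : radSubmodule k o →ₗ[k] L := F ∘ₗ (radSubmodule k o).subtype.restrictScalars k
  have hf : ∀ (g : PreprojA k o) (m : radSubmodule k o), f (g • m) = g • f m := by
    refine map_smul_of_gen f (fun i => key (v k o i) ?_) (fun e => key (u k o e) ?_)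
      (fun e => key (d k o e) ?_)
    · intro j hj
      rw [v_mul_path, hF']
      fin_cases i <;> cases j <;>
        simp +decide [vAct, A3Path.tgt, Φ, path, ← mul_smul, ← mul_assoc, vv, vu, vd] at hj ⊢
    · intro j hj
      rw [u_mul_path, hF']
      fin_cases e <;> cases j <;>
        simp +decide [uAct, Φ, path, ← mul_smul, ← mul_assoc, uv, uu_of_ne, ud_of_ne, u₁d₁,
          u₀d₀, d₁u₁d₁, h] at hj ⊢
    · intro j hj
      rw [d_mul_path, hF']
      fin_cases e <;> cases j <;>
        simp +decide [dAct, Φ, path, ← mul_smul, ← mul_assoc, dv, dd_of_ne, du_of_ne, d₀u₀,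
          d₁u₁u₀, d₀d₁u₁] at hj hd ⊢
      all_goals exact hd.symm
  refine ⟨{ f with map_smul' := hf }, ?_, ?_, ?_, ?_⟩
  · exact (hF p₀₀).trans hx₀
  · exact (hF p₀₁).trans hy₀
  · exact (hF p₂₂).trans hx₂
  · exact (hF p₂₁).trans hy₂

theorem v₀_mul_eq {x : PreprojA k o} : v k o 0 * x = (pathBasis k o).repr x p₀₀ • path k o p₀₀ +
    (pathBasis k o).repr x p₀₁ • path k o p₀₁ + (pathBasis k o).repr x p₀₂ • path k o p₀₂ := by
  conv_lhs => rw [← (pathBasis k o).sum_repr x, A3Path.sum_eq]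
  simp +decide [mul_add, pathBasis_apply, v_mul_path, vAct, A3Path.tgt]
  abel

theorem v₂_mul_eq {x : PreprojA k o} : v k o 2 * x = (pathBasis k o).repr x p₂₂ • path k o p₂₂ +
    (pathBasis k o).repr x p₂₁ • path k o p₂₁ + (pathBasis k o).repr x p₂₀ • path k o p₂₀ := by
  conv_lhs => rw [← (pathBasis k o).sum_repr x, A3Path.sum_eq]
  simp +decide [mul_add, pathBasis_apply, v_mul_path, vAct, A3Path.tgt]
  abel

theorem exists_of_v₀_smul_eq {x : radSubmodule k o} (hx : v k o 0 • x = x) : ∃ α β γ : k,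
    x = α • radGen₀ + β • radGen₀₁ + γ • radPath p₀₂ (by decide) :=
  ⟨_, _, _, hx.symm.trans (Subtype.ext v₀_mul_eq)⟩

theorem exists_of_v₂_smul_eq {x : radSubmodule k o} (hx : v k o 2 • x = x) : ∃ α β γ : k,
    x = α • radGen₂ + β • radGen₂₁ + γ • radPath p₂₀ (by decide) :=
  ⟨_, _, _, hx.symm.trans (Subtype.ext v₂_mul_eq)⟩

end Hom

end FinQuiver.PreprojA

/-! ### The endomorphism algebra of `f_v t_w Π` -/

section Coordinates

open CycPath

variable {k A M : Type} [Field k] [Ring A] [Algebra k A] [AddCommGroup M] [Module k M] [Module A M]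
  [IsScalarTower k A M] {X : Fin 4 → M} {r s : A} {β : Module.Basis CycPath k (Module.End A M)}

theorem CycPath.end_apply_one (hβ : ∀ i j, β i (X j) = CycPath.image X r s i j)
    (g : Module.End A M) : g (X 1) = β.repr g e₂ • X 1 + β.repr g .b • r • X 2 := by
  conv_lhs => rw [← β.sum_repr g, CycPath.sum_eq]
  simp [hβ, CycPath.image]

theorem CycPath.end_apply_three (hβ : ∀ i j, β i (X j) = CycPath.image X r s i j)
    (g : Module.End A M) : g (X 3) = β.repr g e₄ • X 3 + β.repr g .d • s • X 0 := by
  conv_lhs => rw [← β.sum_repr g, CycPath.sum_eq]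
  simp [hβ, CycPath.image]

end Coordinates

namespace FinQuiver.PreprojA

open A3Path

variable {k : Type} [Field k] {o : Fin 2 → Bool}

variable (k o) in
/-- The torsion submodule of `radSubmodule` for the simple reflection at the middle vertex. -/
noncomputable abbrev socRad : Submodule (PreprojA k o) (radSubmodule k o) :=
  torsionRadical k (typeA 2 o) ((typeA 2 o).cox.simple 1) (radSubmodule k o)

variable (k o) in
/-- The generators of the quotient module. -/
noncomputable def quotGen : Fin 4 → radSubmodule k o ⧸ socRad k o :=
  ![(socRad k o).mkQ radGen₀, (socRad k o).mkQ radGen₀₁, (socRad k o).mkQ radGen₂,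
    (socRad k o).mkQ radGen₂₁]

theorem smul_eq_zero_of_mem_socRad {x : radSubmodule k o} (hx : x ∈ socRad k o)
    {q : PreprojA k o} (hq : q ∈ socGen k o 1) : q • x = 0 := by
  obtain ⟨c, rfl⟩ := mem_torsionRadical_radSubmodule.1 hx
  rw [smul_comm, smul_radPath_z hq, smul_zero]

theorem v_mem_socGen_one {i : Fin 3} (hi : i ≠ 1) : v k o i ∈ socGen k o 1 :=
  Or.inl ⟨i, hi, rfl⟩

theorem v_smul_radGen₀ : v k o 0 • (radGen₀ : radSubmodule k o) = radGen₀ :=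
  Subtype.ext (v_mul_self _)

theorem v_smul_radGen₂ : v k o 2 • (radGen₂ : radSubmodule k o) = radGen₂ :=
  Subtype.ext (v_mul_self _)

theorem v_smul_radGen₀₁ : v k o 0 • (radGen₀₁ : radSubmodule k o) = radGen₀₁ :=
  Subtype.ext (v_mul_d 0)

theorem v_smul_radGen₂₁ : v k o 2 • (radGen₂₁ : radSubmodule k o) = radGen₂₁ :=
  Subtype.ext (v_mul_u 1)

/-- The torsion part sits at the middle vertex, so nothing at an outer vertex is lost in the
quotient. -/
theorem eq_zero_of_mem_socRad {x : radSubmodule k o} (hx : x ∈ socRad k o) {i : Fin 3}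
    (hi : i ≠ 1) (h : v k o i • x = x) : x = 0 := by
  rw [← h, smul_eq_zero_of_mem_socRad hx (v_mem_socGen_one hi)]

theorem quot_hom_ext {f g : Module.End (PreprojA k o) (radSubmodule k o ⧸ socRad k o)}
    (h : ∀ j, f (quotGen k o j) = g (quotGen k o j)) : f = g := by
  have h1 : f ∘ₗ (socRad k o).mkQ = g ∘ₗ (socRad k o).mkQ :=
    radSubmodule_hom_ext (h 0) (h 1) (h 2) (h 3)
  ext x
  exact LinearMap.congr_fun h1 x

/-- Once z is zero, the relation u₀ y₀ = d₁ y₂ splits into two separate conditions. This decoupling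
is the source of the cokernel of φ₂. -/
theorem exists_quot_end {x₀ y₀ x₂ y₂ : radSubmodule k o ⧸ socRad k o} (hx₀ : v k o 0 • x₀ = x₀)
    (hy₀ : v k o 0 • y₀ = y₀) (hx₂ : v k o 2 • x₂ = x₂) (hy₂ : v k o 2 • y₂ = y₂)
    (h₀ : u k o 0 • y₀ = 0) (h₂ : d k o 1 • y₂ = 0) :
    ∃ f : Module.End (PreprojA k o) (radSubmodule k o ⧸ socRad k o),
      ∀ j, f (quotGen k o j) = ![x₀, y₀, x₂, y₂] j := by
  obtain ⟨f, hf0, hf1, hf2, hf3⟩ := exists_radSubmodule_hom hx₀ hy₀ hx₂ hy₂ (h₀.trans h₂.symm)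
  have hz : (radPath z (by decide) : radSubmodule k o) = d k o 1 • radGen₂₁ := rfl
  refine ⟨(socRad k o).liftQ f fun x hx => ?_, fun j => ?_⟩
  · obtain ⟨c, rfl⟩ := mem_torsionRadical_radSubmodule.1 hx
    rw [LinearMap.mem_ker, ← algebraMap_smul (PreprojA k o), map_smul, hz, map_smul, hf3, h₂,
      smul_zero]
  · fin_cases j
    exacts [hf0, hf1, hf2, hf3]

theorem p₀₂_eq : (d k o 0 * d k o 1) • (radGen₂ : radSubmodule k o) = radPath p₀₂ (by decide) :=
  Subtype.ext (by change d k o 0 * d k o 1 * v k o 2 = d k o 0 * d k o 1; simp +decide [mul_assoc, dv])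

theorem p₂₀_eq : (u k o 1 * u k o 0) • (radGen₀ : radSubmodule k o) = radPath p₂₀ (by decide) :=
  Subtype.ext (by change u k o 1 * u k o 0 * v k o 0 = u k o 1 * u k o 0; simp +decide [mul_assoc, uv])

theorem smul_radGen₀₁ : (u k o 1 * u k o 0) • (radGen₀₁ : radSubmodule k o) = 0 :=
  Subtype.ext (by
    change u k o 1 * u k o 0 * d k o 0 = 0
    rw [mul_assoc, u₀d₀, ← mul_assoc, u₁d₁, zero_mul])

theorem smul_radGen₂₁ : (d k o 0 * d k o 1) • (radGen₂₁ : radSubmodule k o) = 0 :=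
  Subtype.ext d₀d₁u₁

theorem u_mul_d_eq_zero : (u k o 1 * u k o 0) * (d k o 0 * d k o 1) = 0 := by
  rw [mul_assoc, ← mul_assoc (u k o 0), u₀d₀, d₁u₁d₁, mul_zero]

theorem d_mul_u_eq_zero : (d k o 0 * d k o 1) * (u k o 1 * u k o 0) = 0 := by
  rw [← mul_assoc, d₀d₁u₁, zero_mul]

theorem quot_indep {i : Fin 3} (hi : i ≠ 1) {j₁ j₂ j₃ : A3Path} {h₁ : j₁ ≠ p₁₁} {h₂ : j₂ ≠ p₁₁}
    {h₃ : j₃ ≠ p₁₁} (t₁ : A3Path.tgt j₁ = i) (t₂ : A3Path.tgt j₂ = i) (t₃ : A3Path.tgt j₃ = i)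
    (h₁₂ : j₁ ≠ j₂) (h₁₃ : j₁ ≠ j₃) (h₂₃ : j₂ ≠ j₃) {α β γ : k}
    (h : α • (socRad k o).mkQ (radPath j₁ h₁) + β • (socRad k o).mkQ (radPath j₂ h₂) +
      γ • (socRad k o).mkQ (radPath j₃ h₃) = 0) : α = 0 ∧ β = 0 ∧ γ = 0 := by
  have hmem : α • radPath j₁ h₁ + β • radPath j₂ h₂ + γ • radPath j₃ h₃ ∈ socRad k o :=
    (Submodule.Quotient.mk_eq_zero _).1 h
  have hv : ∀ (j : A3Path) (hj : j ≠ p₁₁), A3Path.tgt j = i →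
      v k o i • (radPath j hj : radSubmodule k o) = radPath j hj := fun j hj ht =>
    Subtype.ext (by
      change v k o i * path k o j = path k o j
      rw [v_mul_path, vAct, if_pos ht]
      rfl)
  have h0 := eq_zero_of_mem_socRad hmem hi (by
    rw [smul_add, smul_add, smul_comm _ α, smul_comm _ β, smul_comm _ γ, hv _ _ t₁, hv _ _ t₂,
      hv _ _ t₃])
  have h1 : α • pathBasis k o j₁ + β • pathBasis k o j₂ + γ • pathBasis k o j₃ = 0 := by
    rw [pathBasis_apply, pathBasis_apply, pathBasis_apply]
    exact congrArg Subtype.val h0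
  have e1 := congrArg (fun y => (pathBasis k o).repr y j₁) h1
  have e2 := congrArg (fun y => (pathBasis k o).repr y j₂) h1
  have e3 := congrArg (fun y => (pathBasis k o).repr y j₃) h1
  simp [h₁₂, h₁₃, h₂₃, h₁₂.symm, h₁₃.symm, h₂₃.symm] at e1 e2 e3
  exact ⟨e1, e2, e3⟩

theorem exists_lift_of_v_smul_eq {m : radSubmodule k o ⧸ socRad k o} {i : Fin 3}
    (hm : v k o i • m = m) : ∃ x, (socRad k o).mkQ x = m ∧ v k o i • x = x := by
  obtain ⟨x, rfl⟩ := (socRad k o).mkQ_surjective m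
  refine ⟨v k o i • x, by rw [map_smul, hm], by rw [← mul_smul, v_mul_self]⟩

variable (k o) in
-- The quotient is P₀ ⊕ S₀ ⊕ P₂ ⊕ S₂. The elements r = d₀ d₁ and s = u₁ u₀ lead from the tops of P₂
-- and P₀ through the middle vertex to their socles.
theorem isCyclicSystem_quotGen : IsCyclicSystem k (quotGen k o) (v k o 0) (v k o 2)
    (d k o 0 * d k o 1) (u k o 1 * u k o 0) where
  p_X₀ := congrArg (socRad k o).mkQ v_smul_radGen₀
  p_X₁ := congrArg (socRad k o).mkQ v_smul_radGen₀₁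
  q_X₂ := congrArg (socRad k o).mkQ v_smul_radGen₂
  q_X₃ := congrArg (socRad k o).mkQ v_smul_radGen₂₁
  s_X₁ := congrArg (socRad k o).mkQ smul_radGen₀₁
  r_X₃ := congrArg (socRad k o).mkQ smul_radGen₂₁
  s_r := by rw [← mul_smul, u_mul_d_eq_zero, zero_smul]
  r_s := by rw [← mul_smul, d_mul_u_eq_zero, zero_smul]
  indep_p := fun α β γ h => by
    have h1 : (d k o 0 * d k o 1) • quotGen k o 2 = (socRad k o).mkQ (radPath p₀₂ (by decide)) :=
      congrArg (socRad k o).mkQ p₀₂_eq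
    rw [h1] at h
    exact quot_indep (i := 0) (by decide) rfl rfl rfl (by decide) (by decide) (by decide) h
  indep_q := fun α β γ h => by
    have h1 : (u k o 1 * u k o 0) • quotGen k o 0 = (socRad k o).mkQ (radPath p₂₀ (by decide)) :=
      congrArg (socRad k o).mkQ p₂₀_eq
    rw [h1] at h
    exact quot_indep (i := 2) (by decide) rfl rfl rfl (by decide) (by decide) (by decide) h
  span_p := fun m hm => by
    obtain ⟨x, rfl, hx⟩ := exists_lift_of_v_smul_eq hm
    obtain ⟨α, β, γ, h⟩ := exists_of_v₀_smul_eq hx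
    refine ⟨α, β, γ, ?_⟩
    rw [← p₀₂_eq] at h
    exact congrArg (socRad k o).mkQ h
  span_q := fun m hm => by
    obtain ⟨x, rfl, hx⟩ := exists_lift_of_v_smul_eq hm
    obtain ⟨α, β, γ, h⟩ := exists_of_v₂_smul_eq hx
    refine ⟨α, β, γ, ?_⟩
    rw [← p₂₀_eq] at h
    exact congrArg (socRad k o).mkQ h
  ext := fun f g h => quot_hom_ext h
  exists_end := by
    have h0 : v k o 0 • quotGen k o 0 = quotGen k o 0 := congrArg (socRad k o).mkQ v_smul_radGen₀
    have h1 : v k o 0 • quotGen k o 1 = quotGen k o 1 := congrArg (socRad k o).mkQ v_smul_radGen₀₁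
    have h2 : v k o 2 • quotGen k o 2 = quotGen k o 2 := congrArg (socRad k o).mkQ v_smul_radGen₂
    have h3 : v k o 2 • quotGen k o 3 = quotGen k o 3 := congrArg (socRad k o).mkQ v_smul_radGen₂₁
    have hr : v k o 0 • (d k o 0 * d k o 1) • quotGen k o 2 =
        (d k o 0 * d k o 1) • quotGen k o 2 := by
      rw [← mul_smul, ← mul_assoc, vd, if_pos (by decide)]
    have hs : v k o 2 • (u k o 1 * u k o 0) • quotGen k o 0 =
        (u k o 1 * u k o 0) • quotGen k o 0 := by
      rw [← mul_smul, ← mul_assoc, vu, if_pos (by decide)]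
    have hur : u k o 0 • (d k o 0 * d k o 1) • quotGen k o 2 = 0 := by
      rw [← mul_smul, ← mul_assoc, u₀d₀, d₁u₁d₁, zero_smul]
    have hds : d k o 1 • (u k o 1 * u k o 0) • quotGen k o 0 = 0 := by
      rw [← mul_smul, ← mul_assoc, d₁u₁u₀, zero_smul]
    have hz : (radPath z (by decide) : radSubmodule k o) ∈ socRad k o :=
      mem_torsionRadical_radSubmodule.2 ⟨1, (one_smul _ _).symm⟩
    have hd3 : d k o 1 • quotGen k o 3 = 0 := (Submodule.Quotient.mk_eq_zero _).2 hz
    have hu1 : u k o 0 • quotGen k o 1 = 0 := by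
      refine (Submodule.Quotient.mk_eq_zero _).2 ?_
      have : u k o 0 • (radGen₀₁ : radSubmodule k o) = radPath z (by decide) := Subtype.ext u₀d₀
      change u k o 0 • radGen₀₁ ∈ socRad k o
      rw [this]
      exact hz
    intro i
    cases i
    all_goals
      refine exists_quot_end (k := k) (o := o) ?_ ?_ ?_ ?_ ?_ ?_ <;>
      first
        | exact smul_zero _
        | assumption

theorem torsionFreePartEnd_mk (f : Module.End (PreprojA k o) (radSubmodule k o))
    (x : radSubmodule k o) :
    torsionFreePartEnd k (typeA 2 o) ((typeA 2 o).cox.simple 1) (radSubmodule k o) f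
      ((socRad k o).mkQ x) = (socRad k o).mkQ (f x) := rfl

/-- An endomorphism with values in the torsion part sends generators at outer vertices to vectors at
the middle vertex, hence to zero. -/
theorem torsionFreePartEnd_injective : Function.Injective
    (torsionFreePartEnd k (typeA 2 o) ((typeA 2 o).cox.simple 1) (radSubmodule k o)) := by
  rw [injective_iff_map_eq_zero]
  intro f hf
  have h : ∀ x, f x ∈ socRad k o := fun x => (Submodule.Quotient.mk_eq_zero _).1 (by
    have := torsionFreePartEnd_mk f x
    rw [hf] at this
    exact this.symm)
  refine radSubmodule_hom_ext ?_ ?_ ?_ ?_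
  · exact eq_zero_of_mem_socRad (h _) (i := 0) (by decide) (by rw [← map_smul, v_smul_radGen₀])
  · exact eq_zero_of_mem_socRad (h _) (i := 0) (by decide) (by rw [← map_smul, v_smul_radGen₀₁])
  · exact eq_zero_of_mem_socRad (h _) (i := 2) (by decide) (by rw [← map_smul, v_smul_radGen₂])
  · exact eq_zero_of_mem_socRad (h _) (i := 2) (by decide) (by rw [← map_smul, v_smul_radGen₂₁])

theorem u_smul_eq (α β γ : k) : u k o 0 • (α • radGen₀ + β • radGen₀₁ + γ • radPath p₀₂ (by decide) :
    radSubmodule k o) = α • radPath p₁₀ (by decide) + β • radPath z (by decide) := by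
  have h1 : u k o 0 • (radGen₀ : radSubmodule k o) = radPath p₁₀ (by decide) :=
    Subtype.ext (u_mul_v 0)
  have h2 : u k o 0 • (radGen₀₁ : radSubmodule k o) = radPath z (by decide) := Subtype.ext u₀d₀
  have h3 : u k o 0 • (radPath p₀₂ (by decide) : radSubmodule k o) = 0 :=
    Subtype.ext (by change u k o 0 * (d k o 0 * d k o 1) = 0; rw [← mul_assoc, u₀d₀, d₁u₁d₁])
  rw [smul_add, smul_add, smul_comm _ α, smul_comm _ β, smul_comm _ γ, h1, h2, h3, smul_zero,
    add_zero]

theorem d_smul_eq (α β γ : k) : d k o 1 • (α • radGen₂ + β • radGen₂₁ + γ • radPath p₂₀ (by decide) :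
    radSubmodule k o) = α • radPath p₁₂ (by decide) + β • radPath z (by decide) := by
  have h1 : d k o 1 • (radGen₂ : radSubmodule k o) = radPath p₁₂ (by decide) :=
    Subtype.ext (d_mul_v 1)
  have h2 : d k o 1 • (radGen₂₁ : radSubmodule k o) = radPath z (by decide) := rfl
  have h3 : d k o 1 • (radPath p₂₀ (by decide) : radSubmodule k o) = 0 :=
    Subtype.ext (by change d k o 1 * (u k o 1 * u k o 0) = 0; rw [← mul_assoc, d₁u₁u₀])
  rw [smul_add, smul_add, smul_comm _ α, smul_comm _ β, smul_comm _ γ, h1, h2, h3, smul_zero,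
    add_zero]

/-- The two sides are combinations of `p₁₀`, z and of `p₁₂`, z; only z is common to both. -/
theorem coeff_eq_of_smul_eq {α β γ α' β' γ' : k}
    (h : u k o 0 • (α • radGen₀ + β • radGen₀₁ + γ • radPath p₀₂ (by decide) : radSubmodule k o) =
      d k o 1 • (α' • radGen₂ + β' • radGen₂₁ + γ' • radPath p₂₀ (by decide))) :
    α = 0 ∧ α' = 0 ∧ β = β' := by
  rw [u_smul_eq, d_smul_eq] at h
  have h1 : α • pathBasis k o p₁₀ + β • pathBasis k o z =
      α' • pathBasis k o p₁₂ + β' • pathBasis k o z := by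
    rw [pathBasis_apply, pathBasis_apply, pathBasis_apply]
    exact congrArg Subtype.val h
  have e1 := congrArg (fun y => (pathBasis k o).repr y p₁₀) h1
  have e2 := congrArg (fun y => (pathBasis k o).repr y p₁₂) h1
  have e3 := congrArg (fun y => (pathBasis k o).repr y z) h1
  simp [Finsupp.single_apply] at e1 e2 e3
  exact ⟨e1, e2.symm, e3⟩

/-! ### The image of φ₂ -/

section Range

open CycPath

variable {β : Module.Basis CycPath k (Module.End (PreprojA k o) (radSubmodule k o ⧸ socRad k o))}

theorem mkQ_v₀ (α β γ : k) : (socRad k o).mkQ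
    (α • radGen₀ + β • radGen₀₁ + γ • radPath p₀₂ (by decide)) =
      α • quotGen k o 0 + β • quotGen k o 1 + γ • (d k o 0 * d k o 1) • quotGen k o 2 := by
  rw [← p₀₂_eq]
  rfl

theorem mkQ_v₂ (α β γ : k) : (socRad k o).mkQ
    (α • radGen₂ + β • radGen₂₁ + γ • radPath p₂₀ (by decide)) =
      α • quotGen k o 2 + β • quotGen k o 3 + γ • (u k o 1 * u k o 0) • quotGen k o 0 := by
  rw [← p₂₀_eq]
  rfl

/-- An endomorphism of t_w Π respects u₀ d₀ = d₁ u₁ = z. Comparing coefficients of z equates the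
scalars on the two generators of rad P₁. -/
theorem coeff_eq_of_end (f : Module.End (PreprojA k o) (radSubmodule k o)) {c₁ c₂ c₃ c₄ : k}
    (h₁ : (socRad k o).mkQ (f radGen₀₁) =
      c₁ • quotGen k o 1 + c₂ • (d k o 0 * d k o 1) • quotGen k o 2)
    (h₃ : (socRad k o).mkQ (f radGen₂₁) =
      c₃ • quotGen k o 3 + c₄ • (u k o 1 * u k o 0) • quotGen k o 0) : c₁ = c₃ := by
  obtain ⟨α, b, γ, h0⟩ := exists_of_v₀_smul_eq (x := f radGen₀₁)
    ((f.map_smul (v k o 0) radGen₀₁).symm.trans (congrArg f v_smul_radGen₀₁))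
  obtain ⟨α', b', γ', h2⟩ := exists_of_v₂_smul_eq (x := f radGen₂₁)
    ((f.map_smul (v k o 2) radGen₂₁).symm.trans (congrArg f v_smul_radGen₂₁))
  have hz : u k o 0 • (radGen₀₁ : radSubmodule k o) = d k o 1 • radGen₂₁ := Subtype.ext u₀d₀
  have h : u k o 0 • f radGen₀₁ = d k o 1 • f radGen₂₁ :=
    (f.map_smul (u k o 0) radGen₀₁).symm.trans ((congrArg f hz).trans (f.map_smul (d k o 1) _))
  rw [h0, h2] at h
  rw [h0, mkQ_v₀] at h₁
  rw [h2, mkQ_v₂] at h₃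
  obtain ⟨rfl, rfl, rfl⟩ := coeff_eq_of_smul_eq h
  rw [zero_smul, zero_add, ← sub_eq_zero, add_sub_add_comm, ← sub_smul, ← sub_smul] at h₁ h₃
  have i1 := ((isCyclicSystem_quotGen k o).indep_p 0 _ _ (by rw [zero_smul, zero_add, h₁])).2.1
  have i3 := ((isCyclicSystem_quotGen k o).indep_q 0 _ _ (by rw [zero_smul, zero_add, h₃])).2.1
  rw [← sub_eq_zero.1 i1, sub_eq_zero.1 i3]

theorem v₀_smul_comb (a b c : k) :
    v k o 0 • (a • radGen₀ + b • radGen₀₁ + c • radPath p₀₂ (by decide) : radSubmodule k o) =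
      a • radGen₀ + b • radGen₀₁ + c • radPath p₀₂ (by decide) := by
  have h1 : v k o 0 • (radPath p₀₂ (by decide) : radSubmodule k o) = radPath p₀₂ (by decide) :=
    Subtype.ext (v_mul_path 0 p₀₂)
  rw [smul_add, smul_add, smul_comm _ a, smul_comm _ b, smul_comm _ c, h1, v_smul_radGen₀,
    v_smul_radGen₀₁]

theorem v₂_smul_comb (a b c : k) :
    v k o 2 • (a • radGen₂ + b • radGen₂₁ + c • radPath p₂₀ (by decide) : radSubmodule k o) =
      a • radGen₂ + b • radGen₂₁ + c • radPath p₂₀ (by decide) := by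
  have h1 : v k o 2 • (radPath p₂₀ (by decide) : radSubmodule k o) = radPath p₂₀ (by decide) :=
    Subtype.ext (v_mul_path 2 p₂₀)
  rw [smul_add, smul_add, smul_comm _ a, smul_comm _ b, smul_comm _ c, h1, v_smul_radGen₂,
    v_smul_radGen₂₁]

/-- The images of the generators are lifted at their own vertices. With a common scalar c, both
sides of the defining relation become c z. -/
theorem exists_torsionFreePartEnd_eq
    {g : Module.End (PreprojA k o) (radSubmodule k o ⧸ socRad k o)} {c c₂ c₄ : k}
    (g1 : g (quotGen k o 1) = c • quotGen k o 1 + c₂ • (d k o 0 * d k o 1) • quotGen k o 2)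
    (g3 : g (quotGen k o 3) = c • quotGen k o 3 + c₄ • (u k o 1 * u k o 0) • quotGen k o 0) :
    ∃ f, torsionFreePartEnd k (typeA 2 o) ((typeA 2 o).cox.simple 1) (radSubmodule k o) f = g := by
  obtain ⟨x₀, hx₀, hx₀'⟩ := exists_lift_of_v_smul_eq (m := g (quotGen k o 0)) (i := 0)
    ((g.map_smul (v k o 0) _).symm.trans (congrArg g (isCyclicSystem_quotGen k o).p_X₀))
  obtain ⟨x₂, hx₂, hx₂'⟩ := exists_lift_of_v_smul_eq (m := g (quotGen k o 2)) (i := 2)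
    ((g.map_smul (v k o 2) _).symm.trans (congrArg g (isCyclicSystem_quotGen k o).q_X₂))
  obtain ⟨f, f0, f1, f2, f3⟩ := exists_radSubmodule_hom hx₀' (v₀_smul_comb 0 c c₂)
    hx₂' (v₂_smul_comb 0 c c₄) (by rw [u_smul_eq, d_smul_eq, zero_smul, zero_smul])
  refine ⟨f, quot_hom_ext fun j => ?_⟩
  fin_cases j
  · exact (congrArg (socRad k o).mkQ f0).trans hx₀
  · refine (congrArg (socRad k o).mkQ f1).trans ((mkQ_v₀ _ _ _).trans ?_)
    rw [zero_smul, zero_add]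
    exact g1.symm
  · exact (congrArg (socRad k o).mkQ f2).trans hx₂
  · refine (congrArg (socRad k o).mkQ f3).trans ((mkQ_v₂ _ _ _).trans ?_)
    rw [zero_smul, zero_add]
    exact g3.symm

theorem mem_range_torsionFreePartEnd
    {g : Module.End (PreprojA k o) (radSubmodule k o ⧸ socRad k o)}
    (hβ : ∀ i j, β i (quotGen k o j) =
      CycPath.image (quotGen k o) (d k o 0 * d k o 1) (u k o 1 * u k o 0) i j) :
    g ∈ LinearMap.range (torsionFreePartEnd k (typeA 2 o) ((typeA 2 o).cox.simple 1)
      (radSubmodule k o)).toLinearMap ↔ β.repr g e₂ = β.repr g e₄ := by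
  have g1 := CycPath.end_apply_one hβ g
  have g3 := CycPath.end_apply_three hβ g
  constructor
  · rintro ⟨f, hf⟩
    have hf' : ∀ x, (socRad k o).mkQ (f x) = g ((socRad k o).mkQ x) := fun x => by
      rw [← hf]
      rfl
    exact coeff_eq_of_end f ((hf' _).trans g1) ((hf' _).trans g3)
  · intro h
    rw [← h] at g3
    exact exists_torsionFreePartEnd_eq g1 g3

variable (k o) in
/-- The algebra map `End M → End (f_v M)` for `M = radSubmodule k o`, and its target. -/
theorem torsionFreePartEnd_radSubmodule :
    Function.Injective
      (torsionFreePartEnd k (typeA 2 o) ((typeA 2 o).cox.simple 1) (radSubmodule k o)) ∧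
    Nonempty ((Module.End (PreprojA k o) (radSubmodule k o ⧸ socRad k o) ⧸ LinearMap.range
      (torsionFreePartEnd k (typeA 2 o) ((typeA 2 o).cox.simple 1)
        (radSubmodule k o)).toLinearMap) ≃ₗ[k] k) ∧
    ¬ Function.Surjective
      (torsionFreePartEnd k (typeA 2 o) ((typeA 2 o).cox.simple 1) (radSubmodule k o)) ∧
    ∃ β : Module.Basis CycPath k
      (Module.End (PreprojA k o) (radSubmodule k o ⧸ socRad k o)), IsPathBasis β := by
  obtain ⟨β, hβ, h⟩ := (isCyclicSystem_quotGen k o).exists_basis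
  let l := β.coord e₂ - β.coord e₄
  have hl : l (β e₂) = 1 := by simp [l]
  have hrange : LinearMap.range (torsionFreePartEnd k (typeA 2 o) ((typeA 2 o).cox.simple 1)
      (radSubmodule k o)).toLinearMap = LinearMap.ker l := by
    ext g
    rw [mem_range_torsionFreePartEnd h, LinearMap.mem_ker]
    exact sub_eq_zero.symm
  refine ⟨torsionFreePartEnd_injective, ⟨?_⟩, fun hs => ?_, β, hβ⟩
  · exact (Submodule.quotEquivOfEq _ _ hrange).trans
      (l.quotKerEquivOfSurjective (LinearMap.surjective fun h0 => by simp [h0] at hl))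
  · obtain ⟨f, hf⟩ := hs (β e₂)
    have : β e₂ ∈ LinearMap.ker l := hrange ▸ ⟨f, hf⟩
    rw [LinearMap.mem_ker, hl] at this
    exact one_ne_zero this

end Range

end FinQuiver.PreprojA

/-! ### Indecomposable modules over `Π(A₂)` -/

section Indecomposable

variable {k A Y : Type} [Field k] [Ring A] [Algebra k A] [AddCommGroup Y] [Module k Y] [Module A Y]
  [IsScalarTower k A Y]

/-- Any vector with a nonzero coefficient at ξ generates the module. If ξ splits as n + n', one
summand has such a coefficient. The choice a = 0 covers simple modules. -/
theorem isIndecomposableModule_of_cyclic {ξ : Y} {a : A} (hξ : ξ ≠ 0) (ha : a • a • ξ = 0)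
    (h : ∀ m : Y, ∃ α β : k, m = α • ξ + β • a • ξ) : IsIndecomposableModule A Y := by
  have key : ∀ N : Submodule A Y, ∀ α β : k, α ≠ 0 → α • ξ + β • a • ξ ∈ N → N = ⊤ := by
    intro N α β hα hN
    have hk : ∀ (c : k) (m : Y), m ∈ N → c • m ∈ N := fun c m hm => by
      rw [← algebraMap_smul A]
      exact N.smul_mem _ hm
    have h1 : a • ξ ∈ N := by
      have h2 := hk α⁻¹ _ (N.smul_mem a hN)
      rwa [smul_add, smul_comm a α, smul_comm a β, ha, smul_zero, add_zero, smul_smul,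
        inv_mul_cancel₀ hα, one_smul] at h2
    have h2 : ξ ∈ N := by
      have h3 := hk α⁻¹ _ ((N.add_mem_iff_left (hk β _ h1)).1 hN)
      rwa [smul_smul, inv_mul_cancel₀ hα, one_smul] at h3
    rw [eq_top_iff]
    rintro m -
    obtain ⟨c, c', rfl⟩ := h m
    exact N.add_mem (hk _ _ h2) (hk _ _ h1)
  refine ⟨⟨ξ, 0, hξ⟩, fun N N' hN => ?_⟩
  obtain ⟨n, hn, n', hn', hs⟩ := Submodule.mem_sup.1
    (hN.sup_eq_top ▸ Submodule.mem_top : ξ ∈ N ⊔ N')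
  obtain ⟨α, β, rfl⟩ := h n
  obtain ⟨α', β', rfl⟩ := h n'
  by_cases hα : α = 0
  · by_cases hα' : α' = 0
    · refine absurd ?_ hξ
      rw [hα, hα', zero_smul, zero_add, zero_add, ← add_smul] at hs
      have : a • ξ = 0 := by rw [← hs, smul_comm, ha, smul_zero]
      rw [← hs, this, smul_zero]
    · left
      have := hN.inf_eq_bot
      rwa [key N' α' β' hα' hn', inf_top_eq] at this
  · right
    have := hN.inf_eq_bot
    rwa [key N α β hα hn, top_inf_eq] at this

/-- An indecomposable module on which `a` does not vanish is isomorphic to `A p`, if `A p` has the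
basis `p, a`, and `q A` has the basis `q, a`. -/
theorem nonempty_equiv_span_of_smul_ne_zero {a p q : A} (hap : a * p = a) (hqa : q * a = a)
    (haa : a * a = 0) (hqp : q * p = 0) (hpp : p * p = p) (ha : ∀ g : A, ∃ α : k, a * g = α • a)
    (hq : ∀ g : A, ∃ α β : k, q * g = α • q + β • a)
    (hp : ∀ g : A, ∃ α β : k, g * p = α • p + β • a) (hY : IsIndecomposableModule A Y) {x : Y}
    (hx : a • x ≠ 0) : Nonempty (Y ≃ₗ[A] (Ideal.span {p} : Ideal A)) := by
  obtain ⟨f, hf⟩ := Module.Projective.exists_dual_eq_one k hx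
  let y := p • x
  have hay : a • y = a • x := by rw [← mul_smul, hap]
  have hpy : p • y = y := by rw [← mul_smul, hpp]
  have hfa : ∀ α β : k, f (a • (α • y + β • a • x)) = α := fun α β => by
    rw [smul_add, smul_comm a α, smul_comm a β, hay, ← mul_smul a a, haa, zero_smul, smul_zero,
      add_zero, map_smul, hf, smul_eq_mul, mul_one]
  have hfq : ∀ α β : k, f (q • (α • y + β • a • x)) = β := fun α β => by
    rw [smul_add, smul_comm q α, smul_comm q β, ← mul_smul q a, hqa, ← mul_smul q p, hqp,
      zero_smul, smul_zero, zero_add, map_smul, hf, smul_eq_mul, mul_one]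
  -- The numbers f (a m) and f (q m) are the coordinates of m along y and a x. By `ha` and `hq`
  -- their common kernel is a submodule, hence a complement of A y.
  let N' : Submodule A Y :=
    { carrier := {m | f (a • m) = 0 ∧ f (q • m) = 0}
      add_mem' := fun {m m'} hm hm' => by
        refine ⟨?_, ?_⟩
        · rw [smul_add, map_add, hm.1, hm'.1, add_zero]
        · rw [smul_add, map_add, hm.2, hm'.2, add_zero]
      zero_mem' := by
        refine ⟨?_, ?_⟩ <;> rw [smul_zero, map_zero]
      smul_mem' := fun g m hm => by
        obtain ⟨α, h1⟩ := ha g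
        obtain ⟨β, γ, h2⟩ := hq g
        refine ⟨?_, ?_⟩
        · rw [← mul_smul, h1, smul_assoc, map_smul, hm.1, smul_zero]
        · rw [← mul_smul, h2, add_smul, smul_assoc, smul_assoc, map_add, f.map_smul β, f.map_smul γ,
            hm.1, hm.2, smul_zero, smul_zero, add_zero] }
  have hgy : ∀ g : A, ∃ α β : k, g • y = α • y + β • a • x := fun g => by
    obtain ⟨α, β, h⟩ := hp g
    refine ⟨α, β, ?_⟩
    rw [← mul_smul, h, add_smul, smul_assoc, smul_assoc]
  have hcompl : IsCompl (Submodule.span A {y}) N' := by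
    constructor
    · rw [Submodule.disjoint_def]
      rintro m hm ⟨h1, h2⟩
      obtain ⟨g, rfl⟩ := Submodule.mem_span_singleton.1 hm
      obtain ⟨α, β, h⟩ := hgy g
      rw [h] at h1 h2 ⊢
      rw [hfa] at h1
      rw [hfq] at h2
      rw [h1, h2, zero_smul, zero_smul, add_zero]
    · rw [codisjoint_iff, eq_top_iff]
      rintro m -
      rw [Submodule.mem_sup]
      refine ⟨f (a • m) • y + f (q • m) • a • x, ?_, m - (f (a • m) • y + f (q • m) • a • x),
        ⟨?_, ?_⟩, by abel⟩
      · rw [← algebraMap_smul A (f (a • m)), ← algebraMap_smul A (f (q • m)), ← hay]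
        exact Submodule.add_mem _ (Submodule.smul_mem _ _ (Submodule.mem_span_singleton_self y))
          (Submodule.smul_mem _ _ (Submodule.smul_mem _ _ (Submodule.mem_span_singleton_self y)))
      · rw [smul_sub, map_sub, hfa, sub_self]
      · rw [smul_sub, map_sub, hfq, sub_self]
  have hy0 : Submodule.span A {y} ≠ ⊥ := fun h => hx (by
    rw [← hay, Submodule.span_singleton_eq_bot.1 h, smul_zero])
  have htop : Submodule.span A {y} = ⊤ := by
    have h := hcompl.sup_eq_top
    rwa [(hY.2 _ _ hcompl).resolve_left hy0, sup_bot_eq] at h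
  let F : (Ideal.span {p} : Ideal A) →ₗ[A] Y :=
    (LinearMap.toSpanSingleton A Y y) ∘ₗ (Ideal.span {p}).subtype
  refine ⟨(LinearEquiv.ofBijective F ⟨?_, fun m => ?_⟩).symm⟩
  · rw [injective_iff_map_eq_zero]
    rintro ⟨t, ht⟩ h
    obtain ⟨g, rfl⟩ := Ideal.mem_span_singleton'.1 ht
    obtain ⟨α, β, hg⟩ := hp g
    have h' : α • y + β • a • x = 0 := by
      rw [← h]
      change _ = (g * p) • y
      rw [hg, add_smul, smul_assoc, smul_assoc, hpy, hay]
    have h1 := hfa α β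
    have h2 := hfq α β
    rw [h', smul_zero, map_zero] at h1 h2
    refine Subtype.ext ?_
    change g * p = 0
    rw [hg, ← h1, ← h2, zero_smul, zero_smul, add_zero]
  · obtain ⟨g, rfl⟩ := Submodule.mem_span_singleton.1 (htop ▸ Submodule.mem_top : m ∈ _)
    refine ⟨⟨g * p, Ideal.mem_span_singleton'.2 ⟨g, rfl⟩⟩, ?_⟩
    change (g * p) • y = g • y
    rw [mul_smul, hpy]

/-- When A acts through scalars, every line is a direct summand, so an indecomposable module is a
line. -/
theorem nonempty_equiv_span_of_smul_eq {t : A} (ht : t ≠ 0)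
    (h : ∀ g : A, ∃ α : k, g * t = α • t ∧ ∀ m : Y, g • m = α • m)
    (hY : IsIndecomposableModule A Y) : Nonempty (Y ≃ₗ[A] (Ideal.span {t} : Ideal A)) := by
  have := hY.1
  obtain ⟨y, hy⟩ := exists_ne (0 : Y)
  obtain ⟨f, hf⟩ := Module.Projective.exists_dual_eq_one k hy
  let F : Y →ₗ[A] (Ideal.span {t} : Ideal A) :=
    { toFun := fun m => f m • ⟨t, Ideal.mem_span_singleton_self t⟩
      map_add' := fun m m' => by rw [map_add, add_smul]
      map_smul' := fun g m => by
        obtain ⟨α, h1, h2⟩ := h g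
        rw [h2, map_smul, RingHom.id_apply, smul_comm g]
        refine Subtype.ext ?_
        change (α * f m) • t = f m • (g * t)
        rw [h1, smul_smul, mul_comm] }
  have hcompl : IsCompl (Submodule.span A {y}) (LinearMap.ker F) := by
    constructor
    · rw [Submodule.disjoint_def]
      intro m hm hm'
      obtain ⟨g, rfl⟩ := Submodule.mem_span_singleton.1 hm
      obtain ⟨α, h1, h2⟩ := h g
      have h3 : f (g • y) • t = 0 := congrArg Subtype.val (LinearMap.mem_ker.1 hm')
      rw [h2, map_smul, hf, smul_eq_mul, mul_one] at h3
      rw [h2, (smul_eq_zero.1 h3).resolve_right ht, zero_smul]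
    · rw [codisjoint_iff, eq_top_iff]
      rintro m -
      rw [Submodule.mem_sup]
      refine ⟨f m • y, ?_, m - f m • y, ?_, by abel⟩
      · rw [← algebraMap_smul A (f m)]
        exact Submodule.smul_mem _ _ (Submodule.mem_span_singleton_self y)
      · rw [LinearMap.mem_ker]
        refine Subtype.ext ?_
        change f (m - f m • y) • t = 0
        rw [map_sub, map_smul, hf, smul_eq_mul, mul_one, sub_self, zero_smul]
  have hker : LinearMap.ker F = ⊥ := (hY.2 _ _ hcompl).resolve_left fun h =>
    hy (Submodule.span_singleton_eq_bot.1 h)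
  refine ⟨LinearEquiv.ofBijective F ⟨LinearMap.ker_eq_bot.1 hker, ?_⟩⟩
  rintro ⟨s, hs⟩
  obtain ⟨g, rfl⟩ := Ideal.mem_span_singleton'.1 hs
  obtain ⟨α, h1, -⟩ := h g
  refine ⟨α • y, Subtype.ext ?_⟩
  change f (α • y) • t = g * t
  rw [map_smul, hf, smul_eq_mul, mul_one, h1]

end Indecomposable

/-! ### The preprojective algebra of type `A₂` -/

namespace FinQuiver.PreprojA

variable {k : Type} [Field k] {o : Fin 1 → Bool}

theorem A₂.du : d k o 0 * u k o 0 = 0 := by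
  have h := sum_u_mul_d (k := k) (o := o)
  rw [Fin.sum_univ_one, Fin.sum_univ_one] at h
  have h1 := congrArg (v k o 0 * ·) h
  simpa +decide [← mul_assoc, vu, vd] using h1.symm

theorem A₂.ud : u k o 0 * d k o 0 = 0 := by
  have h := sum_u_mul_d (k := k) (o := o)
  rw [Fin.sum_univ_one, Fin.sum_univ_one] at h
  rw [h, A₂.du]

theorem A₂.uu : u k o 0 * u k o 0 = 0 := uu_of_ne (by decide)

theorem A₂.dd : d k o 0 * d k o 0 = 0 := dd_of_ne (by decide)

theorem A₂.exists_eq (g : PreprojA k o) : ∃ α β γ δ : k,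
    g = α • v k o 0 + β • v k o 1 + γ • u k o 0 + δ • d k o 0 := by
  let S : Submodule k (PreprojA k o) := Submodule.span k {v k o 0, v k o 1, u k o 0, d k o 0}
  have hS : ∀ x, x ∈ S ↔ ∃ α β γ δ : k,
      x = α • v k o 0 + β • v k o 1 + γ • u k o 0 + δ • d k o 0 := fun x => by
    simp only [S, Submodule.mem_span_insert, Submodule.mem_span_singleton]
    constructor
    · rintro ⟨α, _, ⟨β, _, ⟨γ, _, ⟨δ, rfl⟩, rfl⟩, rfl⟩, rfl⟩
      exact ⟨α, β, γ, δ, by abel⟩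
    · rintro ⟨α, β, γ, δ, rfl⟩
      exact ⟨α, _, ⟨β, _, ⟨γ, _, ⟨δ, rfl⟩, rfl⟩, rfl⟩, by abel⟩
  have h1 : (1 : PreprojA k o) ∈ S := by
    rw [← sum_v, Fin.sum_univ_two]
    exact S.add_mem (Submodule.subset_span (by simp)) (Submodule.subset_span (by simp))
  have hg : ∀ t : PreprojA k o, (t * v k o 0 ∈ S) → (t * v k o 1 ∈ S) → (t * u k o 0 ∈ S) →
      (t * d k o 0 ∈ S) → ∀ m ∈ S, t • m ∈ S := by
    intro t h0 h1 h2 h3 m hm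
    obtain ⟨α, β, γ, δ, rfl⟩ := (hS m).1 hm
    rw [smul_eq_mul, mul_add, mul_add, mul_add, mul_smul_comm, mul_smul_comm, mul_smul_comm,
      mul_smul_comm]
    exact S.add_mem (S.add_mem (S.add_mem (S.smul_mem _ h0) (S.smul_mem _ h1)) (S.smul_mem _ h2))
      (S.smul_mem _ h3)
  have m0 : v k o 0 ∈ S := Submodule.subset_span (by simp)
  have m1 : v k o 1 ∈ S := Submodule.subset_span (by simp)
  have m2 : u k o 0 ∈ S := Submodule.subset_span (by simp)
  have m3 : d k o 0 ∈ S := Submodule.subset_span (by simp)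
  have h := smul_mem_of_gen S
    (fun i => by
      refine hg (v k o i) ?_ ?_ ?_ ?_ <;> fin_cases i <;> simp +decide [vv, vu, vd, m0, m1, m2, m3])
    (fun e => by
      refine hg (u k o e) ?_ ?_ ?_ ?_ <;> fin_cases e <;>
        simp +decide [uv, A₂.uu, A₂.ud, m0, m1, m2, m3])
    (fun e => by
      refine hg (d k o e) ?_ ?_ ?_ ?_ <;> fin_cases e <;>
        simp +decide [dv, A₂.dd, A₂.du, m0, m1, m2, m3]) g 1 h1
  rw [smul_eq_mul, mul_one] at h
  exact (hS g).1 h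

/-- Two representations of dimension two are used, one in which only u is nonzero and one in which
only d is. Together they separate the four elements. -/
theorem A₂.eq_zero {α β γ δ : k}
    (h : α • v k o 0 + β • v k o 1 + γ • u k o 0 + δ • d k o 0 = 0) :
    α = 0 ∧ β = 0 ∧ γ = 0 ∧ δ = 0 := by
  obtain ⟨f, fv, fu, fd⟩ := exists_lift (k := k) (o := o) (S := Matrix (Fin 2) (Fin 2) k)
    ![!![1, 0; 0, 0], !![0, 0; 0, 1]] ![!![0, 0; 1, 0]] ![0]
    (fun i => by fin_cases i <;> ext a b <;> fin_cases a <;> fin_cases b <;> simp)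
    (fun i j h => by
      fin_cases i <;> fin_cases j <;> first | exact absurd rfl h | skip
      all_goals ext a b; fin_cases a <;> fin_cases b <;> simp)
    (by simp [Matrix.one_fin_two])
    (fun e => by fin_cases e; ext a b; fin_cases a <;> fin_cases b <;> simp) (fun e => by fin_cases e; ext a b; fin_cases a <;> fin_cases b <;> simp)
    (fun e => by fin_cases e; ext a b; fin_cases a <;> fin_cases b <;> simp) (fun e => by fin_cases e; ext a b; fin_cases a <;> fin_cases b <;> simp)
    (by simp)
  obtain ⟨f', fv', fu', fd'⟩ := exists_lift (k := k) (o := o) (S := Matrix (Fin 2) (Fin 2) k)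
    ![!![1, 0; 0, 0], !![0, 0; 0, 1]] ![0] ![!![0, 1; 0, 0]]
    (fun i => by fin_cases i <;> ext a b <;> fin_cases a <;> fin_cases b <;> simp)
    (fun i j h => by
      fin_cases i <;> fin_cases j <;> first | exact absurd rfl h | skip
      all_goals ext a b; fin_cases a <;> fin_cases b <;> simp)
    (by simp [Matrix.one_fin_two])
    (fun e => by fin_cases e; ext a b; fin_cases a <;> fin_cases b <;> simp) (fun e => by fin_cases e; ext a b; fin_cases a <;> fin_cases b <;> simp)
    (fun e => by fin_cases e; ext a b; fin_cases a <;> fin_cases b <;> simp) (fun e => by fin_cases e; ext a b; fin_cases a <;> fin_cases b <;> simp)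
    (by simp)
  have h1 := congrArg f h
  have h2 := congrArg f' h
  simp only [map_add, map_smul, fv, fu, fd, map_zero] at h1
  simp only [map_add, map_smul, fv', fu', fd', map_zero] at h2
  have e1 := congrFun (congrFun h1 0) 0
  have e2 := congrFun (congrFun h1 1) 1
  have e3 := congrFun (congrFun h1 1) 0
  have e4 := congrFun (congrFun h2 0) 1
  simp at e1 e2 e3 e4
  exact ⟨e1, e2, e3, e4⟩

theorem A₂.finDim : FinDim k (PreprojA k o) (PreprojA k o) := by
  refine FinDim.self ⟨?_⟩
  have h : Submodule.span k {v k o 0, v k o 1, u k o 0, d k o 0} = ⊤ := by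
    rw [eq_top_iff]
    rintro x -
    obtain ⟨α, β, γ, δ, rfl⟩ := A₂.exists_eq x
    refine add_mem (add_mem (add_mem ?_ ?_) ?_) ?_ <;>
      exact Submodule.smul_mem _ _ (Submodule.subset_span (by simp))
  rw [← h]
  exact Submodule.fg_span (Set.toFinite _)

variable (k o) in
/-- Generators of the indecomposable left ideals `P₀, S₀, P₁, S₁` of `Π(A₂)`. -/
noncomputable def A₂.gen : Fin 4 → PreprojA k o := ![v k o 0, d k o 0, v k o 1, u k o 0]

variable (k o) in
/-- The indecomposable modules `P₀, S₀, P₁, S₁` over `Π(A₂)`. -/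
noncomputable abbrev A₂.Ind (i : Fin 4) : Ideal (PreprojA k o) := Ideal.span {A₂.gen k o i}

/-- The generator as an element of the module. -/
noncomputable def A₂.ξ (i : Fin 4) : A₂.Ind k o i := ⟨_, Ideal.mem_span_singleton_self _⟩

theorem A₂.exists_eq₀ (m : A₂.Ind k o 0) : ∃ α β : k, m = α • A₂.ξ 0 + β • u k o 0 • A₂.ξ 0 := by
  obtain ⟨m, hm⟩ := m
  obtain ⟨g, rfl⟩ := Ideal.mem_span_singleton'.1 hm
  obtain ⟨α, β, γ, δ, rfl⟩ := A₂.exists_eq g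
  refine ⟨α, γ, Subtype.ext ?_⟩
  change _ * v k o 0 = α • v k o 0 + γ • (u k o 0 * v k o 0)
  simp +decide [add_mul, vv, uv, dv]

theorem A₂.exists_eq₂ (m : A₂.Ind k o 2) : ∃ α β : k, m = α • A₂.ξ 2 + β • d k o 0 • A₂.ξ 2 := by
  obtain ⟨m, hm⟩ := m
  obtain ⟨g, rfl⟩ := Ideal.mem_span_singleton'.1 hm
  obtain ⟨α, β, γ, δ, rfl⟩ := A₂.exists_eq g
  refine ⟨β, δ, Subtype.ext ?_⟩
  change _ * v k o 1 = β • v k o 1 + δ • (d k o 0 * v k o 1)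
  simp +decide [add_mul, vv, uv, dv]

theorem A₂.exists_eq₁ (m : A₂.Ind k o 1) : ∃ α : k, m = α • A₂.ξ 1 := by
  obtain ⟨m, hm⟩ := m
  obtain ⟨g, rfl⟩ := Ideal.mem_span_singleton'.1 hm
  obtain ⟨α, β, γ, δ, rfl⟩ := A₂.exists_eq g
  refine ⟨α, Subtype.ext ?_⟩
  change _ * d k o 0 = α • d k o 0
  simp +decide [add_mul, vd, A₂.ud, A₂.dd]

theorem A₂.exists_eq₃ (m : A₂.Ind k o 3) : ∃ α : k, m = α • A₂.ξ 3 := by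
  obtain ⟨m, hm⟩ := m
  obtain ⟨g, rfl⟩ := Ideal.mem_span_singleton'.1 hm
  obtain ⟨α, β, γ, δ, rfl⟩ := A₂.exists_eq g
  refine ⟨β, Subtype.ext ?_⟩
  change _ * u k o 0 = β • u k o 0
  simp +decide [add_mul, vu, A₂.uu, A₂.du]

theorem A₂.v₀_ne : v k o 0 ≠ 0 := fun h =>
  one_ne_zero (A₂.eq_zero (k := k) (o := o) (α := 1) (β := 0) (γ := 0) (δ := 0) (by simp [h])).1

theorem A₂.v₁_ne : v k o 1 ≠ 0 := fun h =>
  one_ne_zero (A₂.eq_zero (k := k) (o := o) (α := 0) (β := 1) (γ := 0) (δ := 0) (by simp [h])).2.1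

theorem A₂.u_ne : u k o 0 ≠ 0 := fun h =>
  one_ne_zero (A₂.eq_zero (k := k) (o := o) (α := 0) (β := 0) (γ := 1) (δ := 0) (by simp [h])).2.2.1

theorem A₂.d_ne : d k o 0 ≠ 0 := fun h =>
  one_ne_zero (A₂.eq_zero (k := k) (o := o) (α := 0) (β := 0) (γ := 0) (δ := 1) (by simp [h])).2.2.2

theorem A₂.gen_ne (i : Fin 4) : A₂.gen k o i ≠ 0 := by
  fin_cases i
  exacts [A₂.v₀_ne, A₂.d_ne, A₂.v₁_ne, A₂.u_ne]

theorem A₂.isIndecomposableModule (i : Fin 4) :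
    IsIndecomposableModule (PreprojA k o) (A₂.Ind k o i) := by
  have hξ : ∀ i, A₂.ξ i ≠ (0 : A₂.Ind k o i) := fun i h => A₂.gen_ne i (congrArg Subtype.val h)
  fin_cases i
  · exact isIndecomposableModule_of_cyclic (k := k) (hξ 0) (a := u k o 0)
      (by rw [← mul_smul (u k o 0), A₂.uu, zero_smul]) A₂.exists_eq₀
  · refine isIndecomposableModule_of_cyclic (k := k) (hξ 1) (a := 0) (zero_smul _ _) fun m => ?_
    obtain ⟨α, h⟩ := A₂.exists_eq₁ m
    exact ⟨α, 0, by rw [zero_smul, add_zero, h]⟩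
  · exact isIndecomposableModule_of_cyclic (k := k) (hξ 2) (a := d k o 0)
      (by rw [← mul_smul (d k o 0), A₂.dd, zero_smul]) A₂.exists_eq₂
  · refine isIndecomposableModule_of_cyclic (k := k) (hξ 3) (a := 0) (zero_smul _ _) fun m => ?_
    obtain ⟨α, h⟩ := A₂.exists_eq₃ m
    exact ⟨α, 0, by rw [zero_smul, add_zero, h]⟩

theorem A₂.smul_eq_zero_iff {t : PreprojA k o} {i : Fin 4} :
    (∀ x : A₂.Ind k o i, t • x = 0) ↔ ∀ g, t * (g * A₂.gen k o i) = 0 := by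
  constructor
  · intro h g
    exact congrArg Subtype.val (h ⟨g * A₂.gen k o i, Ideal.mem_span_singleton'.2 ⟨g, rfl⟩⟩)
  · rintro h ⟨x, hx⟩
    obtain ⟨g, rfl⟩ := Ideal.mem_span_singleton'.1 hx
    exact Subtype.ext (h g)

theorem A₂.u_smul_eq_zero_iff (i : Fin 4) : (∀ x : A₂.Ind k o i, u k o 0 • x = 0) ↔ i ≠ 0 := by
  rw [A₂.smul_eq_zero_iff]
  constructor
  · rintro h rfl
    have := h 1
    rw [one_mul] at this
    exact A₂.u_ne ((u_mul_v (k := k) (o := o) 0).symm.trans this)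
  · intro hi g
    obtain ⟨α, β, γ, δ, rfl⟩ := A₂.exists_eq g
    fin_cases i <;>
      simp +decide [A₂.gen, add_mul, mul_add, vv, vd, vu, uv, dv, A₂.uu, A₂.ud, A₂.du, A₂.dd] at hi ⊢

theorem A₂.d_smul_eq_zero_iff (i : Fin 4) : (∀ x : A₂.Ind k o i, d k o 0 • x = 0) ↔ i ≠ 2 := by
  rw [A₂.smul_eq_zero_iff]
  constructor
  · rintro h rfl
    have := h 1
    rw [one_mul] at this
    exact A₂.d_ne ((d_mul_v (k := k) (o := o) 0).symm.trans this)
  · intro hi g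
    obtain ⟨α, β, γ, δ, rfl⟩ := A₂.exists_eq g
    fin_cases i <;>
      simp +decide [A₂.gen, add_mul, mul_add, vv, vd, vu, uv, dv, A₂.uu, A₂.ud, A₂.du, A₂.dd] at hi ⊢

theorem A₂.v_smul_eq_zero_iff (i : Fin 4) : (∀ x : A₂.Ind k o i, v k o 0 • x = 0) ↔ i = 3 := by
  rw [A₂.smul_eq_zero_iff]
  constructor
  · intro h
    by_contra hi
    fin_cases i
    · have := h 1
      rw [one_mul] at this
      exact A₂.v₀_ne ((v_mul_self (k := k) (o := o) 0).symm.trans this)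
    · have := h 1
      rw [one_mul] at this
      exact A₂.d_ne ((v_mul_d (k := k) (o := o) 0).symm.trans this)
    · have : v k o 0 * (d k o 0 * v k o 1) = 0 := h (d k o 0)
      rw [dv, if_pos (by decide), vd, if_pos (by decide)] at this
      exact A₂.d_ne this
    · exact hi rfl
  · rintro rfl g
    obtain ⟨α, β, γ, δ, rfl⟩ := A₂.exists_eq g
    simp +decide [A₂.gen, add_mul, mul_add, vv, vd, vu, uv, dv, A₂.uu, A₂.ud, A₂.du, A₂.dd]

/-- Annihilators separate the four modules: u acts nontrivially only on P₀, d only on P₁, and v₀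
kills only S₁. -/
theorem A₂.eq_of_nonempty_equiv {i j : Fin 4}
    (h : Nonempty (A₂.Ind k o i ≃ₗ[PreprojA k o] A₂.Ind k o j)) : i = j := by
  obtain ⟨e⟩ := h
  have key : ∀ t : PreprojA k o,
      (∀ x : A₂.Ind k o i, t • x = 0) ↔ ∀ x : A₂.Ind k o j, t • x = 0 := fun t => by
    constructor
    · intro h x
      rw [← e.apply_symm_apply x, ← map_smul, h, map_zero]
    · intro h x
      rw [← e.symm_apply_apply x, ← map_smul, h, map_zero]
  have h1 := key (u k o 0)
  have h2 := key (d k o 0)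
  have h3 := key (v k o 0)
  rw [A₂.u_smul_eq_zero_iff, A₂.u_smul_eq_zero_iff] at h1
  rw [A₂.d_smul_eq_zero_iff, A₂.d_smul_eq_zero_iff] at h2
  rw [A₂.v_smul_eq_zero_iff, A₂.v_smul_eq_zero_iff] at h3
  clear key e
  revert i j
  decide

/-- If u acts nontrivially, a copy of P₀ splits off; if d does, a copy of P₁. Otherwise the module
is the direct sum of its vertex spaces, on which the algebra acts by scalars. Finite dimension is
not needed. -/
theorem A₂.exists_equiv {Y : Type} [AddCommGroup Y] [Module k Y] [Module (PreprojA k o) Y]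
    [IsScalarTower k (PreprojA k o) Y] (hY : IsIndecomposableModule (PreprojA k o) Y) :
    ∃ i, Nonempty (Y ≃ₗ[PreprojA k o] A₂.Ind k o i) := by
  by_cases hu : ∃ x : Y, u k o 0 • x ≠ 0
  · obtain ⟨x, hx⟩ := hu
    refine ⟨0, nonempty_equiv_span_of_smul_ne_zero (k := k) (u_mul_v 0) (v_mul_u 0) A₂.uu
      (v_mul_of_ne (by decide)) (v_mul_self _) (fun g => ?_) (fun g => ?_) (fun g => ?_) hY hx⟩ <;>
    obtain ⟨α, β, γ, δ, rfl⟩ := A₂.exists_eq g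
    · exact ⟨α, by simp +decide [mul_add, uv, A₂.uu, A₂.ud]⟩
    · exact ⟨β, γ, by simp +decide [mul_add, vv, vu, vd]⟩
    · exact ⟨α, γ, by
        change _ * v k o 0 = α • v k o 0 + γ • u k o 0
        simp +decide [add_mul, vv, uv, dv]⟩
  by_cases hd : ∃ x : Y, d k o 0 • x ≠ 0
  · obtain ⟨x, hx⟩ := hd
    refine ⟨2, nonempty_equiv_span_of_smul_ne_zero (k := k) (d_mul_v 0) (v_mul_d 0) A₂.dd
      (v_mul_of_ne (by decide)) (v_mul_self _) (fun g => ?_) (fun g => ?_) (fun g => ?_) hY hx⟩ <;>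
    obtain ⟨α, β, γ, δ, rfl⟩ := A₂.exists_eq g
    · exact ⟨β, by simp +decide [mul_add, dv, A₂.dd, A₂.du]⟩
    · exact ⟨α, δ, by simp +decide [mul_add, vv, vu, vd]⟩
    · exact ⟨β, δ, by
        change _ * v k o 1 = β • v k o 1 + δ • d k o 0
        simp +decide [add_mul, vv, uv, dv]⟩
  push Not at hu hd
  have hg : ∀ (α β γ δ : k) (m : Y), (α • v k o 0 + β • v k o 1 + γ • u k o 0 + δ • d k o 0) • m =
      α • v k o 0 • m + β • v k o 1 • m := fun α β γ δ m => by
    rw [add_smul, add_smul, add_smul, smul_assoc, smul_assoc, smul_assoc, smul_assoc, hu, hd,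
      smul_zero, smul_zero, add_zero, add_zero]
  have hsum : ∀ m : Y, v k o 0 • m + v k o 1 • m = m := fun m => by
    rw [← add_smul, ← Fin.sum_univ_two (v k o), sum_v, one_smul]
  have hvv : ∀ (i j : Fin 2) (m : Y), i ≠ j → v k o i • v k o j • m = 0 := fun i j m h => by
    rw [← mul_smul, v_mul_of_ne h, zero_smul]
  -- The kernel of v_i is the space at the other vertex. It is a submodule because both arrows act
  -- by zero.
  let N : Fin 2 → Submodule (PreprojA k o) Y := fun i =>
    { carrier := {m | v k o i • m = 0}
      add_mem' := fun {m m'} hm hm' => by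
        change v k o i • (m + m') = 0
        rw [smul_add, hm, hm', add_zero]
      zero_mem' := smul_zero _
      smul_mem' := fun g m hm => by
        obtain ⟨α, β, γ, δ, rfl⟩ := A₂.exists_eq g
        change v k o i • _ = 0
        have hm : v k o i • m = 0 := hm
        rw [hg, smul_add, smul_comm _ α, smul_comm _ β]
        fin_cases i
        · have hm : v k o 0 • m = 0 := hm
          rw [hm, smul_zero, smul_zero, zero_add]
          exact (congrArg (β • ·) (hvv 0 1 m (by decide))).trans (smul_zero _)
        · have hm : v k o 1 • m = 0 := hm
          rw [hm, smul_zero, smul_zero, add_zero]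
          exact (congrArg (α • ·) (hvv 1 0 m (by decide))).trans (smul_zero _) }
  have hcompl : IsCompl (N 0) (N 1) := by
    constructor
    · rw [Submodule.disjoint_def]
      intro m h0 h1
      have h0 : v k o 0 • m = 0 := h0
      have h1 : v k o 1 • m = 0 := h1
      rw [← hsum m, h0, h1, add_zero]
    · rw [codisjoint_iff, eq_top_iff]
      rintro m -
      rw [Submodule.mem_sup]
      exact ⟨v k o 1 • m, hvv 0 1 m (by decide), v k o 0 • m, hvv 1 0 m (by decide),
        by rw [add_comm, hsum]⟩
  rcases hY.2 _ _ hcompl with h | h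
  · have h1 : ∀ m : Y, v k o 1 • m = 0 := fun m =>
      (Submodule.mem_bot _).1 (h.le (show v k o 1 • m ∈ N 0 from hvv 0 1 m (by decide)))
    have h0 : ∀ m : Y, v k o 0 • m = m := fun m => by
      conv_rhs => rw [← hsum m, h1, add_zero]
    refine ⟨1, nonempty_equiv_span_of_smul_eq (k := k) A₂.d_ne (fun g => ?_) hY⟩
    obtain ⟨α, β, γ, δ, rfl⟩ := A₂.exists_eq g
    exact ⟨α, by
      change _ * d k o 0 = α • d k o 0
      simp +decide [add_mul, vd, A₂.ud, A₂.dd],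
      fun m => by rw [hg, h0, h1, smul_zero, add_zero]⟩
  · have h0 : ∀ m : Y, v k o 0 • m = 0 := fun m =>
      (Submodule.mem_bot _).1 (h.le (show v k o 0 • m ∈ N 1 from hvv 1 0 m (by decide)))
    have h1 : ∀ m : Y, v k o 1 • m = m := fun m => by
      conv_rhs => rw [← hsum m, h0, zero_add]
    refine ⟨3, nonempty_equiv_span_of_smul_eq (k := k) A₂.u_ne (fun g => ?_) hY⟩
    obtain ⟨α, β, γ, δ, rfl⟩ := A₂.exists_eq g
    exact ⟨β, by
      change _ * u k o 0 = β • u k o 0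
      simp +decide [add_mul, vu, A₂.uu, A₂.du],
      fun m => by rw [hg, h0, h1, smul_zero, zero_add]⟩

end FinQuiver.PreprojA

/-! ### The Auslander algebra of `Π(A₂)` -/

namespace FinQuiver.PreprojA

variable {k : Type} [Field k] {o : Fin 1 → Bool}

variable (k o) in
/-- The generators of the direct sum of the indecomposable `Π(A₂)`-modules. -/
noncomputable def A₂.sumGen (j : Fin 4) : ∀ i, A₂.Ind k o i := Pi.single j (A₂.ξ j)

/-- Right multiplication by y is left linear, and it maps the ideal of the i-th generator into the
j-th ideal once it does so on the generator. -/
theorem A₂.exists_end {i j : Fin 4} (m : A₂.Ind k o j) (y : PreprojA k o)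
    (h : A₂.gen k o i * y = m) : ∃ f : Module.End (PreprojA k o) (∀ i, A₂.Ind k o i),
      ∀ l, f (A₂.sumGen k o l) = if l = i then Pi.single j m else 0 := by
  have hy : ∀ x ∈ A₂.Ind k o i, LinearMap.toSpanSingleton _ _ y x ∈ A₂.Ind k o j := by
    intro x hx
    obtain ⟨g, rfl⟩ := Ideal.mem_span_singleton'.1 hx
    change g * A₂.gen k o i * y ∈ _
    rw [mul_assoc, h]
    exact Submodule.smul_mem _ g m.2
  refine ⟨LinearMap.single _ _ j ∘ₗ (LinearMap.toSpanSingleton _ _ y).restrict hy ∘ₗ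
    LinearMap.proj i, fun l => ?_⟩
  split_ifs with hl
  · subst hl
    change (Pi.single j ((LinearMap.toSpanSingleton _ _ y).restrict hy
      ((Pi.single l (A₂.ξ l) : ∀ i, A₂.Ind k o i) l)) :
        ∀ i, A₂.Ind k o i) = _
    rw [Pi.single_eq_same]
    exact congrArg (Pi.single j) (Subtype.ext h)
  · change (Pi.single j ((LinearMap.toSpanSingleton _ _ y).restrict hy
      ((Pi.single l (A₂.ξ l) : ∀ i, A₂.Ind k o i) i)) :
        ∀ i, A₂.Ind k o i) = _
    rw [Pi.single_eq_of_ne (Ne.symm hl), map_zero, Pi.single_zero]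

theorem A₂.smul_sumGen (a : PreprojA k o) (j : Fin 4) :
    a • A₂.sumGen k o j = Pi.single j (a • A₂.ξ j) := (Pi.single_smul j a _).symm

theorem A₂.smul_sumGen' (a : k) (j : Fin 4) :
    a • A₂.sumGen k o j = Pi.single j (a • A₂.ξ j) := (Pi.single_smul j a _).symm

theorem A₂.smul_single (a : k) (j : Fin 4) (x : A₂.Ind k o j) :
    a • (Pi.single j x : ∀ i, A₂.Ind k o i) = Pi.single j (a • x) := (Pi.single_smul j a _).symm

theorem A₂.single_add_apply (m : ∀ i, A₂.Ind k o i) :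
    m = Pi.single 0 (m 0) + Pi.single 1 (m 1) + Pi.single 2 (m 2) + Pi.single 3 (m 3) := by
  funext i
  fin_cases i <;> simp

variable (k o) in
-- Here a single arrow joins top and socle of each projective: r = d₀ and s = u₀ take the place of
-- the paths of length two through the middle vertex of A₃.
theorem A₂.isCyclicSystem : IsCyclicSystem k (A₂.sumGen k o) (v k o 0) (v k o 1)
    (d k o 0) (u k o 0) where
  p_X₀ := by
    rw [A₂.smul_sumGen]
    exact congrArg (Pi.single 0) (Subtype.ext (v_mul_self _))
  p_X₁ := by
    rw [A₂.smul_sumGen]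
    exact congrArg (Pi.single 1) (Subtype.ext (v_mul_d 0))
  q_X₂ := by
    rw [A₂.smul_sumGen]
    exact congrArg (Pi.single 2) (Subtype.ext (v_mul_self _))
  q_X₃ := by
    rw [A₂.smul_sumGen]
    exact congrArg (Pi.single 3) (Subtype.ext (v_mul_u 0))
  s_X₁ := by
    rw [A₂.smul_sumGen, show u k o 0 • (A₂.ξ 1 : A₂.Ind k o 1) = 0 from Subtype.ext A₂.ud,
      Pi.single_zero]
  r_X₃ := by
    rw [A₂.smul_sumGen, show d k o 0 • (A₂.ξ 3 : A₂.Ind k o 3) = 0 from Subtype.ext A₂.du,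
      Pi.single_zero]
  s_r := by rw [← mul_smul, A₂.ud, zero_smul]
  r_s := by rw [← mul_smul, A₂.du, zero_smul]
  indep_p := fun α β γ h => by
    rw [A₂.smul_sumGen (d k o 0), A₂.smul_sumGen', A₂.smul_sumGen', A₂.smul_single] at h
    have h0 : α • v k o 0 = 0 := congrArg Subtype.val
      (show α • (A₂.ξ 0 : A₂.Ind k o 0) = 0 by simpa using congrFun h 0)
    have h1 : β • d k o 0 = 0 := congrArg Subtype.val
      (show β • (A₂.ξ 1 : A₂.Ind k o 1) = 0 by simpa using congrFun h 1)
    have h2 : γ • (d k o 0 * v k o 1) = 0 := congrArg Subtype.val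
      (show γ • (d k o 0 • A₂.ξ 2 : A₂.Ind k o 2) = 0 by simpa using congrFun h 2)
    rw [dv, if_pos (by decide)] at h2
    exact ⟨(smul_eq_zero.1 h0).resolve_right A₂.v₀_ne, (smul_eq_zero.1 h1).resolve_right A₂.d_ne,
      (smul_eq_zero.1 h2).resolve_right A₂.d_ne⟩
  indep_q := fun α β γ h => by
    rw [A₂.smul_sumGen (u k o 0), A₂.smul_sumGen', A₂.smul_sumGen', A₂.smul_single] at h
    have h0 : α • v k o 1 = 0 := congrArg Subtype.val
      (show α • (A₂.ξ 2 : A₂.Ind k o 2) = 0 by simpa using congrFun h 2)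
    have h1 : β • u k o 0 = 0 := congrArg Subtype.val
      (show β • (A₂.ξ 3 : A₂.Ind k o 3) = 0 by simpa using congrFun h 3)
    have h2 : γ • (u k o 0 * v k o 0) = 0 := congrArg Subtype.val
      (show γ • (u k o 0 • A₂.ξ 0 : A₂.Ind k o 0) = 0 by simpa using congrFun h 0)
    rw [uv, if_pos (by decide)] at h2
    exact ⟨(smul_eq_zero.1 h0).resolve_right A₂.v₁_ne, (smul_eq_zero.1 h1).resolve_right A₂.u_ne,
      (smul_eq_zero.1 h2).resolve_right A₂.u_ne⟩
  span_p := fun m hm => by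
    have hm' : ∀ i, v k o 0 • m i = m i := fun i => congrFun hm i
    obtain ⟨α, α', h0⟩ := A₂.exists_eq₀ (m 0)
    obtain ⟨β, h1⟩ := A₂.exists_eq₁ (m 1)
    obtain ⟨γ', γ, h2⟩ := A₂.exists_eq₂ (m 2)
    obtain ⟨δ, h3⟩ := A₂.exists_eq₃ (m 3)
    have e0 : m 0 = α • A₂.ξ 0 := by
      rw [← hm' 0, h0]
      refine Subtype.ext ?_
      change v k o 0 * (α • v k o 0 + α' • (u k o 0 * v k o 0)) = α • v k o 0
      simp +decide [mul_add, uv, vv, vu]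
    have e2 : m 2 = γ • d k o 0 • A₂.ξ 2 := by
      rw [← hm' 2, h2]
      refine Subtype.ext ?_
      change v k o 0 * (γ' • v k o 1 + γ • (d k o 0 * v k o 1)) = γ • (d k o 0 * v k o 1)
      simp +decide [mul_add, dv, vv, vd]
    have e3 : m 3 = 0 := by
      rw [← hm' 3, h3]
      refine Subtype.ext ?_
      change v k o 0 * (δ • u k o 0) = 0
      simp +decide [vu]
    refine ⟨α, β, γ, ?_⟩
    rw [A₂.smul_sumGen (d k o 0), A₂.smul_sumGen', A₂.smul_sumGen', A₂.smul_single, ← e0, ← h1,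
      ← e2]
    conv_lhs => rw [A₂.single_add_apply m, e3, Pi.single_zero, add_zero]
  span_q := fun m hm => by
    have hm' : ∀ i, v k o 1 • m i = m i := fun i => congrFun hm i
    obtain ⟨α, α', h0⟩ := A₂.exists_eq₀ (m 0)
    obtain ⟨β, h1⟩ := A₂.exists_eq₁ (m 1)
    obtain ⟨γ', γ, h2⟩ := A₂.exists_eq₂ (m 2)
    obtain ⟨δ, h3⟩ := A₂.exists_eq₃ (m 3)
    have e0 : m 0 = α' • u k o 0 • A₂.ξ 0 := by
      rw [← hm' 0, h0]
      refine Subtype.ext ?_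
      change v k o 1 * (α • v k o 0 + α' • (u k o 0 * v k o 0)) = α' • (u k o 0 * v k o 0)
      simp +decide [mul_add, uv, vv, vu]
    have e2 : m 2 = γ' • A₂.ξ 2 := by
      rw [← hm' 2, h2]
      refine Subtype.ext ?_
      change v k o 1 * (γ' • v k o 1 + γ • (d k o 0 * v k o 1)) = γ' • v k o 1
      simp +decide [mul_add, dv, vv, vd]
    have e1 : m 1 = 0 := by
      rw [← hm' 1, h1]
      refine Subtype.ext ?_
      change v k o 1 * (β • d k o 0) = 0
      simp +decide [vd]
    refine ⟨γ', δ, α', ?_⟩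
    rw [A₂.smul_sumGen (u k o 0), A₂.smul_sumGen', A₂.smul_sumGen', A₂.smul_single, ← e0, ← h3,
      ← e2]
    conv_lhs => rw [A₂.single_add_apply m, e1, Pi.single_zero, add_zero]
    abel
  ext := fun f g h => by
    refine LinearMap.pi_ext fun i x => ?_
    obtain ⟨x, hx⟩ := x
    obtain ⟨a, rfl⟩ := Ideal.mem_span_singleton'.1 hx
    have : (⟨_, hx⟩ : A₂.Ind k o i) = a • A₂.ξ i := rfl
    rw [this, ← A₂.smul_sumGen, map_smul, map_smul, h]
  exists_end := by
    have hdv : d k o 0 = d k o 0 * v k o 1 := (d_mul_v 0).symm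
    have huv : u k o 0 = u k o 0 * v k o 0 := (u_mul_v 0).symm
    have conv : ∀ (i j : Fin 4) (m : A₂.Ind k o j) (y : PreprojA k o), A₂.gen k o i * y = m →
        ∀ w : Fin 4 → ∀ i, A₂.Ind k o i, (∀ l, w l = if l = i then Pi.single j m else 0) →
        ∃ f : Module.End (PreprojA k o) (∀ i, A₂.Ind k o i), ∀ l, f (A₂.sumGen k o l) = w l :=
      fun i j m y h w hw => by
        obtain ⟨f, hf⟩ := A₂.exists_end m y h
        exact ⟨f, fun l => (hf l).trans (hw l).symm⟩
    intro i
    cases i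
    · exact conv 0 0 (A₂.ξ 0) 1 (mul_one _) _ fun l => by fin_cases l <;> rfl
    · exact conv 1 1 (A₂.ξ 1) 1 (mul_one _) _ fun l => by fin_cases l <;> rfl
    · exact conv 2 2 (A₂.ξ 2) 1 (mul_one _) _ fun l => by fin_cases l <;> rfl
    · exact conv 3 3 (A₂.ξ 3) 1 (mul_one _) _ fun l => by fin_cases l <;> rfl
    · exact conv 0 1 (A₂.ξ 1) (d k o 0) (v_mul_d 0) _ fun l => by fin_cases l <;> rfl
    · refine conv 1 2 (d k o 0 • A₂.ξ 2) (v k o 1) rfl _ fun l => ?_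
      fin_cases l
      exacts [rfl, A₂.smul_sumGen _ 2, rfl, rfl]
    · exact conv 2 3 (A₂.ξ 3) (u k o 0) (v_mul_u 0) _ fun l => by fin_cases l <;> rfl
    · refine conv 3 0 (u k o 0 • A₂.ξ 0) (v k o 0) rfl _ fun l => ?_
      fin_cases l
      exacts [rfl, rfl, rfl, A₂.smul_sumGen _ 0]
    · refine conv 0 2 (d k o 0 • A₂.ξ 2) (d k o 0) ((v_mul_d 0).trans hdv) _ fun l => ?_
      fin_cases l
      exacts [A₂.smul_sumGen _ 2, rfl, rfl, rfl]
    · refine conv 2 0 (u k o 0 • A₂.ξ 0) (u k o 0) ((v_mul_u 0).trans huv) _ fun l => ?_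
      fin_cases l
      exacts [rfl, rfl, A₂.smul_sumGen _ 0, rfl]

variable (o) in
/-- An algebra with a path basis is the Auslander algebra of `Π(A₂)`. -/
theorem isAuslanderAlgebra_of_isPathBasis {B : Type} [Ring B] [Algebra k B]
    {β : Module.Basis CycPath k B} (hβ : IsPathBasis β) :
    IsAuslanderAlgebra k (PreprojA k o) B := by
  obtain ⟨γ, hγ, -⟩ := (A₂.isCyclicSystem k o).exists_basis
  refine ⟨4, fun i => A₂.Ind k o i, fun _ => inferInstance, fun _ => inferInstance,
    fun _ => inferInstance, fun _ => inferInstance, fun i => ⟨?_, A₂.isIndecomposableModule i⟩,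
    fun i j => A₂.eq_of_nonempty_equiv, fun Y _ _ _ hY => ?_, hβ.nonempty_algEquiv hγ⟩
  · exact A₂.finDim.of_injective (A₂.Ind k o i).subtype (A₂.Ind k o i).injective_subtype
  · let _ : Module k Y := Module.compHom Y (algebraMap k (PreprojA k o))
    have : IsScalarTower k (PreprojA k o) Y := IsScalarTower.of_algebraMap_smul fun _ _ => rfl
    exact A₂.exists_equiv hY

/-- The properties of `φ₂` and of `Π_{v,w}` in type `A₃`, for `v = s₂` and `w = s₁s₃s₂s₁s₃`. -/
theorem phi₂_properties {k : Type} [Field k] {o : Fin 2 → Bool} {w : (typeA 2 o).Weyl}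
    (hw : w = (typeA 2 o).cox.wordProd [0, 2, 1, 0, 2]) :
    Function.Injective (phi₂ k (typeA 2 o) ((typeA 2 o).cox.simple 1) w) ∧
    Nonempty ((PiPair k (typeA 2 o) ((typeA 2 o).cox.simple 1) w ⧸ LinearMap.range
      (phi₂ k (typeA 2 o) ((typeA 2 o).cox.simple 1) w).toLinearMap) ≃ₗ[k] k) ∧
    ¬ Function.Surjective (phi₂ k (typeA 2 o) ((typeA 2 o).cox.simple 1) w) ∧
    ∃ β : Module.Basis CycPath k (PiPair k (typeA 2 o) ((typeA 2 o).cox.simple 1) w),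
      IsPathBasis β := by
  -- All types involved depend on the submodule, so the identification of t_w Π is transported
  -- through a predicate of submodules.
  let P : Submodule (PreprojA k o) (PreprojA k o) → Prop := fun T =>
    Function.Injective (torsionFreePartEnd k (typeA 2 o) ((typeA 2 o).cox.simple 1) T) ∧
    Nonempty ((Module.End (PreprojA k o)
      (TorsionFreePart k (typeA 2 o) ((typeA 2 o).cox.simple 1) T) ⧸ LinearMap.range
      (torsionFreePartEnd k (typeA 2 o) ((typeA 2 o).cox.simple 1) T).toLinearMap) ≃ₗ[k] k) ∧
    ¬ Function.Surjective (torsionFreePartEnd k (typeA 2 o) ((typeA 2 o).cox.simple 1) T) ∧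
    ∃ β : Module.Basis CycPath k (Module.End (PreprojA k o)
      (TorsionFreePart k (typeA 2 o) ((typeA 2 o).cox.simple 1) T)), IsPathBasis β
  have h : P (radSubmodule k o) := torsionFreePartEnd_radSubmodule k o
  rw [← torsionRadical_self_eq hw] at h
  exact h

end FinQuiver.PreprojA

theorem mainTheorem4 (o : Fin 2 → Bool) (o' : Fin 1 → Bool)
    (Q : FinQuiver (Fin 3) (Fin 2)) (hQ : Q = FinQuiver.typeA 2 o)
    (Q' : FinQuiver (Fin 2) (Fin 1)) (hQ' : Q' = FinQuiver.typeA 1 o')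
    (s : Fin 3 → Q.Weyl) (hs : s = Q.cox.simple)
    (v w : Q.Weyl) (hw : w = s 0 * s 2 * s 1 * s 0 * s 2) (hv : v = s 1) :
    Function.Injective (FinQuiver.phi₂ ℂ Q v w) ∧
    Nonempty ((FinQuiver.PiPair ℂ Q v w ⧸
      LinearMap.range (FinQuiver.phi₂ ℂ Q v w).toLinearMap) ≃ₗ[ℂ] ℂ) ∧
    ¬ Function.Surjective (FinQuiver.phi₂ ℂ Q v w) ∧
    IsAuslanderAlgebra ℂ (FinQuiver.Preproj ℂ Q') (FinQuiver.PiPair ℂ Q v w) ∧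
    globalDimension (FinQuiver.PiPair ℂ Q v w) = 2 ∧
    globalDimension (FinQuiver.PiPair ℂ Q v w)ᵐᵒᵖ = 2 ∧
    HasVirtualDimension (FinQuiver.PiPair ℂ Q v w) 2 := by
  subst hQ hQ' hs hv
  have hw' : w = (FinQuiver.typeA 2 o).cox.wordProd [0, 2, 1, 0, 2] := by
    rw [hw]
    simp only [CoxeterSystem.wordProd_cons, CoxeterSystem.wordProd_nil, mul_assoc, mul_one]
  obtain ⟨h1, h2, h3, β, hβ⟩ := FinQuiver.PreprojA.phi₂_properties (k := ℂ) hw'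
  -- The path basis of the opposite algebra gives the right global dimension.
  obtain ⟨γ, hγ⟩ := hβ.exists_op
  exact ⟨h1, h2, h3, FinQuiver.PreprojA.isAuslanderAlgebra_of_isPathBasis o' hβ, hβ.globalDimension_eq,
    hγ.globalDimension_eq, hβ.hasVirtualDimension⟩
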